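/- Let $n\ge 40$ and $m\ge 22$ be integers. Let $ABC$ be the equilateral triangle with side length $n$ and corners $A=(0,0)$, $B=(n,0)$, $C=(n/2,\,n\sqrt3/2)$, and let $M$ be its center. Let $c$ be the side $AB$, and call the closed segments $e=AM$, $f=BM$, $g=CM$ the \emph{internal segments} (so $M$ belongs to all three). Subdivide each side of the triangle into $n$ parts of length $1$; the resulting $3n$ points (including the corners) are the \emph{base vertices}. Subdivide each internal segment into $m$ parts of equal length $\gamma=\frac{n}{\sqrt3\, m}$; the resulting points other than $A,B,C$ (so including $M$) are the \emph{internal vertices}. The instance $T'_{n,m}$ consists of all base vertices and of those internal vertices whose distance to each of $A$, $B$, $C$ is at least $\max\{10,\,4+4\gamma\}$. A \emph{tour} of $T'_{n,m}$ is a closed polygon visiting each point of $T'_{n,m}$ exactly once, and it is \emph{optimum} if its Euclidean length is minimum among all tours. A \emph{trip} of an oriented tour is a subpath that starts and ends at base vertices, contains no other base vertices, and contains at least one internal vertex. The first and the last internal vertex of a trip (which may coincide) are its \emph{connection vertices}. A side of the triangle $ABC$ that contains both end vertices of a trip is called the \emph{main side} of the trip. Every optimum tour of $T'_{n,m}$,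 oriented suitably, visits the base vertices in counterclockwise order, and the following hold. 1. An optimum tour of $T'_{n,m}$ contains no trip whose two connection vertices lie on the same internal segment. 2. Let $t$ be a trip with main side $c$ in an optimum tour of $T'_{n,m}$ that is oriented such that the base vertices are visited in counterclockwise order. Then the first connection vertex of $t$ lies on $e$ and the second (last) connection vertex of $t$ lies on $f$. -/

import Mathlib

namespace Tetrahedron

/-- The Euclidean plane. -/
abbrev Plane : Type := EuclideanSpace ℝ (Fin 2)

/-- The vertex `a_i` (`0 ≤ i ≤ n`) on the base side from `B` to `C`. -/
noncomputable def aVert (n i : ℕ) : Plane :=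
  !₂[(n : ℝ) - (i : ℝ) / 2, (i : ℝ) * √3 / 2]

/-- The vertex `b_i` (`0 ≤ i ≤ n`) on the base side from `C` to `A`. -/
noncomputable def bVert (n i : ℕ) : Plane :=
  !₂[(n : ℝ) / 2 - (i : ℝ) / 2, ((n : ℝ) - (i : ℝ)) * √3 / 2]

/-- The vertex `c_i` (`0 ≤ i ≤ n`) on the base side from `A` to `B`. -/
noncomputable def cVert (i : ℕ) : Plane :=
  !₂[(i : ℝ), 0]

/-- The vertex `e_j` (`0 ≤ j ≤ m`) on the internal segment from `A` to `M`. -/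
noncomputable def eVert (n m j : ℕ) : Plane :=
  !₂[(j : ℝ) * n / (2 * m), (j : ℝ) * n / (2 * √3 * m)]

/-- The vertex `f_j` (`0 ≤ j ≤ m`) on the internal segment from `B` to `M`. -/
noncomputable def fVert (n m j : ℕ) : Plane :=
  !₂[(n : ℝ) - (j : ℝ) * n / (2 * m), (j : ℝ) * n / (2 * √3 * m)]

/-- The vertex `g_j` (`0 ≤ j ≤ m`) on the internal segment from `C` to `M`. -/
noncomputable def gVert (n m j : ℕ) : Plane :=
  !₂[(n : ℝ) / 2, (n : ℝ) * √3 / 2 - (j : ℝ) * n / (√3 * m)]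

/-- The corner `A` of the equilateral triangle of side length `n`. -/
noncomputable def cornerA : Plane := !₂[0, 0]

/-- The corner `B`. -/
noncomputable def cornerB (n : ℕ) : Plane := !₂[(n : ℝ), 0]

/-- The corner `C`. -/
noncomputable def cornerC (n : ℕ) : Plane := !₂[(n : ℝ) / 2, (n : ℝ) * √3 / 2]

/-- The center `M` of the triangle. -/
noncomputable def center (n : ℕ) : Plane := !₂[(n : ℝ) / 2, (n : ℝ) / (2 * √3)]

/-- The base side `c`, opposite to `C`. -/
def sideC (n : ℕ) : Set Plane := segment ℝ cornerA (cornerB n)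

/-- The closed internal segment `e`. -/
def segE (n : ℕ) : Set Plane := segment ℝ cornerA (center n)

/-- The closed internal segment `f`. -/
def segF (n : ℕ) : Set Plane := segment ℝ (cornerB n) (center n)

/-- The closed internal segment `g`. -/
def segG (n : ℕ) : Set Plane := segment ℝ (cornerC n) (center n)

/-- The three internal segments; the center belongs to each of them. -/
def internalSegments (n : ℕ) : Set (Set Plane) := {segE n, segF n, segG n}

/-- The base vertices. -/
def baseVertices (n : ℕ) : Set Plane :=
  {p | ∃ i ≤ n, p = aVert n i ∨ p = bVert n i ∨ p = cVert i}

/-- The internal vertices of the unmodified instance `T_{n,m}`. -/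
def internalVertices (n m : ℕ) : Set Plane :=
  {p | ∃ j, 1 ≤ j ∧ j ≤ m ∧ (p = eVert n m j ∨ p = fVert n m j ∨ p = gVert n m j)}

/-- The smallest distance `γ` between two different internal vertices. -/
noncomputable def gam (n m : ℕ) : ℝ := (n : ℝ) / (√3 * m)

/-- The modified instance `T'_{n,m}`: internal vertices at distance less than
`max {10, 4 + 4γ}` from one of the corners are removed. -/
def modifiedInstance (n m : ℕ) : Set Plane :=
  baseVertices n ∪
    {p | p ∈ internalVertices n m ∧
      ∀ q ∈ ({cornerA, cornerB n, cornerC n} : Set Plane),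
        max 10 (4 + 4 * gam n m) ≤ dist p q}

/-- An (oriented) tour of a set `V` of points, given by the list of its vertices in the order of
traversal (starting anywhere): every point of `V` is visited exactly once, and no other points. -/
def IsTour (V : Set Plane) (l : List Plane) : Prop :=
  l.Nodup ∧ ∀ p, p ∈ l ↔ p ∈ V

/-- The length of the closed polygon with the vertices `l`, including the edge from the last
vertex back to the first one. -/
noncomputable def tourLength (l : List Plane) : ℝ :=
  (List.zipWith dist l (l.rotate 1)).sum

/-- An optimum tour is a tour of minimum length. -/
def IsOptimumTour (V : Set Plane) (l : List Plane) : Prop :=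
  IsTour V l ∧ ∀ l', IsTour V l' → tourLength l ≤ tourLength l'

/-- The base vertices, each once, in counterclockwise order, starting at `A`. -/
noncomputable def baseCycle (n : ℕ) : List Plane :=
  (List.range n).map cVert ++ (List.range n).map (aVert n) ++ (List.range n).map (bVert n)

/-- The oriented tour `l` visits the base vertices in counterclockwise cyclic order. -/
def IsCounterclockwise (n : ℕ) (l : List Plane) : Prop :=
  ∃ b : List Plane, b.Sublist l ∧ b ~r baseCycle n

/-- The vertices `u`, `w`, `v` (`w` a list) form a trip of the oriented closed tour `l`: a subpath
of `l` from the base vertex `u` to the base vertex `v`, whose intermediate vertices, listed in `w`,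
are not base vertices, and which has at least one intermediate vertex. -/
structure IsTrip (n : ℕ) (l : List Plane) (u : Plane) (w : List Plane) (v : Plane) : Prop where
  start_mem : u ∈ baseVertices n
  end_mem : v ∈ baseVertices n
  ne_nil : w ≠ []
  not_base : ∀ x ∈ w, x ∉ baseVertices n
  subpath : ∃ rest : List Plane, l ~r (u :: (w ++ v :: rest))

/-- A trip with end vertices `u` and `v` has main side `s` if both end vertices belong to `s`. -/
def HasMainSide (s : Set Plane) (u v : Plane) : Prop := u ∈ s ∧ v ∈ s

end Tetrahedron

/-! Everything follows from local changes that cannot shorten an optimum tour.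

Order of the base vertices. A 2-opt exchange shows that two tour edges without a common end vertex
are disjoint (`IsOptimumTour.disjoint_edges`), unless all points are collinear, which is not the
case here. Two polygonal paths in the triangle whose ends alternate on its boundary must meet
(`polylines_meet`); a continuity argument for the angle under which one path is seen from the points
of the other replaces the Jordan curve theorem. Hence successive base vertices never separate
another such pair, and a cyclic order with this property is the boundary order or its reverse. In
particular the ends `u`, `v` of a trip are consecutive base vertices, at distance 1.

Connection vertices (`connection_side_c`). Let `p`, `q` be the connection vertices of a trip at the
side `c`. Unless they lie on `e` and `f`, both different from `M`, the direction of `pq` makes an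
angle of at least 30 degrees with `c` (`steep_or`). Reflection in `c` then gives `|up| + |uq| > |pq|
+ h`, where `h` is a lower bound for the distances of the internal vertices from `c`, and `h ≥ 2 +
2γ` by the choice of the instance. There are two cases. If the trip misses an internal vertex, close
the trip by `pq` and the rest of the tour by `uv`, and merge the two closed tours at neighbouring
internal vertices at cost `2γ`; this would be shorter. If the trip visits all internal vertices,
closing it gives a tour of the three-legged star. Such a tour has length at least `((4 + √3) K -
1/2) γ`, where `K` is the number of vertices on a leg besides `M` (`star_tour_bound`). This bound is
a linear programming dual: cuts and three-tooth comb inequalities, weighted by `cutPotential`. An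
explicit tour with one trip based in the middle of `c` (`exists_single_trip_tour`) is then shorter.

Conclusion. Points of `e` and `f` other than `M` share no internal segment, and rotation by 120
degrees carries this from `c` to the other sides. In a counterclockwise tour a trip at `c` cannot go
from `f` to `e`, because its first and last edge would cross (`crossing_at_side_c`). -/

namespace Tetrahedron

/-! ### Lengths of paths and tours -/

/-- The length of the open polygon with the vertices `l`. -/
noncomputable def pathLength : List Plane → ℝ
  | [] => 0
  | [_] => 0
  | a :: b :: l => dist a b + pathLength (b :: l)

lemma pathLength_append {X Y : List Plane} (hX : X ≠ []) (hY : Y ≠ []) :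
    pathLength (X ++ Y) = pathLength X + dist (X.getLast hX) (Y.head hY) + pathLength Y := by
  induction X with
  | nil => exact absurd rfl hX
  | cons a X ih =>
    cases X with
    | nil =>
      cases Y with
      | nil => exact absurd rfl hY
      | cons b Y => simp [pathLength]
    | cons b X =>
      have := ih (by simp)
      simp only [List.cons_append, pathLength, List.getLast_cons_cons] at this ⊢
      rw [this]; ring

lemma pathLength_reverse (X : List Plane) : pathLength X.reverse = pathLength X := by
  induction X with
  | nil => rfl
  | cons a X ih =>
    cases X with
    | nil => rfl
    | cons b X =>
      rw [List.reverse_cons, pathLength_append (by simp) (by simp), ih]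
      simp [pathLength, dist_comm, add_comm]

lemma sum_zipWith_dist (a c : Plane) (l : List Plane) :
    (List.zipWith dist (a :: l) (l ++ [c])).sum = pathLength (a :: (l ++ [c])) := by
  induction l generalizing a with
  | nil => simp [pathLength]
  | cons b l ih =>
    have := ih b
    simp only [List.cons_append, List.zipWith_cons_cons, List.sum_cons, pathLength] at this ⊢
    rw [this]

lemma tourLength_eq {X : List Plane} (hX : X ≠ []) :
    tourLength X = pathLength X + dist (X.getLast hX) (X.head hX) := by
  cases X with
  | nil => exact absurd rfl hX
  | cons a X =>
    rw [tourLength, List.rotate_cons_succ, List.rotate_zero, sum_zipWith_dist,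
      ← List.cons_append, pathLength_append (by simp) (by simp)]
    simp [pathLength]

lemma tourLength_append {X Y : List Plane} (hX : X ≠ []) (hY : Y ≠ []) :
    tourLength (X ++ Y) = pathLength X + pathLength Y + dist (X.getLast hX) (Y.head hY) +
      dist (Y.getLast hY) (X.head hX) := by
  rw [tourLength_eq (by simp [hX]), pathLength_append hX hY, List.getLast_append_of_ne_nil _ hY,
    List.head_append_of_ne_nil hX]
  ring

lemma tourLength_append_comm (X Y : List Plane) : tourLength (X ++ Y) = tourLength (Y ++ X) := by
  by_cases hX : X = []
  · simp [hX]
  by_cases hY : Y = []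
  · simp [hY]
  rw [tourLength_append hX hY, tourLength_append hY hX]
  ring

lemma isRotated_iff_append {α : Type*} {l l' : List α} :
    l ~r l' ↔ ∃ X Y, l = X ++ Y ∧ l' = Y ++ X := by
  constructor
  · rintro h
    obtain ⟨k, hk, rfl⟩ := List.isRotated_iff_mod.1 h
    exact ⟨l.take k, l.drop k, by simp, List.rotate_eq_drop_append_take hk⟩
  · rintro ⟨X, Y, rfl, rfl⟩
    exact List.isRotated_append

lemma tourLength_of_isRotated {l l' : List Plane} (h : l ~r l') :
    tourLength l = tourLength l' := by
  obtain ⟨X, Y, rfl, rfl⟩ := isRotated_iff_append.1 h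
  exact tourLength_append_comm X Y

lemma tourLength_reverse (l : List Plane) : tourLength l.reverse = tourLength l := by
  by_cases h : l = []
  · simp [h]
  rw [tourLength_eq (by simpa using h), tourLength_eq h, pathLength_reverse]
  simp [dist_comm]

lemma IsTour.of_perm {V : Set Plane} {l l' : List Plane} (h : IsTour V l) (hp : l.Perm l') :
    IsTour V l' :=
  ⟨hp.nodup_iff.1 h.1, fun p => by rw [← h.2 p, hp.mem_iff]⟩

lemma IsOptimumTour.of_isRotated {V : Set Plane} {l l' : List Plane} (h : IsOptimumTour V l)
    (hr : l ~r l') : IsOptimumTour V l' :=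
  ⟨h.1.of_perm hr.perm, fun k hk => by rw [← tourLength_of_isRotated hr]; exact h.2 k hk⟩

lemma IsOptimumTour.le_of_perm {V : Set Plane} {l l' : List Plane} (h : IsOptimumTour V l)
    (hp : l.Perm l') : tourLength l ≤ tourLength l' :=
  h.2 _ (h.1.of_perm hp)

/-- A 2-opt move does not improve an optimum tour. -/
lemma IsOptimumTour.two_opt {V : Set Plane} {B D : List Plane} (h : IsOptimumTour V (B ++ D))
    (hB : B ≠ []) (hD : D ≠ []) :
    dist (B.getLast hB) (D.head hD) + dist (D.getLast hD) (B.head hB) ≤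
      dist (B.getLast hB) (D.getLast hD) + dist (D.head hD) (B.head hB) := by
  have h1 := h.le_of_perm (l' := B ++ D.reverse)
    (List.Perm.append_left B D.reverse_perm.symm)
  rw [tourLength_append hB hD, tourLength_append hB (by simpa using hD), pathLength_reverse,
    List.head_reverse, List.getLast_reverse] at h1
  linarith

/-- The two closing edges are traded for two connecting ones, each bounded by a walk along a closing
edge and the segment between the head of `X` and the last vertex of `Y`. -/
lemma tourLength_append_le {X Y : List Plane} (hX : X ≠ []) (hY : Y ≠ []) :
    tourLength (X ++ Y) ≤
      tourLength X + tourLength Y + 2 * dist (X.head hX) (Y.getLast hY) := by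
  rw [tourLength_append hX hY, tourLength_eq hX, tourLength_eq hY]
  have h1 := dist_triangle4 (X.getLast hX) (X.head hX) (Y.getLast hY) (Y.head hY)
  have h2 := dist_comm (X.head hX) (Y.getLast hY)
  linarith

/-- Closing the subpath `w` of an optimum tour `w ++ Y` and merging the two closed tours again
at `x ∈ w` and `y ∈ Y` does not improve the tour. -/
lemma IsOptimumTour.merge {V : Set Plane} {w Y : List Plane} (h : IsOptimumTour V (w ++ Y))
    (hw : w ≠ []) (hY : Y ≠ []) {x y : Plane} (hx : x ∈ w) (hy : y ∈ Y) :
    dist (w.getLast hw) (Y.head hY) + dist (Y.getLast hY) (w.head hw) ≤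
      dist (w.getLast hw) (w.head hw) + dist (Y.getLast hY) (Y.head hY) + 2 * dist x y := by
  obtain ⟨w₁, w₂, rfl⟩ := List.append_of_mem hx
  obtain ⟨Y₁, Y₂, rfl⟩ := List.append_of_mem hy
  -- The closed tours are rotated so that the first one starts at `x` and the second one ends at
  -- `y`.
  have hw' : (w₁ ++ x :: w₂) ~r ((x :: w₂) ++ w₁) := List.isRotated_append
  have hY' : (Y₁ ++ y :: Y₂) ~r (Y₂ ++ (Y₁ ++ [y])) := by
    have : Y₁ ++ y :: Y₂ = (Y₁ ++ [y]) ++ Y₂ := by simp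
    rw [this]; exact List.isRotated_append
  have h1 := h.le_of_perm (hw'.perm.append hY'.perm)
  have h2 := tourLength_append_le (X := (x :: w₂) ++ w₁) (Y := Y₂ ++ (Y₁ ++ [y]))
    (by simp) (by simp)
  rw [← tourLength_of_isRotated hw', ← tourLength_of_isRotated hY'] at h2
  rw [tourLength_append hw hY] at h1
  rw [tourLength_eq hw, tourLength_eq hY] at h2
  have h3 : (Y₂ ++ (Y₁ ++ [y])).getLast (by simp) = y := by simp
  have h4 : ((x :: w₂) ++ w₁).head (by simp) = x := by simp
  rw [h3, h4] at h2
  linarith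

/-! ### Edges of an optimum tour do not cross -/

lemma dist_line (o d : Plane) (s t : ℝ) : dist (o + s • d) (o + t • d) = |s - t| * ‖d‖ := by
  rw [dist_add_left, dist_eq_norm, ← sub_smul, norm_smul, Real.norm_eq_abs]

/-- If the triangle inequality from `o + b • d` via `o + a • d` to `z` is tight, then `z` lies
on the same line, beyond `o + a • d`. -/
lemma exists_line_of_dist_le {o d z : Plane} {a b : ℝ} (hd : d ≠ 0) (hab : a ≠ b)
    (hz : z ≠ o + a • d)
    (h : dist (o + b • d) (o + a • d) + dist (o + a • d) z ≤ dist (o + b • d) z) :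
    ∃ r > 0, z = o + (a + r * (a - b)) • d := by
  have h1 : Wbtw ℝ (o + b • d) (o + a • d) z :=
    dist_add_dist_eq_iff.1 (le_antisymm h (dist_triangle _ _ _))
  have hne : o + b • d ≠ o + a • d := by
    intro h2
    have := sub_eq_zero.2 (add_left_cancel h2)
    rw [← sub_smul] at this
    rcases smul_eq_zero.1 this with h3 | h3
    · exact hab (by linarith)
    · exact hd h3
  obtain ⟨t, ht, hz'⟩ := h1.right_mem_image_Ici_of_left_ne hne
  simp only [Set.mem_Ici] at ht
  have hz2 : z = o + (a + (t - 1) * (a - b)) • d := by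
    rw [← hz', AffineMap.lineMap_apply]
    simp only [vsub_eq_sub, vadd_eq_add, add_sub_add_left_eq_sub]
    module
  refine ⟨t - 1, ?_, hz2⟩
  rcases ht.lt_or_eq with h2 | h2
  · linarith
  · exact absurd (by rw [hz2, ← h2]; simp) hz

/-- Two overlapping tour edges on one line, traversed in opposite directions, can be exchanged
without changing the length, so this exchange gives no contradiction. Instead collinearity is
propagated through the arc `B`, vertex by vertex: the next edge of `B` takes the place of one of the
two edges, and the overlap persists. -/
lemma collinear_of_overlap {V : Set Plane} {o d : Plane} (hd : d ≠ 0) (N : ℕ) :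
    ∀ (B D : List Plane) (_ : B.length = N) (hB : B ≠ []) (hD : D ≠ [])
      (_ : IsOptimumTour V (B ++ D)) (a a' b b' : ℝ)
      (_ : D.getLast hD = o + a • d) (_ : B.head hB = o + a' • d)
      (_ : D.head hD = o + b • d) (_ : B.getLast hB = o + b' • d)
      (_ : a < a') (_ : b < b') (_ : a < b') (_ : b < a'),
      ∀ x ∈ B, ∃ r : ℝ, x = o + r • d := by
  induction N with
  | zero =>
    intro B D hN hB
    exact absurd (List.length_eq_zero_iff.1 hN) hB
  | succ N ih =>
    intro B D hN hB hD hopt a a' b b' hp hp' hq' hq h1 h2 h3 h4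
    have hdpos : 0 < ‖d‖ := norm_pos_iff.2 hd
    -- If `a' < b'`, the head of `B` lies strictly inside the other edge. The 2-opt inequality for
    -- the edge leaving this head makes a triangle inequality tight, so the next vertex lies on the
    -- line, further up. If `a' > b'`, the same happens at the other end of `B`.
    rcases lt_trichotomy a' b' with hlt | heq | hgt
    · match B, hB, hp', hq with
      | [p'], _, hp', _ =>
        intro x hx
        rw [List.mem_singleton] at hx
        exact ⟨a', by rw [hx]; exact hp'⟩
      | p' :: p'' :: B, _, hp', hq =>
        simp only [List.head_cons] at hp'
        have hopt' : IsOptimumTour V ((p'' :: B) ++ (D ++ [p'])) := by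
          refine hopt.of_isRotated ?_
          have := List.isRotated_append (l := [p']) (l' := p'' :: B ++ D)
          simpa using this
        have hne : p'' ≠ p' := by
          rintro rfl
          have := hopt.1.1
          simp at this
        have h5 := hopt'.two_opt (by simp) (by simp)
        rw [List.getLast_append_of_ne_nil _ (by simp),
          List.head_append_of_ne_nil hD] at h5
        simp only [List.getLast_cons_cons] at hq
        simp only [List.getLast_singleton, List.head_cons] at h5
        rw [hq, hq', hp', dist_line, dist_line] at h5
        have h6 : dist (o + b • d) (o + a' • d) + dist (o + a' • d) p'' ≤
            dist (o + b • d) p'' := by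
          rw [dist_line, abs_of_neg (by linarith)]
          rw [abs_of_pos (by linarith), abs_of_pos (by linarith)] at h5
          nlinarith
        obtain ⟨r, hr, hp2⟩ := exists_line_of_dist_le hd (by linarith : b < a').ne'
          (by rw [← hp']; exact hne) h6
        have h7 := ih (p'' :: B) (D ++ [p']) (by simpa using hN) (by simp) (by simp) hopt'
          a' (a' + r * (a' - b)) b b' (by simpa using hp') (by simpa using hp2)
          (by rw [List.head_append_of_ne_nil hD]; exact hq') hq (by nlinarith) h2 hlt (by nlinarith)
        intro x hx
        rcases List.mem_cons.1 hx with rfl | hx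
        · exact ⟨a', hp'⟩
        · exact h7 x hx
    · have hn := (List.nodup_append.1 hopt.1.1).1
      have : B.head hB = B.getLast hB := by rw [hp', hq, heq]
      match B, hB, this with
      | [p'], _, _ =>
        intro x hx
        rw [List.mem_singleton] at hx
        exact ⟨a', by rw [hx]; exact hp'⟩
      | p' :: p'' :: B, _, this =>
        simp only [List.head_cons, List.getLast_cons_cons] at this
        exact absurd (this ▸ List.getLast_mem (by simp)) (List.nodup_cons.1 hn).1
    · rcases List.eq_nil_or_concat B with rfl | ⟨B₁, q, rfl⟩
      · exact absurd rfl hB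
      rcases List.eq_nil_or_concat B₁ with rfl | ⟨B₂, q₁, rfl⟩
      · intro x hx
        simp only [List.concat_eq_append, List.nil_append, List.mem_singleton] at hx
        exact ⟨a', by rw [hx]; simpa using hp'⟩
      simp only [List.concat_eq_append] at *
      rw [List.head_append_of_ne_nil (by simp)] at hp'
      simp only [List.getLast_append_singleton] at hq
      have hopt' : IsOptimumTour V ((B₂ ++ [q₁]) ++ (q :: D)) := by
        simpa using hopt
      have hne : q₁ ≠ q := by
        rintro rfl
        have := hopt.1.1
        simp [List.nodup_append] at this
      have h5 := hopt'.two_opt (by simp) (by simp)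
      simp only [List.getLast_append_singleton, List.head_cons, List.getLast_cons hD] at h5
      rw [hp, hp', hq, dist_line, dist_line] at h5
      have h6 : dist (o + a • d) (o + b' • d) + dist (o + b' • d) q₁ ≤ dist (o + a • d) q₁ := by
        rw [dist_line, abs_of_neg (by linarith), dist_comm _ q₁, dist_comm _ q₁]
        rw [abs_of_neg (by linarith), abs_of_neg (by linarith)] at h5
        nlinarith
      obtain ⟨r, hr, hp2⟩ := exists_line_of_dist_le hd (by linarith : a < b').ne'
        (by rw [← hq]; exact hne) h6
      have h7 := ih (B₂ ++ [q₁]) (q :: D) (by simpa using hN) (by simp) (by simp) hopt'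
        a a' b' (b' + r * (b' - a)) (by rw [List.getLast_cons hD]; exact hp) hp'
        (by simpa using hq) (by simpa using hp2) h1 (by nlinarith) (by nlinarith) (by linarith)
      intro x hx
      rcases List.mem_append.1 hx with hx | hx
      · exact h7 x hx
      · exact ⟨b', by rw [List.mem_singleton.1 hx]; exact hq⟩

lemma dist_mem_segment {o p p' : Plane} (h : o ∈ segment ℝ p p') :
    dist p o + dist o p' = dist p p' :=
  dist_add_dist_eq_iff.2 (mem_segment_iff_wbtw.1 h)

/-- Through a common point `x` of the two edges, the triangle inequality bounds the exchanged edges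
by the old ones. Optimality forces equality, hence four collinear ends, and `collinear_of_overlap`
spreads this to both arcs. It is enough that `x` is not an end of one of the two edges. -/
lemma all_collinear_of_cross {V : Set Plane} {B D : List Plane} (h : IsOptimumTour V (B ++ D))
    (hB : B ≠ []) (hD : D ≠ []) {x : Plane} (hx1 : x ∈ segment ℝ (D.getLast hD) (B.head hB))
    (hx2 : x ∈ segment ℝ (B.getLast hB) (D.head hD)) (hne : x ≠ D.getLast hD) (hne' : x ≠ B.head hB)
    (hpp : D.getLast hD ≠ B.head hB) (hqq : B.getLast hB ≠ D.head hD) :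
    ∃ o d : Plane, ∀ y ∈ V, ∃ r : ℝ, y = o + r • d := by
  have h0 := h.two_opt hB hD
  have e1 := dist_mem_segment hx1
  have e2 := dist_mem_segment hx2
  have t1 := dist_triangle (B.getLast hB) x (D.getLast hD)
  have t2 := dist_triangle (D.head hD) x (B.head hB)
  have c1 := dist_comm x (D.getLast hD)
  have c2 := dist_comm x (D.head hD)
  have c3 := dist_comm x (B.getLast hB)
  have c4 := dist_comm x (B.head hB)
  have c5 := dist_comm (B.getLast hB) (D.getLast hD)
  have c6 := dist_comm (D.head hD) (B.head hB)
  set p := D.getLast hD with hp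
  set p' := B.head hB with hp'
  set q := B.getLast hB with hq
  set q' := D.head hD with hq'
  obtain ⟨t, ⟨ht0, ht1⟩, hxt⟩ := (segment_eq_image' ℝ p p') ▸ hx1
  simp only at hxt
  have hd : p' - p ≠ 0 := sub_ne_zero.2 hpp.symm
  have ht0' : 0 < t := lt_of_le_of_ne ht0 (by rintro rfl; exact hne (by simpa using hxt.symm))
  have ht1' : t < 1 := lt_of_le_of_ne ht1 (by rintro rfl; exact hne' (by simpa using hxt.symm))
  have hpl : p = p + (0 : ℝ) • (p' - p) := by simp
  have hpl' : p' = p + (1 : ℝ) • (p' - p) := by simp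
  -- Tightness of the triangle inequality from `p` via `x` places `q` at a parameter at least `t`;
  -- symmetrically, tightness from `p'` places `q'` at a parameter at most `t`.
  have hq1 : ∃ b', t ≤ b' ∧ q = p + b' • (p' - p) := by
    by_cases hqx : q = x
    · exact ⟨t, le_rfl, by rw [hqx, hxt]⟩
    obtain ⟨r, hr, h3⟩ := exists_line_of_dist_le (o := p) (d := p' - p) (z := q) (a := t) (b := 0)
      hd ht0'.ne' (by rw [hxt]; exact hqx) (by rw [← hpl, hxt]; linarith)
    exact ⟨_, by nlinarith, h3⟩
  have hq2 : ∃ b, b ≤ t ∧ q' = p + b • (p' - p) := by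
    by_cases hqx : q' = x
    · exact ⟨t, le_rfl, by rw [hqx, hxt]⟩
    obtain ⟨r, hr, h3⟩ := exists_line_of_dist_le (o := p) (d := p' - p) (z := q') (a := t) (b := 1)
      hd ht1'.ne (by rw [hxt]; exact hqx) (by rw [← hpl', hxt]; linarith)
    exact ⟨_, by nlinarith, h3⟩
  obtain ⟨b', hb', hqb⟩ := hq1
  obtain ⟨b, hb, hqb'⟩ := hq2
  have hbb : b < b' := lt_of_le_of_ne (by linarith) (by rintro rfl; exact hqq (hqb.trans hqb'.symm))
  have k1 := collinear_of_overlap hd _ B D rfl hB hD h 0 1 b b' (by rw [← hp]; exact hpl)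
    (by rw [← hp']; exact hpl') (by rw [← hq']; exact hqb') (by rw [← hq]; exact hqb)
    one_pos hbb (by linarith) (by linarith)
  -- For the arc `D` the line is traversed in the opposite direction, which negates all parameters.
  have k2 := collinear_of_overlap (o := p) (neg_ne_zero.2 hd) _ D B rfl hD hB
    (h.of_isRotated List.isRotated_append) (-b') (-b) (-1) 0
    (by rw [← hq, hqb]; module) (by rw [← hq', hqb']; module) (by rw [← hp']; simp)
    (by rw [← hp]; simp) (by linarith) (by linarith) (by linarith) (by linarith)
  refine ⟨p, p' - p, fun y hy => ?_⟩
  rcases List.mem_append.1 ((h.1.2 y).2 hy) with hy | hy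
  · exact k1 y hy
  · obtain ⟨r, hr⟩ := k2 y hy
    exact ⟨-r, by rw [hr]; module⟩

/-- Two vertex-disjoint edges of an optimum tour are disjoint, unless all points are collinear. -/
lemma IsOptimumTour.disjoint_edges {V : Set Plane} {B D : List Plane}
    (h : IsOptimumTour V (B ++ D)) (hB : B ≠ []) (hD : D ≠ [])
    (hBne : B.head hB ≠ B.getLast hB) (hDne : D.head hD ≠ D.getLast hD)
    (hV : ¬ ∃ o d : Plane, ∀ y ∈ V, ∃ r : ℝ, y = o + r • d) :
    Disjoint (segment ℝ (D.getLast hD) (B.head hB)) (segment ℝ (B.getLast hB) (D.head hD)) := by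
  rw [Set.disjoint_left]
  intro x hx1 hx2
  apply hV
  have hdisj : ∀ a ∈ B, ∀ b ∈ D, a ≠ b := (List.nodup_append.1 h.1.1).2.2
  have n1 := hdisj _ (List.head_mem hB) _ (List.getLast_mem hD)
  have n2 := hdisj _ (List.getLast_mem hB) _ (List.head_mem hD)
  have n3 := hdisj _ (List.head_mem hB) _ (List.head_mem hD)
  have n4 := hdisj _ (List.getLast_mem hB) _ (List.getLast_mem hD)
  -- A common point that is an end of one edge is not an end of the other, so the two edges can
  -- exchange roles.
  by_cases hx : x = D.getLast hD ∨ x = B.head hB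
  · refine all_collinear_of_cross (h.of_isRotated List.isRotated_append) hD hB hx2 hx1 ?_ ?_ n2 n1.symm
    · rcases hx with rfl | rfl
      · exact n4.symm
      · exact hBne
    · rcases hx with rfl | rfl
      · exact hDne.symm
      · exact n3
  · push Not at hx
    exact all_collinear_of_cross h hB hD hx1 hx2 hx.1 hx.2 n1.symm n2

/-! ### Crossing polygonal paths in the complex plane -/

/-- The total angle under which the polygonal path `l` is seen from `ζ`. -/
noncomputable def angleSum (ζ : ℂ) : List ℂ → ℝ
  | [] => 0
  | [_] => 0
  | a :: b :: l => Complex.arg ((b - ζ) / (a - ζ)) + angleSum ζ (b :: l)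

/-- The polygonal path with the vertices `l`, as a point set. -/
def polyline : List ℂ → Set ℂ
  | [] => ∅
  | [a] => {a}
  | a :: b :: l => segment ℝ a b ∪ polyline (b :: l)

lemma head_mem_polyline (a : ℂ) (l : List ℂ) : a ∈ polyline (a :: l) := by
  cases l with
  | nil => rfl
  | cons b l => exact Or.inl (left_mem_segment ℝ a b)

lemma mem_polyline_of_mem {l : List ℂ} {x : ℂ} (hx : x ∈ l) : x ∈ polyline l := by
  induction l with
  | nil => simp at hx
  | cons a l ih =>
    rcases List.mem_cons.1 hx with rfl | hx
    · exact head_mem_polyline _ _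
    · cases l with
      | nil => simp at hx
      | cons b l => exact Or.inr (ih hx)

lemma isPreconnected_polyline (l : List ℂ) : IsPreconnected (polyline l) := by
  induction l with
  | nil => exact isPreconnected_empty
  | cons a l ih =>
    cases l with
    | nil => exact isPreconnected_singleton
    | cons b l =>
      exact IsPreconnected.union b (right_mem_segment ℝ a b) (head_mem_polyline b l)
        (convex_segment a b).isPreconnected ih

lemma polyline_subset {l : List ℂ} {S : Set ℂ} (hS : Convex ℝ S) (h : ∀ x ∈ l, x ∈ S) :
    polyline l ⊆ S := by
  induction l with
  | nil => exact Set.empty_subset _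
  | cons a l ih =>
    cases l with
    | nil => simpa [polyline] using h
    | cons b l =>
      exact Set.union_subset (hS.segment_subset (h a (by simp)) (h b (by simp)))
        (ih fun x hx => h x (List.mem_cons_of_mem a hx))

lemma exists_edge_of_mem_polyline {l : List ℂ} (hl : 2 ≤ l.length) {ζ : ℂ} (h : ζ ∈ polyline l) :
    ∃ U p p' V, l = U ++ p :: p' :: V ∧ ζ ∈ segment ℝ p p' := by
  induction l with
  | nil => simp at hl
  | cons a l ih =>
    match l, hl, h, ih with
    | b :: l, _, h, ih =>
      rcases h with h | h
      · exact ⟨[], a, b, l, rfl, h⟩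
      · match l, h, ih with
        | [], h, _ =>
          have h' : ζ = b := h
          exact ⟨[], a, b, [], rfl, h' ▸ right_mem_segment ℝ a b⟩
        | c :: l, h, ih =>
          obtain ⟨U, p, p', V, h1, h2⟩ := ih (by simp) h
          exact ⟨a :: U, p, p', V, by rw [h1]; rfl, h2⟩

/-- A zero or negative real quotient puts `ζ` on the segment. Off the edge, the argument of the
quotient therefore depends continuously on `ζ`. -/
lemma div_mem_slitPlane {a b ζ : ℂ} (h : ζ ∉ segment ℝ a b) :
    (b - ζ) / (a - ζ) ∈ Complex.slitPlane := by
  by_contra hs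
  apply h
  rw [Complex.mem_slitPlane_iff] at hs
  push Not at hs
  obtain ⟨h1, h2⟩ := hs
  have ha : a - ζ ≠ 0 := by
    intro h0
    exact h (by rw [← sub_eq_zero.1 h0]; exact left_mem_segment ℝ a b)
  set t : ℝ := -((b - ζ) / (a - ζ)).re with ht
  have h3 : (b - ζ) / (a - ζ) = ((-t : ℝ) : ℂ) := by
    apply Complex.ext
    · simp [ht]
    · simpa using h2
  have h4 : b - ζ = ((-t : ℝ) : ℂ) * (a - ζ) := by rw [← h3]; field_simp
  have ht0 : 0 ≤ t := by linarith
  refine ⟨t / (1 + t), 1 / (1 + t), by positivity, by positivity, by field_simp; ring, ?_⟩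
  have h5 : ((1 + t : ℝ) : ℂ) ≠ 0 := by
    exact_mod_cast (by positivity : (1 + t : ℝ) ≠ 0)
  simp only [Complex.real_smul]
  push_cast at h4 h5 ⊢
  field_simp
  linear_combination h4

lemma continuousOn_angleSum (l : List ℂ) :
    ContinuousOn (fun ζ => angleSum ζ l) (polyline l)ᶜ := by
  induction l with
  | nil => exact continuousOn_const
  | cons a l ih =>
    cases l with
    | nil => exact continuousOn_const
    | cons b l =>
      simp only [angleSum]
      refine ContinuousOn.add ?_ (ih.mono (Set.compl_subset_compl.2 Set.subset_union_right))
      intro ζ hζ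
      have h1 : ζ ∉ segment ℝ a b := fun h => hζ (Or.inl h)
      have ha : a - ζ ≠ 0 := by
        intro h0
        exact h1 (by rw [← sub_eq_zero.1 h0]; exact left_mem_segment ℝ a b)
      have h2 : ContinuousAt (fun ζ : ℂ => (b - ζ) / (a - ζ)) ζ :=
        ContinuousAt.div (by fun_prop) (by fun_prop) ha
      exact (ContinuousAt.comp (f := fun ζ : ℂ => (b - ζ) / (a - ζ))
        (Complex.continuousAt_arg (div_mem_slitPlane h1)) h2).continuousWithinAt

/-- The quotients along the path telescope, so `angleSum` is a real lift of the argument of the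
quotient of the end points; unlike the principal argument, this lift is continuous off the path. -/
lemma ratio_eq_exp_angleSum (l : List ℂ) (a : ℂ) {ζ : ℂ} (h : ζ ∉ polyline (a :: l)) :
    ∃ r : ℝ, 0 < r ∧ (a :: l).getLast (by simp) - ζ =
      (a - ζ) * (r * Complex.exp (angleSum ζ (a :: l) * Complex.I)) := by
  induction l generalizing a with
  | nil => exact ⟨1, one_pos, by simp [angleSum]⟩
  | cons b l ih =>
    obtain ⟨r, hr, h1⟩ := ih b fun h' => h (Or.inr h')
    have ha : a - ζ ≠ 0 := by
      intro h0
      exact h (by rw [← sub_eq_zero.1 h0]; exact head_mem_polyline _ _)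
    have hb : b - ζ ≠ 0 := by
      intro h0
      exact h (by rw [← sub_eq_zero.1 h0]; exact Or.inr (head_mem_polyline _ _))
    have h2 := Complex.norm_mul_exp_arg_mul_I ((b - ζ) / (a - ζ))
    refine ⟨‖(b - ζ) / (a - ζ)‖ * r, mul_pos (norm_pos_iff.2 (div_ne_zero hb ha)) hr, ?_⟩
    rw [List.getLast_cons_cons, h1]
    simp only [angleSum]
    push_cast
    rw [add_mul, Complex.exp_add]
    rw [eq_div_iff ha] at h2
    linear_combination (r * Complex.exp (angleSum ζ (b :: l) * Complex.I)) * (-h2)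

/-- Both arguments lie in `[0, π]`, so their difference can fail to be a principal argument only if
it is `-π`; then the quotient would be a negative real. -/
lemma arg_div_of_im_nonneg {a b : ℂ} (ha : 0 ≤ a.im) (hb : 0 ≤ b.im) (ha0 : a ≠ 0) (hb0 : b ≠ 0)
    (hs : b / a ∈ Complex.slitPlane) : Complex.arg (b / a) = Complex.arg b - Complex.arg a := by
  have h1 := Complex.arg_div_coe_angle hb0 ha0
  rw [← Real.Angle.coe_sub] at h1
  have a0 := Complex.arg_nonneg_iff.2 ha
  have b0 := Complex.arg_nonneg_iff.2 hb
  have a1 := Complex.arg_le_pi a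
  have b1 := Complex.arg_le_pi b
  have hne := Complex.mem_slitPlane_iff_arg.1 hs
  by_cases h2 : b.arg - a.arg = -Real.pi
  · exfalso
    apply hne.1
    have : b.arg - a.arg = -Real.pi := h2
    rw [h2] at h1
    have h3 : ((-Real.pi : ℝ) : Real.Angle) = (Real.pi : ℝ) := by
      rw [Real.Angle.coe_neg, Real.Angle.neg_coe_pi]
    rw [h3] at h1
    have := congrArg Real.Angle.toReal h1
    rwa [Complex.arg_coe_angle_toReal_eq_arg, Real.Angle.toReal_pi] at this
  · have h3 : -Real.pi < b.arg - a.arg := lt_of_le_of_ne (by linarith) (Ne.symm h2)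
    have := congrArg Real.Angle.toReal h1
    rwa [Complex.arg_coe_angle_toReal_eq_arg,
      Real.Angle.toReal_coe_eq_self_iff.2 ⟨h3, by linarith⟩] at this

/-- A path that stays in a half plane whose boundary contains `ζ` does not wind around `ζ`. -/
lemma angleSum_of_halfPlane {ζ d : ℂ} (hd : d ≠ 0) (l : List ℂ) (a : ℂ)
    (h : ζ ∉ polyline (a :: l)) (hl : ∀ p ∈ a :: l, 0 ≤ ((p - ζ) / d).im) :
    angleSum ζ (a :: l) =
      Complex.arg (((a :: l).getLast (by simp) - ζ) / d) - Complex.arg ((a - ζ) / d) := by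
  induction l generalizing a with
  | nil => simp [angleSum]
  | cons b l ih =>
    have h1 := ih b (fun h' => h (Or.inr h')) fun p hp => hl p (List.mem_cons_of_mem a hp)
    have hs : ζ ∉ segment ℝ a b := fun h' => h (Or.inl h')
    have ha : a - ζ ≠ 0 := by
      intro h0
      exact h (by rw [← sub_eq_zero.1 h0]; exact head_mem_polyline _ _)
    have hb : b - ζ ≠ 0 := by
      intro h0
      exact h (by rw [← sub_eq_zero.1 h0]; exact Or.inr (head_mem_polyline _ _))
    have h2 : (b - ζ) / (a - ζ) = ((b - ζ) / d) / ((a - ζ) / d) := by field_simp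
    have h3 := arg_div_of_im_nonneg (hl a (by simp)) (hl b (by simp)) (div_ne_zero ha hd)
      (div_ne_zero hb hd) (h2 ▸ div_mem_slitPlane hs)
    rw [List.getLast_cons_cons]
    simp only [angleSum]
    rw [h1, h2, h3]
    ring

lemma abs_angleSum_le_pi {ζ d : ℂ} (hd : d ≠ 0) (l : List ℂ) (a : ℂ)
    (h : ζ ∉ polyline (a :: l)) (hl : ∀ p ∈ a :: l, 0 ≤ ((p - ζ) / d).im) :
    |angleSum ζ (a :: l)| ≤ Real.pi := by
  rw [angleSum_of_halfPlane hd l a h hl]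
  have h1 := Complex.arg_nonneg_iff.2 (hl a (by simp))
  have h2 := Complex.arg_nonneg_iff.2 (hl _ (List.getLast_mem (by simp)))
  have h3 := Complex.arg_le_pi ((a - ζ) / d)
  have h4 := Complex.arg_le_pi (((a :: l).getLast (by simp) - ζ) / d)
  rw [abs_le]
  constructor <;> linarith

/-- The signed area of the parallelogram spanned by `y - ζ` and `x - ζ`. -/
noncomputable def cross (ζ x y : ℂ) : ℝ := ((y - ζ) * (starRingEnd ℂ) (x - ζ)).im

lemma cross_eq (ζ x y : ℂ) :
    cross ζ x y = (x.re - ζ.re) * (y.im - ζ.im) - (x.im - ζ.im) * (y.re - ζ.re) := by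
  simp [cross]; ring

lemma cross_eq_sin (l : List ℂ) (x : ℂ) {ζ : ℂ} (h : ζ ∉ polyline (x :: l)) :
    ∃ r : ℝ, 0 < r ∧ cross ζ x ((x :: l).getLast (by simp)) =
      r * Real.sin (angleSum ζ (x :: l)) := by
  obtain ⟨r, hr, h1⟩ := ratio_eq_exp_angleSum l x h
  have ha : x - ζ ≠ 0 := by
    intro h0
    exact h (by rw [← sub_eq_zero.1 h0]; exact head_mem_polyline _ _)
  refine ⟨r * ‖x - ζ‖ ^ 2, by positivity, ?_⟩
  rw [cross, h1]
  have : (x - ζ) * (r * Complex.exp (angleSum ζ (x :: l) * Complex.I)) *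
      (starRingEnd ℂ) (x - ζ) =
      ((r * ‖x - ζ‖ ^ 2 : ℝ) : ℂ) * Complex.exp (angleSum ζ (x :: l) * Complex.I) := by
    have := Complex.mul_conj' (x - ζ)
    push_cast
    rw [← this]; ring
  rw [this, Complex.im_ofReal_mul, Complex.exp_ofReal_mul_I_im]

/-- Two paths in a convex region cross if the end points `z`, `w` of one of them lie on different
sides of the line through the end points `x`, `y` of the other one. -/
lemma not_disjoint_of_cross_neg {x z : ℂ} {P Q : List ℂ} {dz dw : ℂ} (hdz : dz ≠ 0) (hdw : dw ≠ 0)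
    (hz : ∀ p ∈ x :: P, 0 ≤ ((p - z) / dz).im)
    (hw : ∀ p ∈ x :: P, 0 ≤ ((p - (z :: Q).getLast (by simp)) / dw).im)
    (hc : cross z x ((x :: P).getLast (by simp)) *
      cross ((z :: Q).getLast (by simp)) x ((x :: P).getLast (by simp)) < 0)
    (hpos : ∀ ζ ∈ polyline (z :: Q), ∀ r : ℝ, 0 < r →
      (x :: P).getLast (by simp) - ζ ≠ (x - ζ) * r) :
    ¬ Disjoint (polyline (x :: P)) (polyline (z :: Q)) := by
  intro hdis
  have hsub : ∀ ζ ∈ polyline (z :: Q), ζ ∉ polyline (x :: P) := fun ζ h =>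
    Set.disjoint_right.1 hdis h
  have hzm := head_mem_polyline z Q
  have hwm : (z :: Q).getLast (by simp) ∈ polyline (z :: Q) :=
    mem_polyline_of_mem (List.getLast_mem _)
  set w := (z :: Q).getLast (by simp)
  have h1 := abs_le.1 (abs_angleSum_le_pi hdz P x (hsub z hzm) hz)
  have h2 := abs_le.1 (abs_angleSum_le_pi hdw P x (hsub w hwm) hw)
  obtain ⟨r1, hr1, e1⟩ := cross_eq_sin P x (hsub z hzm)
  obtain ⟨r2, hr2, e2⟩ := cross_eq_sin P x (hsub w hwm)
  rw [e1, e2] at hc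
  set θ : ℂ → ℝ := fun ζ => angleSum ζ (x :: P)
  have hcont : ContinuousOn θ (polyline (z :: Q)) :=
    (continuousOn_angleSum (x :: P)).mono hsub
  have hconn := ((isPreconnected_polyline (z :: Q)).image θ hcont).ordConnected
  -- At the ends of the second path the half-plane hypotheses confine the angle to `[-π, π]`, where
  -- a nonzero sine determines its sign. That sine has the sign of `cross`.
  have hnn : ∀ t : ℝ, |t| ≤ Real.pi → 0 < Real.sin t → 0 ≤ t := by
    intro t ht hs
    by_contra hneg
    push Not at hneg
    have := Real.sin_nonpos_of_nonpos_of_neg_pi_le hneg.le (abs_le.1 ht).1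
    linarith
  have hnp : ∀ t : ℝ, |t| ≤ Real.pi → Real.sin t < 0 → t ≤ 0 := by
    intro t ht hs
    by_contra hneg
    push Not at hneg
    have := Real.sin_nonneg_of_nonneg_of_le_pi hneg.le (abs_le.1 ht).2
    linarith
  have hsin : Real.sin (θ z) * Real.sin (θ w) < 0 := by
    have : r1 * Real.sin (θ z) * (r2 * Real.sin (θ w)) =
      (r1 * r2) * (Real.sin (θ z) * Real.sin (θ w)) := by ring
    rw [this] at hc
    exact (pos_iff_neg_of_mul_neg hc).1 (by positivity)
  -- The angle changes sign along the connected path, so it vanishes at some `ζ`. From there both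
  -- ends of the first path are seen in the same direction, which `hpos` excludes.
  have h0 : (0 : ℝ) ∈ θ '' polyline (z :: Q) := by
    rcases mul_neg_iff.1 hsin with ⟨s1, s2⟩ | ⟨s1, s2⟩
    · exact hconn.out ⟨w, hwm, rfl⟩ ⟨z, hzm, rfl⟩
        ⟨hnp _ (abs_le.2 h2) s2, hnn _ (abs_le.2 h1) s1⟩
    · exact hconn.out ⟨z, hzm, rfl⟩ ⟨w, hwm, rfl⟩
        ⟨hnp _ (abs_le.2 h1) s1, hnn _ (abs_le.2 h2) s2⟩
  obtain ⟨ζ, hζ, h0⟩ := h0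
  obtain ⟨r, hr, e⟩ := ratio_eq_exp_angleSum P x (hsub ζ hζ)
  refine hpos ζ hζ r hr ?_
  have h0' : angleSum ζ (x :: P) = 0 := h0
  rw [e, h0']
  simp

/-- Two paths in a half plane cross if their end points alternate on its boundary. -/
lemma not_disjoint_of_alternating {d o : ℂ} (hd : d ≠ 0) {P Q : List ℂ} {x y z w : ℝ}
    (hP : ∀ p ∈ (o + x * d) :: P, 0 ≤ ((p - o) / d).im)
    (hQ : ∀ p ∈ (o + z * d) :: Q, 0 ≤ ((p - o) / d).im)
    (hy : ((o + x * d) :: P).getLast (by simp) = o + y * d)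
    (hw : ((o + z * d) :: Q).getLast (by simp) = o + w * d)
    (h : (z - x) * (z - y) * ((w - x) * (w - y)) < 0) :
    ¬ Disjoint (polyline ((o + x * d) :: P)) (polyline ((o + z * d) :: Q)) := by
  intro hdis
  have hsub : ∀ ζ ∈ polyline ((o + z * d) :: Q), ζ ∉ polyline ((o + x * d) :: P) := fun ζ h =>
    Set.disjoint_right.1 hdis h
  have hzm := head_mem_polyline (o + z * d) Q
  have hwm : o + w * d ∈ polyline ((o + z * d) :: Q) :=
    mem_polyline_of_mem (hw ▸ List.getLast_mem _)
  set θ : ℂ → ℝ := fun ζ => angleSum ζ ((o + x * d) :: P) with hθ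
  have hcont : ContinuousOn θ (polyline ((o + z * d) :: Q)) :=
    (continuousOn_angleSum _).mono hsub
  have hconn := ((isPreconnected_polyline ((o + z * d) :: Q)).image θ hcont).ordConnected
  have hval : ∀ t : ℝ, o + t * d ∈ polyline ((o + z * d) :: Q) →
      θ (o + t * d) = Complex.arg ((y - t : ℝ) : ℂ) - Complex.arg ((x - t : ℝ) : ℂ) := by
    intro t ht
    have h1 := angleSum_of_halfPlane hd P _ (hsub _ ht) (fun p hp => by
      have := hP p hp
      have e : (p - (o + t * d)) / d = (p - o) / d - (t : ℝ) := by field_simp; ring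
      rw [e, Complex.sub_im, Complex.ofReal_im, sub_zero]
      exact this)
    rw [hy] at h1
    simp only [hθ]
    rw [h1]
    congr 2
    · push_cast; field_simp; ring
    · push_cast; field_simp; ring
  -- From any point of the half plane, `x` and `y` on the boundary line are seen with a fixed
  -- orientation, so the sine of the angle never has the wrong sign.
  have hcr : ∀ ζ ∈ polyline ((o + z * d) :: Q), 0 ≤ (y - x) * Real.sin (θ ζ) := by
    intro ζ hζ
    obtain ⟨r, hr, e⟩ := cross_eq_sin P _ (hsub ζ hζ)
    rw [hy] at e
    have hconv : Convex ℝ {p : ℂ | 0 ≤ ((p - o) / d).im} := by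
      intro p hp q hq s t hs ht hst
      simp only [Set.mem_ofPred_eq] at hp hq ⊢
      have e2 : ((s • p + t • q) - o) / d = (s : ℂ) * ((p - o) / d) + t * ((q - o) / d) := by
        have : (s : ℂ) + t = 1 := by exact_mod_cast hst
        simp only [Complex.real_smul]
        field_simp
        linear_combination o * this
      rw [e2, Complex.add_im, Complex.im_ofReal_mul, Complex.im_ofReal_mul]
      positivity
    have hh : 0 ≤ ((ζ - o) / d).im := polyline_subset hconv hQ hζ
    set k := (ζ - o) / d with hk
    have hζ' : ζ = o + k * d := by rw [hk]; field_simp; ring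
    have e3 : cross ζ (o + x * d) (o + y * d) = ‖d‖ ^ 2 * (k.im * (y - x)) := by
      have e4 : (o + y * d - ζ) * (starRingEnd ℂ) (o + x * d - ζ) =
          ((‖d‖ ^ 2 : ℝ) : ℂ) * ((y - k) * (x - (starRingEnd ℂ) k)) := by
        have := Complex.mul_conj' d
        push_cast
        rw [← this, hζ']
        simp only [map_sub, map_add, map_mul, Complex.conj_ofReal]
        ring
      rw [cross, e4, Complex.im_ofReal_mul]
      simp
      left; ring
    rw [e3] at e
    have h3 : 0 ≤ r * ((y - x) * Real.sin (θ ζ)) := by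
      have : r * ((y - x) * Real.sin (θ ζ)) = ‖d‖ ^ 2 * k.im * (y - x) ^ 2 := by
        have : r * Real.sin (θ ζ) = ‖d‖ ^ 2 * (k.im * (y - x)) := e.symm
        linear_combination (y - x) * this
      rw [this]; positivity
    exact nonneg_of_mul_nonneg_right h3 hr
  have harg : ∀ t : ℝ, o + t * d ∈ polyline ((o + z * d) :: Q) →
      ((t - x) * (t - y) < 0 → (y - x < 0 ∧ θ (o + t * d) = Real.pi) ∨
        (0 < y - x ∧ θ (o + t * d) = - Real.pi)) ∧
      (0 < (t - x) * (t - y) → θ (o + t * d) = 0) := by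
    intro t ht
    rw [hval t ht]
    constructor
    · intro h1
      rcases mul_neg_iff.1 h1 with ⟨h2, h3⟩ | ⟨h2, h3⟩
      · right
        refine ⟨by linarith, ?_⟩
        rw [Complex.arg_ofReal_of_neg (by linarith : x - t < 0),
          Complex.arg_ofReal_of_nonneg (by linarith : 0 ≤ y - t)]
        ring
      · left
        refine ⟨by linarith, ?_⟩
        rw [Complex.arg_ofReal_of_neg (by linarith : y - t < 0),
          Complex.arg_ofReal_of_nonneg (by linarith : 0 ≤ x - t)]
        ring
    · intro h1
      rcases mul_pos_iff.1 h1 with ⟨h2, h3⟩ | ⟨h2, h3⟩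
      · rw [Complex.arg_ofReal_of_neg (by linarith : x - t < 0),
          Complex.arg_ofReal_of_neg (by linarith : y - t < 0)]
        ring
      · rw [Complex.arg_ofReal_of_nonneg (by linarith : 0 ≤ x - t),
          Complex.arg_ofReal_of_nonneg (by linarith : 0 ≤ y - t)]
        ring
  -- The angle is `0` at boundary points outside the interval between `x` and `y`, and `π` or `-π`
  -- inside it. By continuity it passes `π / 2` or `-(π / 2)`, and by the choice of sign this
  -- contradicts `hcr`.
  have hfin : ∀ s t : ℝ, o + s * d ∈ polyline ((o + z * d) :: Q) →
      o + t * d ∈ polyline ((o + z * d) :: Q) → (s - x) * (s - y) < 0 →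
      0 < (t - x) * (t - y) → False := by
    intro s t hs ht h1 h2
    have ht0 := (harg t ht).2 h2
    have hpi := Real.pi_pos
    rcases (harg s hs).1 h1 with ⟨h3, h4⟩ | ⟨h3, h4⟩
    · obtain ⟨ζ, hζ, e⟩ := hconn.out ⟨_, ht, rfl⟩ ⟨_, hs, rfl⟩
        (show Real.pi / 2 ∈ _ from ⟨by rw [ht0]; linarith, by rw [h4]; linarith⟩)
      have := hcr ζ hζ
      rw [e, Real.sin_pi_div_two] at this
      linarith
    · obtain ⟨ζ, hζ, e⟩ := hconn.out ⟨_, hs, rfl⟩ ⟨_, ht, rfl⟩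
        (show -(Real.pi / 2) ∈ _ from ⟨by rw [h4]; linarith, by rw [ht0]; linarith⟩)
      have := hcr ζ hζ
      rw [e, Real.sin_neg, Real.sin_pi_div_two] at this
      linarith
  rcases mul_neg_iff.1 h with ⟨h1, h2⟩ | ⟨h1, h2⟩
  · exact hfin w z hwm hzm h2 h1
  · exact hfin z w hzm hwm h1 h2

/-! ### The boundary of the triangle -/

/-- The plane, identified with the complex numbers. -/
noncomputable def toC (p : Plane) : ℂ := ⟨p 0, p 1⟩

@[simp] lemma toC_re (p : Plane) : (toC p).re = p 0 := rfl
@[simp] lemma toC_im (p : Plane) : (toC p).im = p 1 := rfl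

lemma toC_injective : Function.Injective toC := by
  intro p q h
  ext i
  fin_cases i
  · exact congrArg Complex.re h
  · exact congrArg Complex.im h

lemma exists_mem_segment_of_toC {p p' : Plane} {ζ : ℂ} (h : ζ ∈ segment ℝ (toC p) (toC p')) :
    ∃ x ∈ segment ℝ p p', toC x = ζ := by
  obtain ⟨s, t, hs, ht, hst, rfl⟩ := h
  refine ⟨s • p + t • p', ⟨s, t, hs, ht, hst, rfl⟩, ?_⟩
  apply Complex.ext <;> simp

/-- The `i`-th base vertex in counterclockwise order, starting at `A`. -/
noncomputable def bp (n i : ℕ) : Plane :=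
  if i < n then cVert i else if i < 2 * n then aVert n (i - n) else bVert n (i - 2 * n)

lemma baseCycle_eq_map_range (n : ℕ) : baseCycle n = (List.range (3 * n)).map (bp n) := by
  have h3 : 3 * n = n + n + n := by ring
  rw [h3, List.range_add, List.range_add, baseCycle]
  simp only [List.map_append, List.map_map]
  congr 1
  · congr 1
    · apply List.map_congr_left
      intro i hi
      simp [bp, List.mem_range.1 hi]
    · apply List.map_congr_left
      intro i hi
      have := List.mem_range.1 hi
      simp only [Function.comp_apply, bp]
      rw [if_neg (by omega), if_pos (by omega)]
      congr 1; omega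
  · apply List.map_congr_left
    intro i hi
    have := List.mem_range.1 hi
    simp only [Function.comp_apply, bp]
    rw [if_neg (by omega), if_neg (by omega)]
    congr 1; omega

/-- The starting corner of each of the sides `c`, `a`, `b`. -/
noncomputable def sideOrigin (n : ℕ) : Fin 3 → ℂ := ![0, n, ⟨n / 2, n * √3 / 2⟩]

/-- The counterclockwise unit direction of each of the sides `c`, `a`, `b`. -/
noncomputable def sideDir : Fin 3 → ℂ := ![1, ⟨-1 / 2, √3 / 2⟩, ⟨-1 / 2, -√3 / 2⟩]

lemma normSq_sideDir (s : Fin 3) : Complex.normSq (sideDir s) = 1 := by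
  have h3 : √3 * √3 = 3 := Real.mul_self_sqrt (by norm_num)
  fin_cases s <;> simp [sideDir, Complex.normSq_apply] <;> nlinarith

lemma sideDir_ne_zero (s : Fin 3) : sideDir s ≠ 0 := by
  intro h
  have := normSq_sideDir s
  simp [h] at this

/-- The distance of a point of the triangle from one of the sides `c`, `a`, `b`. -/
noncomputable def height (n : ℕ) (s : Fin 3) (p : ℂ) : ℝ :=
  ((p - sideOrigin n s) / sideDir s).im

lemma height_eq_mul_conj (n : ℕ) (s : Fin 3) (p : ℂ) :
    height n s p = (p.im - (sideOrigin n s).im) * (sideDir s).re -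
      (p.re - (sideOrigin n s).re) * (sideDir s).im := by
  rw [height, Complex.div_im, normSq_sideDir]
  simp

lemma height_zero (n : ℕ) (p : ℂ) : height n 0 p = p.im := by
  rw [height_eq_mul_conj]; simp [sideOrigin, sideDir]

lemma height_one (n : ℕ) (p : ℂ) : height n 1 p = (√3 * (n - p.re) - p.im) / 2 := by
  rw [height_eq_mul_conj]; simp [sideOrigin, sideDir]; ring

lemma height_two (n : ℕ) (p : ℂ) : height n 2 p = (√3 * p.re - p.im) / 2 := by
  rw [height_eq_mul_conj]; simp [sideOrigin, sideDir]; ring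

/-- Heights are affine functions. -/
lemma height_affine (n : ℕ) (s : Fin 3) (p q : ℂ) (a b : ℝ) (hab : a + b = 1) :
    height n s (a * p + b * q) = a * height n s p + b * height n s q := by
  have hb : b = 1 - a := by linarith
  subst hb
  simp only [height_eq_mul_conj]
  simp
  ring

/-- The closed triangle. -/
def triangle (n : ℕ) : Set ℂ := {p | ∀ s, 0 ≤ height n s p}

lemma convex_triangle (n : ℕ) : Convex ℝ (triangle n) := by
  intro p hp q hq a b ha hb hab s
  have := height_affine n s p q a b hab
  simp only [Complex.real_smul]
  rw [this]
  have h1 := hp s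
  have h2 := hq s
  positivity

/-- The index `i` belongs to a base vertex on the side `s`. -/
def OnSide (n : ℕ) (s : Fin 3) (i : ℕ) : Prop :=
  (s = 0 ∧ i ≤ n) ∨ (s = 1 ∧ n ≤ i ∧ i ≤ 2 * n) ∨ (s = 2 ∧ (2 * n ≤ i ∨ i = 0))

lemma toC_bp_zero {n i : ℕ} (hn : 0 < n) (h : i ≤ n) : toC (bp n i) = ⟨i, 0⟩ := by
  rcases h.lt_or_eq with h | rfl
  · apply Complex.ext <;> simp [bp, h, cVert]
  · apply Complex.ext <;> simp [bp, aVert, hn]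

lemma toC_bp_one {n i : ℕ} (hn : 0 < n) (h : n ≤ i) (h' : i ≤ 2 * n) :
    toC (bp n i) = ⟨n - ((i : ℝ) - n) / 2, ((i : ℝ) - n) * √3 / 2⟩ := by
  rcases h'.lt_or_eq with h' | rfl
  · have : ((i - n : ℕ) : ℝ) = i - n := by push_cast [h]; ring
    apply Complex.ext <;> simp [bp, h.not_gt, h', aVert, this]
  · have : ¬ 2 * n < n := by omega
    apply Complex.ext <;> simp [bp, this, bVert] <;> ring

lemma toC_bp_two {n i : ℕ} (h : 2 * n ≤ i) :
    toC (bp n i) = ⟨n / 2 - ((i : ℝ) - 2 * n) / 2, (n - ((i : ℝ) - 2 * n)) * √3 / 2⟩ := by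
  have h1 : ((i - 2 * n : ℕ) : ℝ) = i - 2 * n := by push_cast [h]; ring
  have h2 : ¬ i < n := by omega
  apply Complex.ext <;> simp [bp, h.not_gt, h2, bVert, h1]

/-- The position of the base vertex with index `i` on the side `s`. -/
def sidePos (n : ℕ) (s : Fin 3) (i : ℕ) : ℝ :=
  if s = 2 ∧ i = 0 then n else i - (s : ℕ) * n

lemma toC_bp_eq {n i : ℕ} {s : Fin 3} (hn : 0 < n) (h : OnSide n s i) :
    toC (bp n i) = sideOrigin n s + sidePos n s i * sideDir s := by
  rcases h with ⟨rfl, h⟩ | ⟨rfl, h, h'⟩ | ⟨rfl, h⟩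
  · rw [toC_bp_zero hn h]
    apply Complex.ext <;> simp [sideOrigin, sidePos, sideDir]
  · rw [toC_bp_one hn h h']
    apply Complex.ext <;> simp [sideOrigin, sidePos, sideDir] <;> ring
  · by_cases h0 : i = 0
    · subst h0
      rw [toC_bp_zero hn (by omega)]
      apply Complex.ext <;> simp [sideOrigin, sidePos, sideDir] <;> ring
    · rw [toC_bp_two (by omega)]
      apply Complex.ext <;> simp [sideOrigin, sidePos, sideDir, h0] <;> ring

lemma exists_onSide (n i : ℕ) : ∃ s, OnSide n s i := by
  by_cases h : i ≤ n
  · exact ⟨0, Or.inl ⟨rfl, h⟩⟩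
  by_cases h' : i ≤ 2 * n
  · exact ⟨1, Or.inr (Or.inl ⟨rfl, by omega, h'⟩)⟩
  · exact ⟨2, Or.inr (Or.inr ⟨rfl, Or.inl (by omega)⟩)⟩

lemma height_bp_of_onSide {n i : ℕ} {s : Fin 3} (hn : 0 < n) (h : OnSide n s i) :
    height n s (toC (bp n i)) = 0 := by
  rw [height, toC_bp_eq hn h, add_sub_cancel_left, mul_div_cancel_right₀ _ (sideDir_ne_zero s)]
  simp

lemma toC_bp_mem_triangle {n i : ℕ} (hn : 0 < n) (hi : i ≤ 3 * n) :
    toC (bp n i) ∈ triangle n := by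
  have h3 : √3 * √3 = 3 := Real.mul_self_sqrt (by norm_num)
  have hs : 0 < √3 := by positivity
  have hi' : (i : ℝ) ≤ 3 * n := by exact_mod_cast hi
  have hi0 : (0 : ℝ) ≤ i := by positivity
  intro s
  by_cases h : i ≤ n
  · have h' : (i : ℝ) ≤ n := by exact_mod_cast h
    rw [toC_bp_zero hn h]
    fin_cases s <;> simp only [Fin.mk_one, Fin.zero_eta, Fin.reduceFinMk, height_zero, height_one, height_two]
    · simp
    · have : 0 ≤ √3 * (n - (i : ℝ)) := by apply mul_nonneg hs.le; linarith
      linarith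
    · have : 0 ≤ √3 * (i : ℝ) := by positivity
      linarith
  by_cases h' : i ≤ 2 * n
  · have h1 : (i : ℝ) ≤ 2 * n := by exact_mod_cast h'
    have h2 : (n : ℝ) ≤ i := by exact_mod_cast (by omega : n ≤ i)
    rw [toC_bp_one hn (by omega) h']
    fin_cases s <;> simp only [Fin.mk_one, Fin.zero_eta, Fin.reduceFinMk, height_zero, height_one, height_two]
    · have : 0 ≤ √3 * ((i : ℝ) - n) := by apply mul_nonneg hs.le; linarith
      linarith
    · apply le_of_eq; ring
    · have : 0 ≤ √3 * (2 * n - (i : ℝ)) := by apply mul_nonneg hs.le; linarith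
      linarith
  · have h2 : (2 * n : ℝ) ≤ i := by exact_mod_cast (by omega : 2 * n ≤ i)
    rw [toC_bp_two (by omega)]
    fin_cases s <;> simp only [Fin.mk_one, Fin.zero_eta, Fin.reduceFinMk, height_zero, height_one, height_two]
    · have : 0 ≤ √3 * (3 * n - (i : ℝ)) := by apply mul_nonneg hs.le; linarith
      linarith
    · have : 0 ≤ √3 * ((i : ℝ) - 2 * n) := by apply mul_nonneg hs.le; linarith
      linarith
    · apply le_of_eq; ring

/-- A base vertex lies on exactly the sides that its index tells. -/
lemma onSide_of_height {n i : ℕ} {s : Fin 3} (hn : 0 < n) (hi : i < 3 * n)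
    (h : height n s (toC (bp n i)) = 0) : OnSide n s i := by
  have hs : 0 < √3 := by positivity
  have hi' : (i : ℝ) < 3 * n := by exact_mod_cast hi
  by_contra hcon
  simp only [OnSide, not_or, not_and, not_le] at hcon
  obtain ⟨c0, c1, c2⟩ := hcon
  fin_cases s
  · have h0 : n < i := c0 rfl
    have h0' : (n : ℝ) < i := by exact_mod_cast h0
    simp only [Fin.zero_eta, height_zero] at h
    by_cases h1 : i ≤ 2 * n
    · rw [toC_bp_one hn h0.le h1] at h
      have : 0 < √3 * ((i : ℝ) - n) := by apply mul_pos hs; linarith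
      simp only at h; linarith
    · rw [toC_bp_two (by omega)] at h
      have : 0 < √3 * (3 * n - (i : ℝ)) := by apply mul_pos hs; linarith
      simp only at h; linarith
  · simp only [Fin.mk_one, height_one] at h
    by_cases h1 : n ≤ i
    · have h2 := c1 rfl h1
      have h2' : (2 * n : ℝ) < i := by exact_mod_cast h2
      rw [toC_bp_two (by omega)] at h
      have : 0 < √3 * ((i : ℝ) - 2 * n) := by apply mul_pos hs; linarith
      simp only at h; linarith
    · rw [toC_bp_zero hn (by omega)] at h
      have h2' : (i : ℝ) < n := by exact_mod_cast (not_le.1 h1)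
      have : 0 < √3 * (n - (i : ℝ)) := by apply mul_pos hs; linarith
      simp only at h; linarith
  · have h0 := c2 rfl
    simp only [Fin.reduceFinMk, height_two] at h
    by_cases h1 : i ≤ n
    · rw [toC_bp_zero hn h1] at h
      have h2' : (0 : ℝ) < i := by exact_mod_cast (Nat.pos_of_ne_zero h0.2)
      have : 0 < √3 * (i : ℝ) := by positivity
      simp only at h; linarith
    · rw [toC_bp_one hn (by omega) h0.1.le] at h
      have h2' : (i : ℝ) < 2 * n := by exact_mod_cast h0.1
      have : 0 < √3 * (2 * n - (i : ℝ)) := by apply mul_pos hs; linarith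
      simp only at h; linarith

lemma bp_injOn {n i j : ℕ} (hn : 0 < n) (hi : i < 3 * n) (hj : j < 3 * n) (h : bp n i = bp n j) :
    i = j := by
  have key : ∀ s, OnSide n s i → i = j := by
    intro s hs
    have hj' : OnSide n s j := onSide_of_height hn hj (h ▸ height_bp_of_onSide hn hs)
    have h1 : sideOrigin n s + sidePos n s i * sideDir s =
        sideOrigin n s + sidePos n s j * sideDir s := by
      rw [← toC_bp_eq hn hs, ← toC_bp_eq hn hj', h]
    have h2 := mul_right_cancel₀ (sideDir_ne_zero s) (add_left_cancel h1)
    have h3 : sidePos n s i = sidePos n s j := by exact_mod_cast h2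
    unfold sidePos at h3
    have hi' : (i : ℝ) < 3 * n := by exact_mod_cast hi
    have hj' : (j : ℝ) < 3 * n := by exact_mod_cast hj
    split_ifs at h3 with e1 e2 e2
    · omega
    · rw [e1.1] at h3; norm_num at h3; linarith
    · rw [e2.1] at h3; norm_num at h3; linarith
    · have : (i : ℝ) = j := by linarith
      exact_mod_cast this
  obtain ⟨s, hs⟩ := exists_onSide n i
  exact key s hs

/-- Three base vertices in counterclockwise order form a positively oriented triangle, unless
they lie on a common side. -/
lemma cross_bp_pos {n i j k : ℕ} (hn : 0 < n) (hij : i < j) (hjk : j < k) (hk : k < 3 * n) :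
    0 < cross (toC (bp n i)) (toC (bp n j)) (toC (bp n k)) ∨
      ∃ s, OnSide n s i ∧ OnSide n s j ∧ OnSide n s k := by
  have hs : 0 < √3 := by positivity
  have hij' : (i : ℝ) < j := by exact_mod_cast hij
  have hjk' : (j : ℝ) < k := by exact_mod_cast hjk
  have hk' : (k : ℝ) < 3 * n := by exact_mod_cast hk
  have hi0 : (0 : ℝ) ≤ i := by positivity
  have hn' : (0 : ℝ) < n := by exact_mod_cast hn
  have scale : ∀ c t : ℝ, c = √3 / 2 * t → 0 < t → 0 < c := by
    rintro c t rfl ht; positivity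
  by_cases k1 : k ≤ n
  · exact Or.inr ⟨0, Or.inl ⟨rfl, by omega⟩, Or.inl ⟨rfl, by omega⟩, Or.inl ⟨rfl, k1⟩⟩
  by_cases i2 : 2 * n ≤ i
  · exact Or.inr ⟨2, Or.inr (Or.inr ⟨rfl, by omega⟩), Or.inr (Or.inr ⟨rfl, by omega⟩),
      Or.inr (Or.inr ⟨rfl, by omega⟩)⟩
  by_cases ia : n ≤ i ∧ k ≤ 2 * n
  · exact Or.inr ⟨1, Or.inr (Or.inl ⟨rfl, by omega⟩), Or.inr (Or.inl ⟨rfl, by omega⟩),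
      Or.inr (Or.inl ⟨rfl, by omega⟩)⟩
  by_cases ib : i = 0 ∧ 2 * n ≤ j
  · exact Or.inr ⟨2, Or.inr (Or.inr ⟨rfl, by omega⟩), Or.inr (Or.inr ⟨rfl, by omega⟩),
      Or.inr (Or.inr ⟨rfl, by omega⟩)⟩
  left
  have k1' : (n : ℝ) < k := by exact_mod_cast (not_le.1 k1)
  have i2' : (i : ℝ) < 2 * n := by exact_mod_cast (not_le.1 i2)
  rw [cross_eq]
  by_cases in1 : i < n
  · have in1' : (i : ℝ) < n := by exact_mod_cast in1
    rw [toC_bp_zero hn in1.le]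
    by_cases jn : j ≤ n
    · have jn' : (j : ℝ) ≤ n := by exact_mod_cast jn
      rw [toC_bp_zero hn jn]
      by_cases kn : k ≤ 2 * n
      · rw [toC_bp_one hn (by omega) kn]
        refine scale _ ((j - i) * (k - n)) (by simp only; ring) ?_
        exact mul_pos (by linarith) (by linarith)
      · rw [toC_bp_two (by omega)]
        refine scale _ ((j - i) * (3 * n - k)) (by simp only; ring) ?_
        exact mul_pos (by linarith) (by linarith)
    · have jn' : (n : ℝ) < j := by exact_mod_cast (not_le.1 jn)
      by_cases j2 : j < 2 * n
      · have j2' : (j : ℝ) < 2 * n := by exact_mod_cast j2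
        rw [toC_bp_one hn (by omega) j2.le]
        by_cases kn : k ≤ 2 * n
        · rw [toC_bp_one hn (by omega) kn]
          refine scale _ ((n - i) * (k - j)) (by simp only; ring) ?_
          exact mul_pos (by linarith) (by linarith)
        · have kn' : (2 * n : ℝ) < k := by exact_mod_cast (not_le.1 kn)
          rw [toC_bp_two (by omega)]
          -- One vertex on each side: the area of the inscribed triangle, as a sum of the products
          -- of the complementary pieces into which the sides are divided.
          refine scale _ (((n - i) * ((2 * n - j) * (3 * n - k)) + i * ((j - n) * (k - 2 * n))) / n)
            (by simp only; field_simp; ring) ?_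
          have t1 := mul_pos (sub_pos.2 in1') (mul_pos (sub_pos.2 j2') (sub_pos.2 hk'))
          have t2 := mul_nonneg hi0 (mul_pos (sub_pos.2 jn') (sub_pos.2 kn')).le
          positivity
      · have hi : 0 < i := by omega
        have hi' : (0 : ℝ) < i := by exact_mod_cast hi
        rw [toC_bp_two (by omega), toC_bp_two (by omega)]
        refine scale _ (i * (k - j)) (by simp only; ring) ?_
        exact mul_pos (by linarith) (by linarith)
  · have in1' : (n : ℝ) ≤ i := by exact_mod_cast (not_lt.1 in1)
    have kn : 2 * n < k := by omega
    have kn' : (2 * n : ℝ) < k := by exact_mod_cast kn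
    rw [toC_bp_one hn (by omega) (by omega : i ≤ 2 * n), toC_bp_two (by omega : 2 * n ≤ k)]
    by_cases j2 : j ≤ 2 * n
    · rw [toC_bp_one hn (by omega) j2]
      refine scale _ ((j - i) * (k - 2 * n)) (by simp only; ring) ?_
      exact mul_pos (by linarith) (by linarith)
    · rw [toC_bp_two (by omega)]
      refine scale _ ((2 * n - i) * (k - j)) (by simp only; ring) ?_
      exact mul_pos (by linarith) (by linarith)

/-! ### The order of the base vertices -/

/-- The base vertices with indices `x`, `y` and those with indices `z`, `w` alternate on the
boundary of the triangle, in a form that excludes disjoint paths `x`-`y` and `z`-`w`. -/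
def Alternate (n x y z w : ℕ) : Prop :=
  ((∀ s, ¬ (OnSide n s x ∧ OnSide n s y)) ∧
    cross (toC (bp n z)) (toC (bp n x)) (toC (bp n y)) *
      cross (toC (bp n w)) (toC (bp n x)) (toC (bp n y)) < 0) ∨
  ((∀ s, ¬ (OnSide n s z ∧ OnSide n s w)) ∧
    cross (toC (bp n x)) (toC (bp n z)) (toC (bp n w)) *
      cross (toC (bp n y)) (toC (bp n z)) (toC (bp n w)) < 0) ∨
  ∃ s, OnSide n s x ∧ OnSide n s y ∧ OnSide n s z ∧ OnSide n s w ∧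
    (sidePos n s z - sidePos n s x) * (sidePos n s z - sidePos n s y) *
      ((sidePos n s w - sidePos n s x) * (sidePos n s w - sidePos n s y)) < 0

lemma cross_swap (a b c : ℂ) : cross a b c = - cross a c b := by
  simp only [cross_eq]; ring

lemma cross_swap_left (a b c : ℂ) : cross b a c = - cross a b c := by
  simp only [cross_eq]; ring

lemma Alternate.symm_left {n x y z w : ℕ} (h : Alternate n x y z w) : Alternate n y x z w := by
  rcases h with ⟨h1, h2⟩ | ⟨h1, h2⟩ | ⟨s, h1, h2, h3, h4, h5⟩
  · refine Or.inl ⟨fun s hs => h1 s hs.symm, ?_⟩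
    rw [cross_swap (toC (bp n z)), cross_swap (toC (bp n w))]
    linarith
  · exact Or.inr (Or.inl ⟨h1, by linarith⟩)
  · exact Or.inr (Or.inr ⟨s, h2, h1, h3, h4, by linarith⟩)

lemma Alternate.symm {n x y z w : ℕ} (h : Alternate n x y z w) : Alternate n z w x y := by
  rcases h with ⟨h1, h2⟩ | ⟨h1, h2⟩ | ⟨s, h1, h2, h3, h4, h5⟩
  · exact Or.inr (Or.inl ⟨h1, h2⟩)
  · exact Or.inl ⟨h1, h2⟩
  · exact Or.inr (Or.inr ⟨s, h3, h4, h1, h2, by linarith⟩)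

lemma Alternate.symm_right {n x y z w : ℕ} (h : Alternate n x y z w) : Alternate n x y w z :=
  h.symm.symm_left.symm

/-- If `i` and `k` share no side, the triangles `ijk` and `ikl` are both positively oriented, so `j`
and `l` lie on different sides of the chord `ik`. The same works for the chord `jl`. If both pairs
share a side, all four points lie on one side, in the order of their positions. -/
lemma alternate_of_lt {n i j k l : ℕ} (hn : 0 < n) (hij : i < j) (hjk : j < k) (hkl : k < l)
    (hl : l < 3 * n) : Alternate n i k j l := by
  by_cases h1 : ∀ s, ¬ (OnSide n s i ∧ OnSide n s k)
  · refine Or.inl ⟨h1, ?_⟩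
    have a1 := (cross_bp_pos hn hij hjk (by omega)).resolve_right
      fun ⟨s, hs⟩ => h1 s ⟨hs.1, hs.2.2⟩
    have a2 := (cross_bp_pos hn (hij.trans hjk) hkl hl).resolve_right
      fun ⟨s, hs⟩ => h1 s ⟨hs.1, hs.2.1⟩
    rw [cross_swap_left (toC (bp n i)), cross_swap_left (toC (bp n i)) (toC (bp n l)),
      cross_swap (toC (bp n i)) (toC (bp n l))]
    nlinarith
  by_cases h2 : ∀ s, ¬ (OnSide n s j ∧ OnSide n s l)
  · refine Or.inr (Or.inl ⟨h2, ?_⟩)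
    have a1 := (cross_bp_pos hn hij (hjk.trans hkl) hl).resolve_right
      fun ⟨s, hs⟩ => h2 s ⟨hs.2.1, hs.2.2⟩
    have a2 := (cross_bp_pos hn hjk hkl hl).resolve_right
      fun ⟨s, hs⟩ => h2 s ⟨hs.1, hs.2.2⟩
    rw [cross_swap_left (toC (bp n j)) (toC (bp n k))]
    nlinarith
  push Not at h1 h2
  obtain ⟨s, h1, h1'⟩ := h1
  obtain ⟨t, h2, h2'⟩ := h2
  refine Or.inr (Or.inr ⟨s, ?_⟩)
  have hij' : (i : ℝ) < j := by exact_mod_cast hij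
  have hjk' : (j : ℝ) < k := by exact_mod_cast hjk
  have hkl' : (k : ℝ) < l := by exact_mod_cast hkl
  have hl' : (l : ℝ) < 3 * n := by exact_mod_cast hl
  have hst : OnSide n s j ∧ OnSide n s l := by
    rcases h1 with ⟨rfl, h⟩ | ⟨rfl, h, h'⟩ | ⟨rfl, h⟩ <;>
    rcases h2 with ⟨rfl, g⟩ | ⟨rfl, g, g'⟩ | ⟨rfl, g⟩ <;>
    simp [OnSide] at h1' h2' ⊢ <;> omega
  refine ⟨h1, h1', hst.1, hst.2, ?_⟩
  -- Only the smallest index can be `0`, the corner with the exceptional position `n` on side 2.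
  have hpos : ∀ t, i < t → sidePos n s t = t - (s : ℕ) * n := by
    intro t ht
    rw [sidePos, if_neg (by omega)]
  rw [hpos j hij, hpos k (by omega), hpos l (by omega)]
  unfold sidePos
  split_ifs with h0
  · rw [h0.1]
    norm_num
    have : ((j : ℝ) - 2 * n - n) * (j - k) * ((l - 2 * n - n) * (l - k)) =
      -((3 * n - j) * (k - j) * ((3 * n - l) * (l - k))) := by ring
    rw [this, neg_lt_zero]
    exact mul_pos (mul_pos (by linarith) (by linarith)) (mul_pos (by linarith) (by linarith))
  · have : ((j : ℝ) - (s : ℕ) * n - (i - (s : ℕ) * n)) * (j - (s : ℕ) * n - (k - (s : ℕ) * n)) *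
      ((l - (s : ℕ) * n - (i - (s : ℕ) * n)) * (l - (s : ℕ) * n - (k - (s : ℕ) * n))) =
      -((j - i) * (k - j) * ((l - i) * (l - k))) := by ring
    rw [this, neg_lt_zero]
    exact mul_pos (mul_pos (by linarith) (by linarith)) (mul_pos (by linarith) (by linarith))

/-- `t` lies strictly between `x` and `y`. -/
def Between (x y t : ℕ) : Prop := (x < t ∧ t < y) ∨ (y < t ∧ t < x)

/-- Exactly one of `z` and `w` lies strictly between `x` and `y`. -/
def Separated (x y z w : ℕ) : Prop :=
  (Between x y z ∧ ¬ Between x y w) ∨ (¬ Between x y z ∧ Between x y w)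

/-- Up to the symmetries of `Alternate`, the order is `x < z < y < w` or `w < x < z < y`. -/
lemma alternate_of_separated {n x y z w : ℕ} (hn : 0 < n) (hx : x < 3 * n) (hy : y < 3 * n)
    (hz : z < 3 * n) (hw : w < 3 * n) (h : Separated x y z w) (hxy : x ≠ y) (hxz : x ≠ z)
    (hxw : x ≠ w) (hyz : y ≠ z) (hyw : y ≠ w) : Alternate n x y z w := by
  wlog hlt : x < y generalizing x y
  · refine (this hy hx ?_ hxy.symm hyz hyw hxz hxw (by omega)).symm_left
    unfold Separated Between at h ⊢
    tauto
  wlog hbz : Between x y z generalizing z w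
  · obtain ⟨h1, h2⟩ := h.resolve_left fun h1 => hbz h1.1
    exact (this hw hz (Or.inl ⟨h2, h1⟩) hxw hxz hyw hyz h2).symm_right
  have hbw : ¬ Between x y w := (h.resolve_right fun h1 => h1.1 hbz).2
  unfold Between at hbz hbw
  rcases lt_or_ge w x with h1 | h1
  · exact (alternate_of_lt hn h1 (by omega : x < z) (by omega : z < y) hy).symm.symm_right
  · exact alternate_of_lt hn (by omega : x < z) (by omega : z < y) (by omega : y < w) hw

lemma exists_edge_of_mem_polyline_map {L : List Plane} (hl : 2 ≤ L.length) {ζ : ℂ}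
    (h : ζ ∈ polyline (L.map toC)) :
    ∃ U p p' V, L = U ++ p :: p' :: V ∧ ∃ x ∈ segment ℝ p p', toC x = ζ := by
  obtain ⟨U, p, p', V, h1, h2⟩ := exists_edge_of_mem_polyline (by simpa using hl) h
  obtain ⟨U₀, L₁, rfl, rfl, h3⟩ := List.map_eq_append_iff.1 h1
  obtain ⟨p₀, L₂, rfl, rfl, h4⟩ := List.map_eq_cons_iff.1 h3
  obtain ⟨p₁, L₃, rfl, rfl, h5⟩ := List.map_eq_cons_iff.1 h4
  exact ⟨U₀, p₀, p₁, L₃, rfl, exists_mem_segment_of_toC h2⟩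

/-- Provides a supporting half plane of the triangle whose boundary passes through a given base
vertex. -/
lemma height_sub_of_onSide {n i : ℕ} {s : Fin 3} (hn : 0 < n) (h : OnSide n s i) {p : ℂ}
    (hp : p ∈ triangle n) : 0 ≤ ((p - toC (bp n i)) / sideDir s).im := by
  have h1 := hp s
  have h2 := height_bp_of_onSide hn h
  unfold height at h1 h2
  have : (p - toC (bp n i)) / sideDir s = (p - sideOrigin n s) / sideDir s -
      (toC (bp n i) - sideOrigin n s) / sideDir s := by ring
  rw [this, Complex.sub_im, h2, sub_zero]
  exact h1

/-- Otherwise one of the two base vertices would be a proper convex combination of the other and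
`ζ`, or equal to the other. As heights are nonnegative on the triangle, any side through this vertex
would also contain the other one. -/
lemma ratio_not_pos {n x y : ℕ} (hn : 0 < n) (hx : x < 3 * n) (hy : y < 3 * n)
    (hno : ∀ s, ¬ (OnSide n s x ∧ OnSide n s y)) {ζ : ℂ} (hζ : ζ ∈ triangle n) {r : ℝ}
    (hr : 0 < r) : toC (bp n y) - ζ ≠ (toC (bp n x) - ζ) * r := by
  intro h
  have hxt := toC_bp_mem_triangle hn hx.le
  have hyt := toC_bp_mem_triangle hn hy.le
  rcases lt_trichotomy r 1 with h1 | rfl | h1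
  · obtain ⟨s, hs⟩ := exists_onSide n y
    apply hno s
    refine ⟨onSide_of_height hn hx ?_, hs⟩
    have e : toC (bp n y) = (r : ℂ) * toC (bp n x) + ((1 - r : ℝ) : ℂ) * ζ := by
      push_cast; linear_combination h
    have h2 := height_affine n s (toC (bp n x)) ζ r (1 - r) (by ring)
    rw [← e, height_bp_of_onSide hn hs] at h2
    have h3 := hxt s
    have h4 := hζ s
    nlinarith
  · have : toC (bp n y) = toC (bp n x) := by push_cast at h; linear_combination h
    have h2 := bp_injOn hn hy hx (toC_injective this)
    obtain ⟨s, hs⟩ := exists_onSide n y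
    exact hno s ⟨h2 ▸ hs, hs⟩
  · obtain ⟨s, hs⟩ := exists_onSide n x
    apply hno s
    refine ⟨hs, onSide_of_height hn hy ?_⟩
    have hr0 : (r : ℂ) ≠ 0 := by exact_mod_cast hr.ne'
    have e : toC (bp n x) = ((1 / r : ℝ) : ℂ) * toC (bp n y) + ((1 - 1 / r : ℝ) : ℂ) * ζ := by
      push_cast; field_simp; linear_combination -h
    have h2 := height_affine n s (toC (bp n y)) ζ (1 / r) (1 - 1 / r) (by ring)
    rw [← e, height_bp_of_onSide hn hs] at h2
    have h3 := hyt s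
    have h4 := hζ s
    have h5 : 0 < 1 / r := by positivity
    have h6 : 1 / r < 1 := by rw [div_lt_one hr]; exact h1
    nlinarith

/-- A chord not contained in a side is handled by the sign change of `cross`; four ends on a single
side need the half-plane version, since all the cross products vanish there. -/
lemma polylines_meet {n x y z w : ℕ} (hn : 0 < n) (hx : x < 3 * n) (hy : y < 3 * n)
    (hz : z < 3 * n) (hw : w < 3 * n) (h : Alternate n x y z w) {P Q : List Plane}
    (hP : ∀ p ∈ P, toC p ∈ triangle n) (hQ : ∀ p ∈ Q, toC p ∈ triangle n) :
    ¬ Disjoint (polyline ((bp n x :: (P ++ [bp n y])).map toC))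
      (polyline ((bp n z :: (Q ++ [bp n w])).map toC)) := by
  have tri : ∀ i, i < 3 * n → toC (bp n i) ∈ triangle n := fun i hi =>
    toC_bp_mem_triangle hn hi.le
  have hP' : ∀ p ∈ toC (bp n x) :: (P ++ [bp n y]).map toC, p ∈ triangle n := by
    intro p hp
    simp only [List.map_append, List.mem_cons, List.mem_append, List.mem_map, List.map_cons,
      List.map_nil, List.not_mem_nil, or_false] at hp
    rcases hp with rfl | ⟨q, hq, rfl⟩ | rfl
    exacts [tri x hx, hP q hq, tri y hy]
  have hQ' : ∀ p ∈ toC (bp n z) :: (Q ++ [bp n w]).map toC, p ∈ triangle n := by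
    intro p hp
    simp only [List.map_append, List.mem_cons, List.mem_append, List.mem_map, List.map_cons,
      List.map_nil, List.not_mem_nil, or_false] at hp
    rcases hp with rfl | ⟨q, hq, rfl⟩ | rfl
    exacts [tri z hz, hQ q hq, tri w hw]
  have lP : (toC (bp n x) :: (P ++ [bp n y]).map toC).getLast (by simp) = toC (bp n y) := by simp
  have lQ : (toC (bp n z) :: (Q ++ [bp n w]).map toC).getLast (by simp) = toC (bp n w) := by simp
  rw [List.map_cons, List.map_cons]
  rcases h with ⟨h1, h2⟩ | ⟨h1, h2⟩ | ⟨s, h1, h2, h3, h4, h5⟩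
  · obtain ⟨s, hs⟩ := exists_onSide n z
    obtain ⟨t, ht⟩ := exists_onSide n w
    refine not_disjoint_of_cross_neg (sideDir_ne_zero s) (sideDir_ne_zero t) ?_ ?_ ?_ ?_
    · exact fun p hp => height_sub_of_onSide hn hs (hP' p hp)
    · rw [lQ]
      exact fun p hp => height_sub_of_onSide hn ht (hP' p hp)
    · rw [lP, lQ]; exact h2
    · rw [lP]
      exact fun ζ hζ r hr =>
        ratio_not_pos hn hx hy h1 (polyline_subset (convex_triangle n) hQ' hζ) hr
  · obtain ⟨s, hs⟩ := exists_onSide n x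
    obtain ⟨t, ht⟩ := exists_onSide n y
    rw [disjoint_comm]
    refine not_disjoint_of_cross_neg (sideDir_ne_zero s) (sideDir_ne_zero t) ?_ ?_ ?_ ?_
    · exact fun p hp => height_sub_of_onSide hn hs (hQ' p hp)
    · rw [lP]
      exact fun p hp => height_sub_of_onSide hn ht (hQ' p hp)
    · rw [lP, lQ]; exact h2
    · rw [lQ]
      exact fun ζ hζ r hr =>
        ratio_not_pos hn hz hw h1 (polyline_subset (convex_triangle n) hP' hζ) hr
  · have ex := toC_bp_eq hn h1
    have ez := toC_bp_eq hn h3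
    rw [ex] at hP' lP ⊢
    rw [ez] at hQ' lQ ⊢
    refine not_disjoint_of_alternating (sideDir_ne_zero s) (fun p hp => hP' p hp s)
      (fun p hp => hQ' p hp s) ?_ ?_ h5
    · rw [lP, toC_bp_eq hn h2]
    · rw [lQ, toC_bp_eq hn h4]

/-- An optimum tour contains no two disjoint subpaths between alternating base vertices. -/
lemma IsOptimumTour.not_alternate {V : Set Plane} {n x y z w : ℕ} {P S Q S' : List Plane}
    (hn : 0 < n) (hV : ¬ ∃ o d : Plane, ∀ y ∈ V, ∃ r : ℝ, y = o + r • d)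
    (htri : ∀ p ∈ V, toC p ∈ triangle n) (hx : x < 3 * n) (hy : y < 3 * n)
    (hz : z < 3 * n) (hw : w < 3 * n)
    (h : IsOptimumTour V ((bp n x :: (P ++ [bp n y])) ++ S ++ (bp n z :: (Q ++ [bp n w])) ++ S')) :
    ¬ Alternate n x y z w := by
  intro hA
  have hm : ∀ p, p ∈ P ∨ p ∈ Q → toC p ∈ triangle n := by
    intro p hp
    apply htri
    rw [← h.1.2]
    simp only [List.mem_append, List.mem_cons]
    tauto
  apply polylines_meet hn hx hy hz hw hA (fun p hp => hm p (Or.inl hp))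
    (fun p hp => hm p (Or.inr hp))
  rw [Set.disjoint_left]
  intro ζ h1 h2
  obtain ⟨U, p, p', U', e1, t1, ht1, ht1'⟩ := exists_edge_of_mem_polyline_map (by simp) h1
  obtain ⟨W, q, q', W', e2, t2, ht2, ht2'⟩ := exists_edge_of_mem_polyline_map (by simp) h2
  have ht : t1 = t2 := toC_injective (ht1'.trans ht2'.symm)
  subst ht
  rw [e1, e2] at h
  -- The meeting point lies on one edge of each path. The tour is cut at these two edges, which puts
  -- it in the form required by `disjoint_edges`.
  have hr : IsOptimumTour V ((p' :: (U' ++ S ++ W ++ [q])) ++ (q' :: (W' ++ S' ++ U ++ [p]))) := by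
    refine h.of_isRotated ?_
    have := List.isRotated_append (l := U ++ [p]) (l' := p' :: (U' ++ S ++ W ++ q :: q' :: W' ++ S'))
    simpa using this
  have nd := h.1.1
  have hd := hr.disjoint_edges (by simp) (by simp) ?_ ?_ hV
  · rw [Set.disjoint_left] at hd
    refine hd (a := t1) ?_ ?_
    · simpa using ht1
    · simpa using ht2
  · rintro he
    have nd1 := (List.nodup_append.1 hr.1.1).1
    simp at he nd1
    tauto
  · rintro he
    have nd1 := (List.nodup_append.1 hr.1.1).2.1
    simp at he nd1
    tauto

/-! ### Cyclic sequences without separated neighbours -/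

/-- A discrete intermediate value theorem. -/
lemma exists_adjacent_change {α : Type*} {p : α → Prop} {R : List α} (ha : ∃ a ∈ R, p a)
    (hb : ∃ b ∈ R, ¬ p b) :
    ∃ R₁ z w R₂, R = R₁ ++ z :: w :: R₂ ∧ ((p z ∧ ¬ p w) ∨ (¬ p z ∧ p w)) := by
  induction R with
  | nil => simp at ha
  | cons c R ih =>
    cases R with
    | nil =>
      simp only [List.mem_singleton, exists_eq_left] at ha hb
      exact absurd ha hb
    | cons c' R =>
      by_cases hc : (p c ∧ ¬ p c') ∨ (¬ p c ∧ p c')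
      · exact ⟨[], c, c', R, rfl, hc⟩
      · have ha' : ∃ a ∈ c' :: R, p a := by
          obtain ⟨a, ha, hpa⟩ := ha
          rcases List.mem_cons.1 ha with rfl | ha
          · exact ⟨c', by simp, by tauto⟩
          · exact ⟨a, ha, hpa⟩
        have hb' : ∃ b ∈ c' :: R, ¬ p b := by
          obtain ⟨b, hb, hpb⟩ := hb
          rcases List.mem_cons.1 hb with rfl | hb
          · exact ⟨c', by simp, by tauto⟩
          · exact ⟨b, hb, hpb⟩
        obtain ⟨R₁, z, w, R₂, h1, h2⟩ := ih ha' hb'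
        exact ⟨c :: R₁, z, w, R₂, by rw [h1]; rfl, h2⟩

/-- No two neighbours in the cyclic sequence `I` separate two other neighbours. -/
def Noncrossing (I : List ℕ) : Prop :=
  ∀ x y R₁ z w R₂, I ~r x :: y :: (R₁ ++ z :: w :: R₂) → ¬ Separated x y z w

lemma Noncrossing.reverse {I : List ℕ} (h : Noncrossing I) : Noncrossing I.reverse := by
  intro x y R₁ z w R₂ hr hs
  refine h y x R₂.reverse w z R₁.reverse ?_ ?_
  · have h1 := hr.reverse
    rw [List.reverse_reverse] at h1
    refine h1.trans ?_
    have := List.isRotated_append (l := R₂.reverse ++ w :: z :: R₁.reverse) (l' := [y, x])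
    simpa using this
  · unfold Separated Between at hs ⊢
    tauto

/-- If cyclic neighbours `x`, `y` are not consecutive modulo `N`, there are values both strictly
between and outside. The rest of the sequence avoids `x` and `y`, so somewhere it jumps from one
kind to the other, and this jump is separated. -/
lemma Noncrossing.step {I : List ℕ} {N : ℕ} (h : Noncrossing I) (hnd : I.Nodup)
    (hI : ∀ i, i ∈ I ↔ i < N) {x y : ℕ} {R : List ℕ} (hr : I ~r x :: y :: R) :
    y = x + 1 ∨ x = y + 1 ∨ (x = 0 ∧ y + 1 = N) ∨ (y = 0 ∧ x + 1 = N) := by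
  have hnd' : (x :: y :: R).Nodup := hr.nodup_iff.1 hnd
  have hmem : ∀ i, i ∈ x :: y :: R ↔ i < N := fun i => by rw [← hI i, hr.mem_iff]
  have hx : x < N := (hmem x).1 (by simp)
  have hy : y < N := (hmem y).1 (by simp)
  have hR : ∀ i, i < N → i ≠ x → i ≠ y → i ∈ R := by
    intro i hi h1 h2
    have := (hmem i).2 hi
    simp only [List.mem_cons] at this
    tauto
  have hxy : x ≠ y := by
    rintro rfl
    simp at hnd'
  by_contra hcon
  push Not at hcon
  obtain ⟨c1, c2, c3, c4⟩ := hcon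
  have hin : ∃ a ∈ R, Between x y a := by
    rcases lt_or_gt_of_ne hxy with hlt | hlt
    · exact ⟨x + 1, hR _ (by omega) (by omega) (by omega), Or.inl ⟨by omega, by omega⟩⟩
    · exact ⟨y + 1, hR _ (by omega) (by omega) (by omega), Or.inr ⟨by omega, by omega⟩⟩
  have hout : ∃ a ∈ R, ¬ Between x y a := by
    unfold Between
    by_cases h0 : x = 0 ∨ y = 0
    · exact ⟨N - 1, hR _ (by omega) (by omega) (by omega), by omega⟩
    · exact ⟨0, hR _ (by omega) (by omega) (by omega), by omega⟩
  obtain ⟨R₁, z, w, R₂, rfl, h2⟩ := exists_adjacent_change hin hout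
  exact h x y R₁ z w R₂ hr h2

/-- After `0, 1` every step is forced: the neighbour must be consecutive and the smaller values are
already used. -/
lemma Noncrossing.eq_range {I : List ℕ} {N : ℕ} (h : Noncrossing I) (hnd : I.Nodup)
    (hI : ∀ i, i ∈ I ↔ i < N) {R : List ℕ} (hr : I = 0 :: 1 :: R) : I = List.range N := by
  have hlen : I.length = N := by
    have hp : I.Perm (List.range N) := (List.perm_ext_iff_of_nodup hnd List.nodup_range).2
      fun i => by rw [hI i, List.mem_range]
    simpa using hp.length_eq
  have key : ∀ k, 2 ≤ k → k ≤ N → ∃ T, I = List.range k ++ T := by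
    intro k hk
    induction k, hk using Nat.le_induction with
    | base => exact fun _ => ⟨R, hr⟩
    | succ k hk ih =>
      intro hkN
      obtain ⟨T, hT⟩ := ih (by omega)
      cases T with
      | nil =>
        rw [hT] at hlen
        simp at hlen
        omega
      | cons t T =>
        obtain ⟨k', rfl⟩ : ∃ k', k = k' + 1 := ⟨k - 1, by omega⟩
        have hr' : I ~r k' :: t :: (T ++ List.range k') := by
          rw [hT, List.range_succ]
          have := List.isRotated_append (l := List.range k') (l' := k' :: t :: T)
          simpa using this
        have hnt : t ∉ List.range (k' + 1) := by
          intro ht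
          rw [hT] at hnd
          exact (List.nodup_append.1 hnd).2.2 t ht t (by simp) rfl
        rw [List.mem_range] at hnt
        have hstep := h.step hnd hI hr'
        have : t = k' + 1 := by omega
        refine ⟨T, ?_⟩
        rw [hT, List.range_succ (n := k' + 1), this]
        simp
  have hN : 2 ≤ N := by rw [← hlen, hr]; simp
  obtain ⟨T, hT⟩ := key N hN le_rfl
  have : T = [] := by
    rw [hT] at hlen
    simp at hlen
    exact hlen
  rw [hT, this, List.append_nil]

/-- The two cyclic neighbours of `0` are `1` and `N - 1`. Reversing the sequence if necessary puts
`1` after `0`. -/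
lemma Noncrossing.isRotated_range {I : List ℕ} {N : ℕ} (h : Noncrossing I) (hN : 3 ≤ N)
    (hnd : I.Nodup) (hI : ∀ i, i ∈ I ↔ i < N) :
    I ~r List.range N ∨ I.reverse ~r List.range N := by
  have of_rot : ∀ {J J' : List ℕ}, J ~r J' → Noncrossing J → Noncrossing J' :=
    fun hr hJ x y R₁ z w R₂ h' => hJ x y R₁ z w R₂ (hr.trans h')
  have hlen : I.length = N := by
    have hp : I.Perm (List.range N) := (List.perm_ext_iff_of_nodup hnd List.nodup_range).2
      fun i => by rw [hI i, List.mem_range]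
    simpa using hp.length_eq
  obtain ⟨X, Y, rfl⟩ := List.append_of_mem ((hI 0).2 (by omega))
  have hr0 : (X ++ 0 :: Y) ~r 0 :: (Y ++ X) := List.isRotated_append
  match hYX : Y ++ X, hr0 with
  | [], hr0 =>
    have := hr0.perm.length_eq
    simp at this hlen
    omega
  | [_], hr0 =>
    have := hr0.perm.length_eq
    simp at this hlen
    omega
  | y :: t :: R, hr0 =>
    have hstep := h.step hnd hI hr0
    have hnd0 : (0 :: y :: t :: R).Nodup := hr0.nodup_iff.1 hnd
    have hmem0 : ∀ i, i ∈ 0 :: y :: t :: R ↔ i < N := fun i => by rw [← hI i, hr0.mem_iff]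
    by_cases hy : y = 1
    · subst hy
      left
      have h1 := (of_rot hr0 h).eq_range hnd0 hmem0 rfl
      rw [← h1]
      exact hr0
    · right
      have hr1 : (X ++ 0 :: Y).reverse ~r 0 :: ((t :: R).reverse ++ [y]) := by
        refine hr0.reverse.trans ?_
        have := List.isRotated_append (l := (t :: R).reverse ++ [y]) (l' := [0])
        simpa using this
      have hnd1 : (X ++ 0 :: Y).reverse.Nodup := List.nodup_reverse.2 hnd
      have hI1 : ∀ i, i ∈ (X ++ 0 :: Y).reverse ↔ i < N := fun i => by
        rw [List.mem_reverse, hI i]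
      obtain ⟨s, T, hsT⟩ : ∃ s T, (t :: R).reverse = s :: T :=
        List.exists_cons_of_ne_nil (by simp)
      rw [hsT, List.cons_append] at hr1
      have hs : s ∈ t :: R := by
        rw [← List.mem_reverse, hsT]; simp
      have hsy : s ≠ y := by
        rintro rfl
        simp only [List.nodup_cons] at hnd0
        exact hnd0.2.1 hs
      have hstep1 := h.reverse.step hnd1 hI1 hr1
      have hs1 : s = 1 := by omega
      subst hs1
      have h1 := (of_rot hr1 h.reverse).eq_range (hr1.nodup_iff.1 hnd1)
        (fun i => by rw [← hI1 i, hr1.mem_iff]) rfl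
      rw [← h1]
      exact hr1

/-! ### The instance -/

lemma mem_baseVertices_iff {n : ℕ} (hn : 0 < n) {p : Plane} :
    p ∈ baseVertices n ↔ ∃ i < 3 * n, p = bp n i := by
  have hcn : cVert n = bp n n := by
    apply toC_injective
    rw [toC_bp_zero hn le_rfl]
    apply Complex.ext <;> simp [cVert]
  have han : aVert n n = bp n (2 * n) := by
    apply toC_injective
    rw [toC_bp_one hn (by omega) le_rfl]
    apply Complex.ext <;> simp [aVert] <;> ring
  have hbn : bVert n n = bp n 0 := by
    apply toC_injective
    rw [toC_bp_zero hn (by omega)]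
    apply Complex.ext <;> simp [bVert]
  constructor
  · rintro ⟨i, hi, rfl | rfl | rfl⟩
    · rcases hi.lt_or_eq with h | rfl
      · refine ⟨n + i, by omega, ?_⟩
        rw [bp, if_neg (by omega), if_pos (by omega)]
        congr 1; omega
      · exact ⟨_, by omega, han⟩
    · rcases hi.lt_or_eq with h | rfl
      · refine ⟨2 * n + i, by omega, ?_⟩
        rw [bp, if_neg (by omega), if_neg (by omega)]
        congr 1; omega
      · exact ⟨_, by omega, hbn⟩
    · rcases hi.lt_or_eq with h | rfl
      · exact ⟨i, by omega, by rw [bp, if_pos h]⟩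
      · exact ⟨_, by omega, hcn⟩
  · rintro ⟨i, hi, rfl⟩
    unfold bp
    split_ifs with h1 h2
    · exact ⟨i, by omega, Or.inr (Or.inr rfl)⟩
    · exact ⟨i - n, by omega, Or.inl rfl⟩
    · exact ⟨i - 2 * n, by omega, Or.inr (Or.inl rfl)⟩

lemma toC_internal_mem_triangle {n m : ℕ} {p : Plane} (hp : p ∈ internalVertices n m) :
    toC p ∈ triangle n := by
  obtain ⟨j, hj, hjm, hp⟩ := hp
  have h3 : √3 * √3 = 3 := Real.mul_self_sqrt (by norm_num)
  have hs : 0 < √3 := by positivity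
  have hm : (0 : ℝ) < m := by exact_mod_cast (by omega : 0 < m)
  obtain ⟨τ, hτ⟩ : ∃ τ : ℝ, τ = j / m := ⟨_, rfl⟩
  have hτ0 : 0 ≤ τ := by rw [hτ]; positivity
  have hτ1 : τ ≤ 1 := by rw [hτ, div_le_one hm]; exact_mod_cast hjm
  have e1 : (j : ℝ) * n / (2 * m) = τ * n / 2 := by rw [hτ]; field_simp
  have e2 : (j : ℝ) * n / (2 * √3 * m) = τ * n * √3 / 6 := by
    rw [hτ]; field_simp; nlinarith
  have e3 : (j : ℝ) * n / (√3 * m) = τ * n * √3 / 3 := by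
    rw [hτ]; field_simp; nlinarith
  have hnn : (0 : ℝ) ≤ n := by positivity
  have k1 : 0 ≤ √3 * (τ * n) := by positivity
  have k2 : 0 ≤ √3 * ((1 - τ) * n) := by
    have : 0 ≤ 1 - τ := by linarith
    positivity
  intro s
  rcases hp with rfl | rfl | rfl <;> fin_cases s <;>
    simp only [Fin.mk_one, Fin.zero_eta, Fin.reduceFinMk, height_zero, height_one, height_two,
      toC_re, toC_im, eVert, fVert, gVert, Matrix.cons_val_zero,
      Matrix.cons_val_one, e1, e2, e3] <;> linarith

lemma toC_modified_mem_triangle {n m : ℕ} (hn : 0 < n) {p : Plane}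
    (hp : p ∈ modifiedInstance n m) : toC p ∈ triangle n := by
  rcases hp with hp | hp
  · obtain ⟨i, hi, rfl⟩ := (mem_baseVertices_iff hn).1 hp
    exact toC_bp_mem_triangle hn hi.le
  · exact toC_internal_mem_triangle hp.1

lemma modified_not_collinear {n m : ℕ} (hn : 0 < n) :
    ¬ ∃ o d : Plane, ∀ y ∈ modifiedInstance n m, ∃ r : ℝ, y = o + r • d := by
  rintro ⟨o, d, h⟩
  have hmem : ∀ i < 3 * n, bp n i ∈ modifiedInstance n m := fun i hi =>
    Or.inl ((mem_baseVertices_iff hn).2 ⟨i, hi, rfl⟩)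
  obtain ⟨r0, h0⟩ := h _ (hmem 0 (by omega))
  obtain ⟨r1, h1⟩ := h _ (hmem n (by omega))
  obtain ⟨r2, h2⟩ := h _ (hmem (2 * n) (by omega))
  have hc : cross (toC (bp n 0)) (toC (bp n n)) (toC (bp n (2 * n))) = 0 := by
    rw [h0, h1, h2, cross_eq]
    simp
    ring
  have hn' : (0 : ℝ) < n := by exact_mod_cast hn
  rw [toC_bp_zero hn (by omega), toC_bp_zero hn le_rfl, toC_bp_two le_rfl, cross_eq] at hc
  simp at hc
  omega

/-! ### Base vertices in a tour -/

open Classical in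
/-- The base vertices in the order in which they are visited. -/
noncomputable def baseList (n : ℕ) (l : List Plane) : List Plane :=
  l.filter (· ∈ baseVertices n)

lemma baseList_append (n : ℕ) (X Y : List Plane) :
    baseList n (X ++ Y) = baseList n X ++ baseList n Y := by
  simp [baseList]

lemma baseList_isRotated {n : ℕ} {l l' : List Plane} (h : l ~r l') :
    baseList n l ~r baseList n l' := by
  obtain ⟨X, Y, rfl, rfl⟩ := isRotated_iff_append.1 h
  rw [baseList_append, baseList_append]
  exact List.isRotated_append

/-- A rotation of the base vertices lifts to a rotation of the tour, which makes it possible to cut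
the tour at prescribed base vertices. -/
lemma exists_isRotated_of_baseList {n : ℕ} {l F : List Plane} (h : baseList n l ~r F) :
    ∃ l', l ~r l' ∧ baseList n l' = F := by
  obtain ⟨X, Y, h1, rfl⟩ := isRotated_iff_append.1 h
  obtain ⟨l₁, l₂, rfl, h2, h3⟩ := List.filter_eq_append_iff.1 h1
  refine ⟨l₂ ++ l₁, List.isRotated_append, ?_⟩
  rw [baseList_append]
  exact congrArg₂ _ h3 h2

lemma baseList_eq_cons {n : ℕ} {l F : List Plane} {x : Plane} (h : baseList n l = x :: F) :
    ∃ l₁ l₂, l = l₁ ++ x :: l₂ ∧ (∀ p ∈ l₁, p ∉ baseVertices n) ∧ baseList n l₂ = F := by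
  obtain ⟨l₁, l₂, h1, h2, -, h4⟩ := List.filter_eq_cons_iff.1 h
  exact ⟨l₁, l₂, h1, by simpa using h2, h4⟩

lemma mem_baseList {n : ℕ} {l : List Plane} {p : Plane} :
    p ∈ baseList n l ↔ p ∈ l ∧ p ∈ baseVertices n := by
  simp [baseList]

/-- The base vertices of an optimum tour are visited in counterclockwise or clockwise order. -/
lemma IsOptimumTour.baseList_isRotated {n m : ℕ} (hn : 0 < n) {l : List Plane}
    (hl : IsOptimumTour (modifiedInstance n m) l) :
    baseList n l ~r baseCycle n ∨ (baseList n l).reverse ~r baseCycle n := by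
  have hidx : ∀ p ∈ baseVertices n, ∃ i, i < 3 * n ∧ bp n i = p := fun p hp => by
    obtain ⟨i, hi, h⟩ := (mem_baseVertices_iff hn).1 hp
    exact ⟨i, hi, h.symm⟩
  choose! idx hidx using hidx
  set F := baseList n l with hF
  have hFb : ∀ p ∈ F, p ∈ baseVertices n := fun p hp => (mem_baseList.1 hp).2
  have hFI : (F.map idx).map (bp n) = F := by
    rw [List.map_map]
    nth_rewrite 2 [← List.map_id F]
    apply List.map_congr_left
    intro p hp
    exact (hidx p (hFb p hp)).2
  have hFnd : F.Nodup := hl.1.1.filter _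
  have hInd : (F.map idx).Nodup := by
    refine List.Nodup.of_map (bp n) ?_
    rw [hFI]; exact hFnd
  have hI : ∀ i, i ∈ F.map idx ↔ i < 3 * n := by
    intro i
    constructor
    · intro h
      obtain ⟨p, hp, rfl⟩ := List.mem_map.1 h
      exact (hidx p (hFb p hp)).1
    · intro h
      have hb : bp n i ∈ baseVertices n := (mem_baseVertices_iff hn).2 ⟨i, h, rfl⟩
      have h1 : bp n i ∈ F := mem_baseList.2 ⟨(hl.1.2 _).2 (Or.inl hb), hb⟩
      have h2 : idx (bp n i) = i := bp_injOn hn (hidx _ hb).1 h (hidx _ hb).2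
      rw [← h2]
      exact List.mem_map_of_mem h1
  -- Separated neighbours would be the ends of two vertex-disjoint subpaths of the tour, contrary to
  -- `not_alternate`.
  have hno : Noncrossing (F.map idx) := by
    intro x y R₁ z w R₂ hr hsep
    have hr' : F ~r (x :: y :: (R₁ ++ z :: w :: R₂)).map (bp n) := by
      have := hr.map (bp n)
      rwa [hFI] at this
    obtain ⟨l', hl', hb⟩ := exists_isRotated_of_baseList hr'
    have hopt := hl.of_isRotated hl'
    simp only [List.map_cons, List.map_append] at hb
    obtain ⟨L₀, L₁, rfl, -, hb⟩ := baseList_eq_cons hb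
    obtain ⟨P, L₂, rfl, -, hb⟩ := baseList_eq_cons hb
    obtain ⟨S₁, L₃, rfl, -, hb⟩ := List.filter_eq_append_iff.1 hb
    obtain ⟨S₂, L₄, rfl, -, hb⟩ := baseList_eq_cons hb
    obtain ⟨Q, S', rfl, -, -⟩ := baseList_eq_cons hb
    have hnd := hr.nodup_iff.1 hInd
    have hm : ∀ i ∈ x :: y :: (R₁ ++ z :: w :: R₂), i < 3 * n := fun i hi =>
      (hI i).1 (hr.mem_iff.2 hi)
    have hx := hm x (by simp)
    have hy := hm y (by simp)
    have hz := hm z (by simp)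
    have hw := hm w (by simp)
    have halt : Alternate n x y z w := by
      simp only [List.nodup_cons, List.mem_cons, List.mem_append, not_or] at hnd
      exact alternate_of_separated hn hx hy hz hw hsep hnd.1.1 hnd.1.2.2.1 hnd.1.2.2.2.1
        hnd.2.1.2.1 hnd.2.1.2.2.1
    have hopt' : IsOptimumTour (modifiedInstance n m) ((bp n x :: (P ++ [bp n y])) ++ (S₁ ++ S₂) ++
        (bp n z :: (Q ++ [bp n w])) ++ (S' ++ L₀)) := by
      refine hopt.of_isRotated ?_
      have := List.isRotated_append (l := L₀)
        (l' := bp n x :: (P ++ bp n y :: (S₁ ++ (S₂ ++ bp n z :: (Q ++ bp n w :: S')))))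
      simpa using this
    exact hopt'.not_alternate hn (modified_not_collinear hn)
      (fun p hp => toC_modified_mem_triangle hn hp) hx hy hz hw halt
  rw [baseCycle_eq_map_range]
  rcases hno.isRotated_range (by omega) hInd hI with h | h
  · left
    have := h.map (bp n)
    rwa [hFI] at this
  · right
    have := h.map (bp n)
    rwa [List.map_reverse, hFI] at this

lemma IsOptimumTour.isCounterclockwise_or {n m : ℕ} (hn : 0 < n) {l : List Plane}
    (hl : IsOptimumTour (modifiedInstance n m) l) :
    IsCounterclockwise n l ∨ IsCounterclockwise n l.reverse := by
  rcases hl.baseList_isRotated hn with h | h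
  · exact Or.inl ⟨_, List.filter_sublist, h⟩
  · exact Or.inr ⟨_, List.Sublist.reverse List.filter_sublist, h⟩

lemma mem_baseCycle {n : ℕ} (hn : 0 < n) {p : Plane} : p ∈ baseCycle n ↔ p ∈ baseVertices n := by
  rw [baseCycle_eq_map_range, mem_baseVertices_iff hn]
  simp [eq_comm]

lemma nodup_baseCycle {n : ℕ} (hn : 0 < n) : (baseCycle n).Nodup := by
  rw [baseCycle_eq_map_range]
  refine List.Nodup.map_on ?_ List.nodup_range
  intro i hi j hj h
  exact bp_injOn hn (List.mem_range.1 hi) (List.mem_range.1 hj) h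

/-- A sublist with all base vertices has the same length as the full list of visited base vertices,
so the two agree. -/
lemma IsCounterclockwise.baseList_isRotated {n m : ℕ} (hn : 0 < n) {l : List Plane}
    (hl : IsTour (modifiedInstance n m) l) (h : IsCounterclockwise n l) :
    baseList n l ~r baseCycle n := by
  obtain ⟨b, hb, hr⟩ := h
  have hbb : ∀ p ∈ b, p ∈ baseVertices n := fun p hp => (mem_baseCycle hn).1 (hr.mem_iff.1 hp)
  have h1 : b.Sublist (baseList n l) := by
    have h2 : baseList n b = b := List.filter_eq_self.2 (by simpa using hbb)
    rw [← h2]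
    exact hb.filter _
  have h2 : b.length = (baseList n l).length := by
    have : b.Perm (baseList n l) := (List.perm_ext_iff_of_nodup (hr.nodup_iff.2 (nodup_baseCycle hn))
      (hl.1.filter _)).2 fun p => by
        rw [hr.mem_iff, mem_baseCycle hn]
        constructor
        · intro hp
          exact mem_baseList.2 ⟨(hl.2 p).2 (Or.inl hp), hp⟩
        · intro hp
          exact (mem_baseList.1 hp).2
    exact this.length_eq
  rw [← h1.eq_of_length h2]
  exact hr

lemma bp_three_mul (n : ℕ) (hn : 0 < n) : bp n (3 * n) = bp n 0 := by
  apply toC_injective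
  rw [toC_bp_zero (i := 0) hn (by omega), toC_bp_two (i := 3 * n) (by omega)]
  apply Complex.ext <;> push_cast <;> ring

/-- Neighbours in the cyclic order of the base vertices have consecutive indices. -/
lemma succ_of_isRotated_baseCycle {n : ℕ} (hn : 0 < n) {x y : Plane} {R : List Plane}
    (h : (x :: y :: R) ~r baseCycle n) :
    ∃ i < 3 * n, x = bp n i ∧ y = bp n (i + 1) := by
  obtain ⟨k, hk⟩ := h.symm
  have hlen : (baseCycle n).length = 3 * n := by rw [baseCycle_eq_map_range]; simp
  have h0 : x = ((baseCycle n).rotate k)[0]'(by rw [hk]; simp) := by simp [hk]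
  have h1 : y = ((baseCycle n).rotate k)[1]'(by rw [hk]; simp) := by simp [hk]
  rw [List.getElem_rotate] at h0 h1
  simp only [baseCycle_eq_map_range, List.getElem_map, List.getElem_range, List.length_map,
    List.length_range] at h0 h1
  have hlt : (0 + k) % (3 * n) < 3 * n := Nat.mod_lt _ (by omega)
  refine ⟨(0 + k) % (3 * n), hlt, h0, ?_⟩
  rw [h1]
  have e : (1 + k) % (3 * n) = ((0 + k) % (3 * n) + 1) % (3 * n) := by
    rw [Nat.mod_add_mod]; congr 1; omega
  rw [e]
  rcases (show (0 + k) % (3 * n) + 1 ≤ 3 * n from hlt).lt_or_eq with h2 | h2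
  · rw [Nat.mod_eq_of_lt h2]
  · rw [h2, Nat.mod_self, bp_three_mul n hn]

/-! ### A lower bound for closed tours on a star with three legs -/

/-- The pairs of cyclically consecutive elements. -/
def cyclicPairs {α : Type*} (W : List α) : List (α × α) := W.zip (W.rotate 1)

lemma sum_map_fst_cyclicPairs {α M : Type*} [AddCommMonoid M] (W : List α) (g : α → M) :
    ((cyclicPairs W).map fun e => g e.1).sum = (W.map g).sum := by
  have h : (cyclicPairs W).map Prod.fst = W := List.map_fst_zip (by simp)
  conv_rhs => rw [← h]
  rw [List.map_map]; rfl

lemma sum_map_snd_cyclicPairs {α M : Type*} [AddCommMonoid M] (W : List α) (g : α → M) :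
    ((cyclicPairs W).map fun e => g e.2).sum = (W.map g).sum := by
  have h : (cyclicPairs W).map Prod.snd = W.rotate 1 := List.map_snd_zip (by simp)
  have h2 : ((W.rotate 1).map g).sum = (W.map g).sum :=
    ((List.rotate_perm W 1).map g).sum_eq
  rw [← h2, ← h, List.map_map]; rfl

lemma mem_zip_tail {α : Type*} (R₁ : List α) (z w : α) (R₂ : List α) (c : α) :
    (z, w) ∈ (R₁ ++ z :: w :: R₂).zip ((R₁ ++ z :: w :: R₂).tail ++ [c]) := by
  induction R₁ with
  | nil => simp
  | cons r R₁ ih =>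
    cases R₁ with
    | nil => simp
    | cons r' R₁ =>
      simp only [List.cons_append, List.tail_cons, List.zip_cons_cons, List.mem_cons] at ih ⊢
      right
      exact ih

lemma mem_cyclicPairs {α : Type*} (R₁ : List α) (z w : α) (R₂ : List α) :
    (z, w) ∈ cyclicPairs (R₁ ++ z :: w :: R₂) := by
  have h : ∀ (L : List α) (hL : L ≠ []), L.rotate 1 = L.tail ++ [L.head hL] := by
    intro L hL
    cases L with
    | nil => exact absurd rfl hL
    | cons a L => simp
  rw [cyclicPairs, h _ (by simp)]
  exact mem_zip_tail _ _ _ _ _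

open Classical in
/-- The number of steps of the closed sequence `W` that enter or leave the set `S`. -/
noncomputable def cut {α : Type*} (S : α → Prop) (W : List α) : ℕ :=
  ((cyclicPairs W).map fun e => if (S e.1 ↔ S e.2) then 0 else 1).sum

/-- The members of `S` among the ends of all steps are counted twice over the closed sequence; steps
inside `S` account for two each and crossing steps for one. -/
lemma even_cut {α : Type*} (S : α → Prop) (W : List α) : Even (cut S W) := by
  classical
  have h : cut S W + 2 * ((cyclicPairs W).map fun e => if S e.1 ∧ S e.2 then 1 else 0).sum =
      2 * (W.map fun x => if S x then 1 else 0).sum := by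
    have h1 := sum_map_fst_cyclicPairs W fun x => if S x then 1 else 0
    have h2 := sum_map_snd_cyclicPairs W fun x => if S x then 1 else 0
    rw [two_mul, two_mul]
    nth_rewrite 1 [← h1]
    rw [← h2, cut, ← List.sum_map_add, ← List.sum_map_add, ← List.sum_map_add]
    congr 1
    apply List.map_congr_left
    intro e _
    by_cases h1 : S e.1 <;> by_cases h2 : S e.2 <;> simp [h1, h2]
  rw [Nat.even_iff]
  omega

lemma two_le_cut {α : Type*} {S : α → Prop} {W : List α} (h1 : ∃ a ∈ W, S a)
    (h2 : ∃ a ∈ W, ¬ S a) : 2 ≤ cut S W := by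
  classical
  obtain ⟨R₁, z, w, R₂, rfl, h⟩ := exists_adjacent_change h1 h2
  have hm := mem_cyclicPairs R₁ z w R₂
  have h3 : 1 ≤ cut S (R₁ ++ z :: w :: R₂) := by
    refine List.single_le_sum (by simp) 1 (List.mem_map.2 ⟨_, hm, ?_⟩)
    rw [if_neg]
    tauto
  have h4 := Nat.even_iff.1 (even_cut S (R₁ ++ z :: w :: R₂))
  omega

/-- The comb inequality with three teeth for a closed tour. -/
lemma comb_inequality {α : Type*} {W : List α} {H : α → Prop} {T : Fin 3 → α → Prop}
    (hT : ∀ x i j, T i x → T j x → i = j)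
    (h1 : ∀ i, ∃ a ∈ W, T i a ∧ H a) (h2 : ∀ i, ∃ a ∈ W, T i a ∧ ¬ H a)
    : 10 ≤ cut H W + ∑ i, cut (T i) W := by
  classical
  set a : Fin 3 → ℕ := fun i => ((cyclicPairs W).map fun e =>
    if T i e.1 ∧ T i e.2 ∧ ¬ (H e.1 ↔ H e.2) then 1 else 0).sum with ha
  have hne : ∀ i j, i ≠ j → ∃ b ∈ W, ¬ T i b := fun i j hij => by
    obtain ⟨b, hb, hb'⟩ := h1 j
    exact ⟨b, hb, fun hc => hij (hT b i j hc hb'.1)⟩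
  have hne' : ∀ i, ∃ b ∈ W, ¬ T i b := fun i => by
    fin_cases i
    · exact hne 0 1 (by decide)
    · exact hne 1 0 (by decide)
    · exact hne 2 0 (by decide)
  -- A step inside the tooth that crosses the handle is counted by both halves of the tooth but not
  -- by its cut; a step leaving the tooth is counted once on either side.
  have hsum : ∀ i, cut (fun x => T i x ∧ H x) W + cut (fun x => T i x ∧ ¬ H x) W =
      cut (T i) W + 2 * a i := by
    intro i
    rw [two_mul, ha]
    simp only [cut]
    rw [← List.sum_map_add, ← List.sum_map_add, ← List.sum_map_add]
    congr 1
    apply List.map_congr_left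
    intro e _
    by_cases h1 : T i e.1 <;> by_cases h2 : T i e.2 <;> by_cases h3 : H e.1 <;>
      by_cases h4 : H e.2 <;> simp [h1, h2, h3, h4]
  have hge : ∀ i, 4 ≤ cut (T i) W + 2 * a i := by
    intro i
    rw [← hsum i]
    have k1 : 2 ≤ cut (fun x => T i x ∧ H x) W := two_le_cut (h1 i) (by
      obtain ⟨b, hb, hb'⟩ := hne' i
      exact ⟨b, hb, fun h => hb' h.1⟩)
    have k2 : 2 ≤ cut (fun x => T i x ∧ ¬ H x) W := two_le_cut (h2 i) (by
      obtain ⟨b, hb, hb'⟩ := hne' i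
      exact ⟨b, hb, fun h => hb' h.1⟩)
    omega
  have hT2 : ∀ i, 2 ≤ cut (T i) W := fun i => two_le_cut (by
    obtain ⟨b, hb, hb'⟩ := h1 i
    exact ⟨b, hb, hb'.1⟩) (hne' i)
  have hH2 : 2 ≤ cut H W := two_le_cut (by
    obtain ⟨b, hb, hb'⟩ := h1 0
    exact ⟨b, hb, hb'.2⟩) (by
    obtain ⟨b, hb, hb'⟩ := h2 0
    exact ⟨b, hb, hb'.2⟩)
  -- The teeth are disjoint, so each step across the handle is counted for at most one of them.
  have hHa : a 0 + a 1 + a 2 ≤ cut H W := by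
    rw [ha]
    simp only [cut]
    rw [← List.sum_map_add, ← List.sum_map_add]
    apply List.sum_le_sum
    intro e _
    have t01 := hT e.1 0 1
    have t02 := hT e.1 0 2
    have t12 := hT e.1 1 2
    simp only [Fin.isValue, zero_ne_one, imp_false, Fin.reduceEq] at t01 t02 t12
    by_cases h5 : H e.1 ↔ H e.2
    · simp [h5]
    · by_cases c0 : T 0 e.1 <;> by_cases c1 : T 1 e.1 <;> by_cases c2 : T 2 e.1 <;>
        simp [c0, c1, c2, h5] at t01 t02 t12 ⊢ <;> split_ifs <;> omega
  -- If every `a i` is positive, the handle cut is at least 3, hence 4 by parity, and each tooth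
  -- contributes 2. If some `a i` vanishes, its tooth contributes 4, the other two teeth 2 each and
  -- the handle 2. Both totals are at least 10.
  have hHe := Nat.even_iff.1 (even_cut H W)
  have g0 := hge 0
  have g1 := hge 1
  have g2 := hge 2
  have f0 := hT2 0
  have f1 := hT2 1
  have f2 := hT2 2
  have e0 := Nat.even_iff.1 (even_cut (T 0) W)
  have e1 := Nat.even_iff.1 (even_cut (T 1) W)
  have e2 := Nat.even_iff.1 (even_cut (T 2) W)
  rw [Fin.sum_univ_three]
  omega

/-- The distance between two points of the star: legs meet at angles of 120 degrees. -/
noncomputable def starDist (x y : Fin 3 × ℕ) : ℝ :=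
  if x.1 = y.1 then |(x.2 : ℝ) - y.2| else √((x.2 : ℝ) ^ 2 + x.2 * y.2 + y.2 ^ 2)

/-- The potential that determines the weights of the cuts. -/
noncomputable def cutPotential (K s : ℝ) : ℝ := (√(s ^ 2 + s * K + K ^ 2) - K + s) / 2

/-- This is the triangle inequality for moving an end point by `c` along its leg, as the roots are
distances between points on two legs meeting at 120 degrees. -/
lemma sqrt_form_le {s t c : ℝ} (hs : 0 ≤ s) (ht : 0 ≤ t) (hc : 0 ≤ c) :
    √(s ^ 2 + s * (t + c) + (t + c) ^ 2) ≤ √(s ^ 2 + s * t + t ^ 2) + c := by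
  have h0 : 0 ≤ s ^ 2 + s * t + t ^ 2 := by positivity
  rw [Real.sqrt_le_left (by positivity), add_sq (√_), Real.sq_sqrt h0]
  have h1 : s / 2 + t ≤ √(s ^ 2 + s * t + t ^ 2) := by
    apply Real.le_sqrt_of_sq_le
    nlinarith
  nlinarith

lemma cutPotential_zero {K : ℝ} (hK : 0 ≤ K) : cutPotential K 0 = 0 := by
  simp [cutPotential, Real.sqrt_sq hK]

lemma cutPotential_self {K : ℝ} (hK : 0 ≤ K) : cutPotential K K = √3 * K / 2 := by
  have : K ^ 2 + K * K + K ^ 2 = 3 * K ^ 2 := by ring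
  rw [cutPotential, this, Real.sqrt_mul (by norm_num), Real.sqrt_sq hK]
  ring

lemma cutPotential_step_le {K s : ℝ} (hK : 0 ≤ K) (hs : 0 ≤ s) :
    cutPotential K (s + 1) - cutPotential K s ≤ 1 := by
  have h := sqrt_form_le hK hs zero_le_one
  have e1 : (s + 1) ^ 2 + (s + 1) * K + K ^ 2 = K ^ 2 + K * (s + 1) + (s + 1) ^ 2 := by ring
  have e2 : s ^ 2 + s * K + K ^ 2 = K ^ 2 + K * s + s ^ 2 := by ring
  rw [cutPotential, cutPotential, e1, e2]
  linarith

/-- The root is at most `s + K`, so it grows by at least `1 / 2` per unit step; the summand `s` adds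
1 before halving. -/
lemma le_cutPotential_step {K s : ℝ} (hK : 0 ≤ K) (hs : 0 ≤ s) :
    3 / 4 ≤ cutPotential K (s + 1) - cutPotential K s := by
  have h0 : 0 ≤ s ^ 2 + s * K + K ^ 2 := by positivity
  have h2 : √(s ^ 2 + s * K + K ^ 2) ≤ s + K := by
    rw [Real.sqrt_le_left (by positivity)]
    nlinarith [mul_nonneg hs hK]
  have h : √(s ^ 2 + s * K + K ^ 2) + 1 / 2 ≤ √((s + 1) ^ 2 + (s + 1) * K + K ^ 2) := by
    apply Real.le_sqrt_of_sq_le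
    rw [add_sq, Real.sq_sqrt h0]
    nlinarith
  rw [cutPotential, cutPotential]
  linarith

/-- For fixed `r` the difference of the root and `s - r` decreases in `s`, so the case `s = K` is
decisive. There equality holds, which is what determines the form of `cutPotential`. -/
lemma cutPotential_edge {K r s : ℝ} (hr : 0 ≤ r) (hrs : r ≤ s) (hs : s ≤ K) :
    2 * cutPotential K r + (s - r) ≤ √(r ^ 2 + r * s + s ^ 2) := by
  have h := sqrt_form_le (s := r) (t := s) (c := K - s) hr (by linarith) (by linarith)
  rw [add_sub_cancel] at h
  rw [cutPotential]
  linarith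

lemma sum_range_ite_lt {K r : ℕ} (hr : r ≤ K) (c : ℕ → ℝ) :
    ∑ i ∈ Finset.range K, c i * (if i < r then 1 else 0) = ∑ i ∈ Finset.range r, c i := by
  simp only [mul_ite, mul_one, mul_zero]
  rw [← Finset.sum_filter]
  congr 1
  ext i
  simp only [Finset.mem_filter, Finset.mem_range]
  omega

lemma list_sum_map_finset_sum {α ι : Type*} (E : List α) (s : Finset ι) (f : ι → α → ℝ) :
    (E.map fun e => ∑ i ∈ s, f i e).sum = ∑ i ∈ s, (E.map (f i)).sum := by
  induction E with
  | nil => simp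
  | cons e E ih => simp [ih, Finset.sum_add_distrib]

open Classical in
lemma cut_cast {α : Type*} (S : α → Prop) (W : List α) :
    (cut S W : ℝ) = ((cyclicPairs W).map fun e => if (S e.1 ↔ S e.2) then (0 : ℝ) else 1).sum := by
  rw [cut, Nat.cast_list_sum, List.map_map]
  congr 1
  apply List.map_congr_left
  intro e _
  simp only [Function.comp_apply]
  split_ifs <;> simp

open Classical in
/-- The weights of the cuts that an edge of the star crosses sum up to at most its length. -/
lemma sum_cut_weights_le {K : ℕ} (x y : Fin 3 × ℕ) (hx : x.2 ≤ K) (hy : y.2 ≤ K) :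
    ∑ i ∈ Finset.range K, (cutPotential K ((i : ℝ) + 1) - cutPotential K i) *
        ∑ σ : Fin 3, (if ((x.1 = σ ∧ i < x.2) ↔ (y.1 = σ ∧ i < y.2)) then (0 : ℝ) else 1) +
      ∑ i ∈ Finset.range K, (1 - (cutPotential K ((i : ℝ) + 1) - cutPotential K i)) *
        (if (i < x.2 ↔ i < y.2) then (0 : ℝ) else 1) ≤ starDist x y := by
  wlog hxy : x.2 ≤ y.2 generalizing x y
  · have h := this y x hy hx (by omega)
    have hsymm : starDist y x = starDist x y := by
      unfold starDist
      by_cases h : x.1 = y.1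
      · rw [if_pos h, if_pos h.symm, abs_sub_comm]
      · rw [if_neg h, if_neg (Ne.symm h)]
        congr 1; ring
    rw [hsymm] at h
    refine le_trans (le_of_eq ?_) h
    congr 1
    · refine Finset.sum_congr rfl fun i _ => ?_
      congr 1
      refine Finset.sum_congr rfl fun σ _ => ?_
      simp only [iff_comm]
    · refine Finset.sum_congr rfl fun i _ => ?_
      simp only [iff_comm]
  have hK0 : (0 : ℝ) ≤ K := by positivity
  have hA : ∀ r : ℕ, ∑ i ∈ Finset.range r, (cutPotential K ((i : ℝ) + 1) - cutPotential K i) =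
      cutPotential K r := by
    intro r
    have := Finset.sum_range_sub (fun i : ℕ => cutPotential K (i : ℝ)) r
    simp only [Nat.cast_add, Nat.cast_one, Nat.cast_zero, cutPotential_zero hK0, sub_zero] at this
    exact this
  have hB : ∀ r : ℕ, ∑ i ∈ Finset.range r,
      (1 - (cutPotential K ((i : ℝ) + 1) - cutPotential K i)) = r - cutPotential K r := by
    intro r
    rw [Finset.sum_sub_distrib, hA]; simp
  -- As `x.2 ≤ y.2`, exactly the circular cuts with `x.2 ≤ i < y.2` are crossed.
  have hH : ∀ i : ℕ, (if (i < x.2 ↔ i < y.2) then (0 : ℝ) else 1) =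
      (if i < y.2 then 1 else 0) - (if i < x.2 then 1 else 0) := by
    intro i
    by_cases h1 : i < x.2
    · simp [h1, h1.trans_le hxy]
    · by_cases h2 : i < y.2 <;> simp [h1, h2]
  simp only [hH, mul_sub, Finset.sum_sub_distrib]
  rw [sum_range_ite_lt hx, sum_range_ite_lt hy, hB, hB]
  obtain ⟨σ, r⟩ := x
  obtain ⟨τ, s⟩ := y
  simp only at hx hy hxy ⊢
  have hrs : (r : ℝ) ≤ s := by exact_mod_cast hxy
  have hsK : (s : ℝ) ≤ K := by exact_mod_cast hy
  by_cases hst : σ = τ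
  · subst hst
    have hT : ∀ i : ℕ, ∑ ρ : Fin 3, (if ((σ = ρ ∧ i < r) ↔ (σ = ρ ∧ i < s)) then (0 : ℝ) else 1) =
        (if i < s then 1 else 0) - (if i < r then 1 else 0) := by
      intro i
      rw [Finset.sum_eq_single σ]
      · by_cases h1 : i < r
        · simp [h1, h1.trans_le hxy]
        · by_cases h2 : i < s <;> simp [h1, h2]
      · intro ρ _ hρ
        simp [Ne.symm hρ]
      · simp
    simp only [hT]
    simp only [mul_sub, Finset.sum_sub_distrib]
    rw [sum_range_ite_lt hx, sum_range_ite_lt hy]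
    rw [hA, hA, starDist, if_pos rfl, abs_sub_comm, abs_of_nonneg (by simpa using hrs)]
    simp only
    linarith
  -- An edge between different legs crosses the leg cuts below both of its ends. With the circular
  -- cuts the total weight is `2 * cutPotential K r + (s - r)`, so `cutPotential_edge` applies; on a
  -- common leg the total is `s - r`.
  · have hT : ∀ i : ℕ, ∑ ρ : Fin 3, (if ((σ = ρ ∧ i < r) ↔ (τ = ρ ∧ i < s)) then (0 : ℝ) else 1) =
        (if i < r then 1 else 0) + (if i < s then 1 else 0) := by
      intro i
      have : ∀ ρ : Fin 3, (if ((σ = ρ ∧ i < r) ↔ (τ = ρ ∧ i < s)) then (0 : ℝ) else 1) =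
          (if σ = ρ then (if i < r then 1 else 0) else 0) +
          (if τ = ρ then (if i < s then 1 else 0) else 0) := by
        intro ρ
        by_cases h1 : σ = ρ
        · have h2 : τ ≠ ρ := fun h => hst (h1.trans h.symm)
          by_cases h3 : i < r <;> simp [h1, h2, h3]
        · by_cases h2 : τ = ρ
          · by_cases h3 : i < s <;> simp [h1, h2, h3]
          · simp [h1, h2]
      simp only [this, Finset.sum_add_distrib, Finset.sum_ite_eq, Finset.mem_univ, if_true]
    simp only [hT, mul_add, Finset.sum_add_distrib]
    rw [sum_range_ite_lt hx, sum_range_ite_lt hy, hA, hA, starDist, if_neg hst]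
    have := cutPotential_edge (K := K) (r := r) (s := s) (by positivity) hrs hsK
    simp only
    linarith

/-- A closed tour through all points of the star has length at least `(4 + √3) K - 1 / 2`. -/
lemma star_tour_bound {K : ℕ} (hK : 1 ≤ K) {W : List (Fin 3 × ℕ)} (hW : ∀ x ∈ W, x.2 ≤ K)
    (hall : ∀ σ r, 1 ≤ r → r ≤ K → (σ, r) ∈ W) (hM : ∃ σ, (σ, 0) ∈ W) :
    (4 + √3) * K - 1 / 2 ≤ ((cyclicPairs W).map fun e => starDist e.1 e.2).sum := by
  classical
  set a : ℕ → ℝ := fun i => cutPotential K ((i : ℝ) + 1) - cutPotential K i with ha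
  set t : ℕ → ℝ := fun i => ∑ σ : Fin 3, (cut (fun x : Fin 3 × ℕ => x.1 = σ ∧ i < x.2) W : ℝ)
    with ht
  set h : ℕ → ℝ := fun i => (cut (fun x : Fin 3 × ℕ => i < x.2) W : ℝ) with hh
  have hK0 : (0 : ℝ) ≤ K := by positivity
  have hlow : ∑ i ∈ Finset.range K, a i * t i + ∑ i ∈ Finset.range K, (1 - a i) * h i ≤
      ((cyclicPairs W).map fun e => starDist e.1 e.2).sum := by
    have e1 : ∑ i ∈ Finset.range K, a i * t i + ∑ i ∈ Finset.range K, (1 - a i) * h i =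
        ((cyclicPairs W).map fun e => ∑ i ∈ Finset.range K, a i *
          ∑ σ : Fin 3, (if ((e.1.1 = σ ∧ i < e.1.2) ↔ (e.2.1 = σ ∧ i < e.2.2)) then (0 : ℝ) else 1) +
          ∑ i ∈ Finset.range K, (1 - a i) *
            (if (i < e.1.2 ↔ i < e.2.2) then (0 : ℝ) else 1)).sum := by
      rw [List.sum_map_add, list_sum_map_finset_sum, list_sum_map_finset_sum]
      congr 1
      · refine Finset.sum_congr rfl fun i _ => ?_
        rw [List.sum_map_mul_left, list_sum_map_finset_sum]
        simp only [ht, cut_cast]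
        congr!
      · refine Finset.sum_congr rfl fun i _ => ?_
        rw [List.sum_map_mul_left]
        simp only [hh, cut_cast]
        congr!
    rw [e1]
    apply List.sum_le_sum
    intro e he
    have he1 : e.1 ∈ W := (List.of_mem_zip he).1
    have he2 : e.2 ∈ W := by
      have := (List.of_mem_zip he).2
      rwa [List.mem_rotate] at this
    exact sum_cut_weights_le e.1 e.2 (hW _ he1) (hW _ he2)
  refine le_trans ?_ hlow
  obtain ⟨σ₀, hM⟩ := hM
  have hleg : ∀ σ i, i < K → 2 ≤ cut (fun x : Fin 3 × ℕ => x.1 = σ ∧ i < x.2) W := by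
    intro σ i hi
    exact two_le_cut ⟨(σ, i + 1), hall _ _ (by omega) (by omega), rfl, Nat.lt_succ_self i⟩
      ⟨(σ₀, 0), hM, fun h => absurd h.2 (by simp)⟩
  have h6 : ∀ i, i < K → 6 ≤ t i := by
    intro i hi
    simp only [ht, Fin.sum_univ_three]
    have h0 := hleg 0 i hi
    have h1 := hleg 1 i hi
    have h2 := hleg 2 i hi
    exact_mod_cast (by omega : 6 ≤ cut (fun x : Fin 3 × ℕ => x.1 = 0 ∧ i < x.2) W +
      cut (fun x : Fin 3 × ℕ => x.1 = 1 ∧ i < x.2) W + cut (fun x : Fin 3 × ℕ => x.1 = 2 ∧ i < x.2) W)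
  have h2 : 2 ≤ h 0 := by
    have : 2 ≤ cut (fun x : Fin 3 × ℕ => 0 < x.2) W :=
      two_le_cut ⟨(0, 1), hall _ _ le_rfl hK, one_pos⟩ ⟨(σ₀, 0), hM, by simp⟩
    simp only [hh]
    exact_mod_cast this
  -- The handle consists of the points beyond `i + 1`, the teeth are the legs beyond `i`; outside
  -- the handle each tooth has the single point `(σ, i + 1)`.
  have h10 : ∀ i, i + 1 < K → 10 ≤ h (i + 1) + t i := by
    intro i hi
    have := comb_inequality (W := W) (H := fun x : Fin 3 × ℕ => i + 1 < x.2)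
      (T := fun σ x => x.1 = σ ∧ i < x.2) (fun x σ τ h1 h2 => h1.1.symm.trans h2.1)
      (fun σ => ⟨(σ, i + 2), hall _ _ (by omega) (by omega), ⟨rfl, by simp⟩, by simp⟩)
      (fun σ => ⟨(σ, i + 1), hall _ _ (by omega) (by omega), ⟨rfl, by simp⟩, by simp⟩)
    simp only [hh, ht]
    exact_mod_cast this
  have ha1 : ∀ i, a i ≤ 1 := fun i => cutPotential_step_le hK0 (by positivity)
  have ha2 : ∀ i, 3 / 4 ≤ a i := fun i => le_cutPotential_step hK0 (by positivity)
  obtain ⟨k, rfl⟩ : ∃ k, K = k + 1 := ⟨K - 1, by omega⟩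
  have hA : ∑ i ∈ Finset.range (k + 1), a i = √3 * ((k + 1 : ℕ) : ℝ) / 2 := by
    have := Finset.sum_range_sub (fun i : ℕ => cutPotential ((k + 1 : ℕ) : ℝ) (i : ℝ)) (k + 1)
    simp only [Nat.cast_zero, cutPotential_zero hK0, sub_zero, cutPotential_self hK0] at this
    rw [← this]
    refine Finset.sum_congr rfl fun i _ => ?_
    simp only [ha]
    push_cast; rfl
  -- Since `a i ≥ 3 / 4` exceeds `1 - a (i + 1) ≤ 1 / 4`, the circular cut can be paired completely
  -- with part of the leg cuts in the comb inequality; the remaining weight of the leg cuts uses `6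
  -- ≤ t i`.
  have hpair : ∀ i ∈ Finset.range k, 6 * a i + 4 * (1 - a (i + 1)) ≤
      a i * t i + (1 - a (i + 1)) * h (i + 1) := by
    intro i hi
    have hi' := Finset.mem_range.1 hi
    have q1 := h6 i (by omega)
    have q2 := h10 i (by omega)
    have q3 := ha1 (i + 1)
    have q4 := ha2 i
    have q5 := ha2 (i + 1)
    nlinarith [mul_nonneg (by linarith : 0 ≤ a i - (1 - a (i + 1))) (by linarith : 0 ≤ t i - 6),
      mul_nonneg (by linarith : 0 ≤ 1 - a (i + 1)) (by linarith : 0 ≤ h (i + 1) + t i - 10)]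
  have hs := Finset.sum_le_sum hpair
  rw [Finset.sum_add_distrib, Finset.sum_add_distrib, ← Finset.mul_sum, ← Finset.mul_sum] at hs
  have hA' := hA
  rw [Finset.sum_range_succ] at hA
  rw [Finset.sum_range_succ'] at hA'
  rw [Finset.sum_range_succ, Finset.sum_range_succ' (fun i => (1 - a i) * h i)]
  -- The unpaired terms are `t k` and `h 0`. The total is at least `2 A + 4 K - 2 + 2 a 0`, with `A`
  -- the sum of all `a i`, so `2 A = √3 K`; now `a 0 ≥ 3 / 4` gives the loss of `1 / 2`.
  have q1 := h6 k (by omega)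
  have q2 := ha2 k
  have q3 := ha2 0
  have q4 := ha1 0
  have p1 : 6 * a k ≤ a k * t k := by nlinarith
  have p2 : 2 * (1 - a 0) ≤ (1 - a 0) * h 0 := by nlinarith
  have p3 : ∑ i ∈ Finset.range k, (1 - a (i + 1)) = k - ∑ i ∈ Finset.range k, a (i + 1) := by
    rw [Finset.sum_sub_distrib]; simp
  rw [p3] at hs
  push_cast at hA hA' ⊢
  linarith

/-! ### The internal vertices -/

/-- The point on the leg `x.1` (of the legs `e`, `f`, `g`) at distance `x.2 * γ` from `M`. -/
noncomputable def starPt (n m : ℕ) (x : Fin 3 × ℕ) : Plane :=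
  !₂[(n : ℝ) / 2 + ![-√3 / 2, √3 / 2, 0] x.1 * (x.2 * gam n m),
    m * gam n m / 2 + ![-1 / 2, -1 / 2, 1] x.1 * (x.2 * gam n m)]

lemma dist_plane (p q : Plane) : dist p q = √((p 0 - q 0) ^ 2 + (p 1 - q 1) ^ 2) := by
  rw [EuclideanSpace.dist_eq, Fin.sum_univ_two, Real.dist_eq, Real.dist_eq, sq_abs, sq_abs]

lemma gam_pos {n m : ℕ} (hn : 0 < n) (hm : 0 < m) : 0 < gam n m := by
  have hn' : (0 : ℝ) < n := by exact_mod_cast hn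
  have hm' : (0 : ℝ) < m := by exact_mod_cast hm
  unfold gam; positivity

lemma cast_eq_gam {n m : ℕ} (hm : 0 < m) : (n : ℝ) = √3 * (m * gam n m) := by
  have hm' : (0 : ℝ) < m := by exact_mod_cast hm
  unfold gam; field_simp

/-- The law of cosines at the center, for an angle of 120 degrees. -/
lemma dist_starPt {n m : ℕ} (hn : 0 < n) (hm : 0 < m) (x y : Fin 3 × ℕ) :
    dist (starPt n m x) (starPt n m y) = gam n m * starDist x y := by
  have hg := gam_pos hn hm
  have h3 : √3 * √3 = 3 := Real.mul_self_sqrt (by norm_num)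
  rw [dist_plane, starDist]
  obtain ⟨σ, r⟩ := x
  obtain ⟨τ, s⟩ := y
  simp only
  split_ifs with h
  · subst h
    have e : gam n m * |(r : ℝ) - s| = √((gam n m * ((r : ℝ) - s)) ^ 2) := by
      rw [Real.sqrt_sq_eq_abs, abs_mul, abs_of_pos hg]
    rw [e]
    congr 1
    fin_cases σ <;> simp [starPt] <;> ring_nf <;>
      simp only [Real.sq_sqrt (show (0 : ℝ) ≤ 3 by norm_num)] <;> ring
  · have e : gam n m * √((r : ℝ) ^ 2 + r * s + s ^ 2) =
        √(gam n m ^ 2 * ((r : ℝ) ^ 2 + r * s + s ^ 2)) := by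
      rw [Real.sqrt_mul (by positivity), Real.sqrt_sq hg.le]
    rw [e]
    congr 1
    fin_cases σ <;> fin_cases τ <;> simp [starPt] at h ⊢ <;> ring_nf <;>
      simp only [Real.sq_sqrt (show (0 : ℝ) ≤ 3 by norm_num)] <;> ring

lemma le_starDist (x y : Fin 3 × ℕ) : |(x.2 : ℝ) - y.2| ≤ starDist x y := by
  unfold starDist
  split_ifs with h
  · exact le_rfl
  · apply Real.abs_le_sqrt
    have : (0 : ℝ) ≤ x.2 * y.2 := by positivity
    nlinarith

lemma eVert_eq {n m j : ℕ} (hm : 0 < m) (hj : j ≤ m) : eVert n m j = starPt n m (0, m - j) := by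
  have hm' : (0 : ℝ) < m := by exact_mod_cast hm
  have h3 : √3 * √3 = 3 := Real.mul_self_sqrt (by norm_num)
  have hs : 0 < √3 := by positivity
  ext i
  fin_cases i <;> simp [eVert, starPt, gam, Nat.cast_sub hj] <;> field_simp <;> ring

lemma fVert_eq {n m j : ℕ} (hm : 0 < m) (hj : j ≤ m) : fVert n m j = starPt n m (1, m - j) := by
  have hm' : (0 : ℝ) < m := by exact_mod_cast hm
  have h3 : √3 * √3 = 3 := Real.mul_self_sqrt (by norm_num)
  have hs : 0 < √3 := by positivity
  ext i
  fin_cases i <;> simp [fVert, starPt, gam, Nat.cast_sub hj] <;> field_simp <;> ring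

lemma gVert_eq {n m j : ℕ} (hm : 0 < m) (hj : j ≤ m) : gVert n m j = starPt n m (2, m - j) := by
  have hm' : (0 : ℝ) < m := by exact_mod_cast hm
  have h3 : √3 ^ 2 = 3 := Real.sq_sqrt (by norm_num)
  have hs : 0 < √3 := by positivity
  ext i
  fin_cases i <;> simp [gVert, starPt, gam, Nat.cast_sub hj]
  field_simp
  rw [h3]; ring

lemma cornerA_eq {n m : ℕ} (hm : 0 < m) : cornerA = starPt n m (0, m) := by
  have h := eVert_eq (n := n) (j := 0) hm (by omega)
  rw [Nat.sub_zero] at h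
  rw [← h]
  ext i; fin_cases i <;> simp [cornerA, eVert]

lemma cornerB_eq {n m : ℕ} (hm : 0 < m) : cornerB n = starPt n m (1, m) := by
  have h := fVert_eq (n := n) (j := 0) hm (by omega)
  rw [Nat.sub_zero] at h
  rw [← h]
  ext i; fin_cases i <;> simp [cornerB, fVert]

lemma cornerC_eq {n m : ℕ} (hm : 0 < m) : cornerC n = starPt n m (2, m) := by
  have h := gVert_eq (n := n) (j := 0) hm (by omega)
  rw [Nat.sub_zero] at h
  rw [← h]
  ext i; fin_cases i <;> simp [cornerC, gVert]

lemma starPt_zero (n m : ℕ) (σ τ : Fin 3) : starPt n m (σ, 0) = starPt n m (τ, 0) := by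
  simp [starPt]

lemma center_eq {n m : ℕ} (hm : 0 < m) (σ : Fin 3) : center n = starPt n m (σ, 0) := by
  have hm' : (0 : ℝ) < m := by exact_mod_cast hm
  have hs : 0 < √3 := by positivity
  ext i; fin_cases i <;> simp [center, starPt, gam]
  field_simp

/-- Numerical facts on the size of the instance. -/
lemma size_facts {n m : ℕ} (hn : 40 ≤ n) (hm : 22 ≤ m) :
    0 < gam n m ∧ 23 < m * gam n m ∧ 22 * gam n m ≤ m * gam n m := by
  have hg := gam_pos (show 0 < n by omega) (show 0 < m by omega)
  refine ⟨hg, ?_, ?_⟩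
  · have h := cast_eq_gam (n := n) (show 0 < m by omega)
    have hn' : (40 : ℝ) ≤ n := by exact_mod_cast hn
    have h3 : √3 < 1.7321 := by
      rw [Real.sqrt_lt' (by norm_num)]; norm_num
    by_contra hcon
    push Not at hcon
    have hpos : 0 ≤ m * gam n m := by positivity
    nlinarith
  · have hm' : (22 : ℝ) ≤ m := by exact_mod_cast hm
    exact mul_le_mul_of_nonneg_right hm' hg.le

/-- The radius of the star of remaining internal vertices. -/
lemma exists_radius {n m : ℕ} (hn : 40 ≤ n) (hm : 22 ≤ m) :
    ∃ K : ℕ, 1 ≤ K ∧ K < m ∧ max 10 (4 + 4 * gam n m) ≤ ((m : ℝ) - K) * gam n m ∧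
      ((m : ℝ) - K) * gam n m < max 10 (4 + 4 * gam n m) + gam n m := by
  obtain ⟨hg, h23, h22⟩ := size_facts hn hm
  set D := max 10 (4 + 4 * gam n m) with hD
  have hD0 : 10 ≤ D := le_max_left _ _
  have hDm : D + gam n m < m * gam n m := by
    rcases max_choice 10 (4 + 4 * gam n m) with h | h <;> rw [hD, h] <;> linarith
  -- The radius is `m - ⌈D / γ⌉`; `hDm` guarantees that it is positive.
  have h1 := Nat.le_ceil (D / gam n m)
  have h2 := Nat.ceil_lt_add_one (show 0 ≤ D / gam n m by positivity)
  set k := ⌈D / gam n m⌉₊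
  rw [div_le_iff₀ hg] at h1
  have h3 : (k : ℝ) * gam n m < D + gam n m := by
    have := mul_lt_mul_of_pos_right h2 hg
    rwa [add_mul, div_mul_cancel₀ _ hg.ne', one_mul] at this
  have hk : k < m := by
    have : (k : ℝ) < m := by
      by_contra hc
      push Not at hc
      have := mul_le_mul_of_nonneg_right hc hg.le
      linarith
    exact_mod_cast this
  have hk0 : 0 < k := by
    rcases Nat.eq_zero_or_pos k with h0 | h0
    · rw [h0] at h1; simp at h1; linarith
    · exact h0
  refine ⟨m - k, by omega, by omega, ?_, ?_⟩ <;> rw [Nat.cast_sub hk.le, sub_sub_cancel] <;>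
    assumption

/-- Among the three corners, the one on its own leg is nearest to an internal vertex, so the
distance condition only bounds the index on the leg. -/
lemma mem_modifiedInstance_iff {n m K : ℕ} (hn : 0 < n) (hKm : K < m)
    (h1 : max 10 (4 + 4 * gam n m) ≤ ((m : ℝ) - K) * gam n m)
    (h2 : ((m : ℝ) - K) * gam n m < max 10 (4 + 4 * gam n m) + gam n m) {p : Plane} :
    p ∈ modifiedInstance n m ↔ p ∈ baseVertices n ∨ ∃ x : Fin 3 × ℕ, x.2 ≤ K ∧ p = starPt n m x := by
  have hm : 0 < m := by omega
  have hg := gam_pos hn hm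
  set D := max 10 (4 + 4 * gam n m)
  have hinternal : p ∈ internalVertices n m ↔ ∃ x : Fin 3 × ℕ, x.2 < m ∧ p = starPt n m x := by
    constructor
    · rintro ⟨j, hj, hjm, rfl | rfl | rfl⟩
      · exact ⟨(0, m - j), by simp only; omega, eVert_eq hm hjm⟩
      · exact ⟨(1, m - j), by simp only; omega, fVert_eq hm hjm⟩
      · exact ⟨(2, m - j), by simp only; omega, gVert_eq hm hjm⟩
    · rintro ⟨⟨σ, r⟩, hx, rfl⟩
      simp only at hx
      have e : m - (m - r) = r := by omega
      refine ⟨m - r, by omega, by omega, ?_⟩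
      rw [eVert_eq hm (by omega), fVert_eq hm (by omega), gVert_eq hm (by omega), e]
      fin_cases σ <;> simp
  have hcorner : ∀ x : Fin 3 × ℕ, x.2 < m → ((∀ q ∈ ({cornerA, cornerB n, cornerC n} : Set Plane),
      D ≤ dist (starPt n m x) q) ↔ x.2 ≤ K) := by
    intro x hx
    have hq : (∀ q ∈ ({cornerA, cornerB n, cornerC n} : Set Plane), D ≤ dist (starPt n m x) q) ↔
        ∀ σ, D ≤ gam n m * starDist x (σ, m) := by
      simp only [Set.mem_insert_iff, Set.mem_singleton_iff, forall_eq_or_imp, forall_eq,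
        cornerA_eq (n := n) hm, cornerB_eq (n := n) hm, cornerC_eq (n := n) hm,
        dist_starPt hn hm]
      constructor
      · rintro ⟨a, b, c⟩ σ
        fin_cases σ <;> assumption
      · intro h
        exact ⟨h 0, h 1, h 2⟩
    rw [hq]
    have hxm : (x.2 : ℝ) < m := by exact_mod_cast hx
    constructor
    · intro h
      have h3 := h x.1
      rw [starDist, if_pos rfl, abs_sub_comm, abs_of_pos (by simpa using hxm)] at h3
      simp only at h3
      by_contra hc
      push Not at hc
      have hc' : (K : ℝ) + 1 ≤ x.2 := by exact_mod_cast hc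
      nlinarith
    · intro h σ
      have h' : (x.2 : ℝ) ≤ K := by exact_mod_cast h
      have h3 := le_starDist x (σ, m)
      rw [abs_sub_comm, abs_of_pos (by simpa using hxm)] at h3
      simp only at h3
      nlinarith
  constructor
  · rintro (h | ⟨h, h'⟩)
    · exact Or.inl h
    · obtain ⟨x, hx, rfl⟩ := hinternal.1 h
      exact Or.inr ⟨x, (hcorner x hx).1 h', rfl⟩
  · rintro (h | ⟨x, hx, rfl⟩)
    · exact Or.inl h
    · exact Or.inr ⟨hinternal.2 ⟨x, by omega, rfl⟩, (hcorner x (by omega)).2 hx⟩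

lemma starPt_not_mem_base {n m : ℕ} (hn : 0 < n) {x : Fin 3 × ℕ} (hx : x.2 < m) :
    starPt n m x ∉ baseVertices n := by
  have hm : 0 < m := by omega
  have hg := gam_pos hn hm
  have hs : 0 < √3 := by positivity
  have h3 : √3 * √3 = 3 := Real.mul_self_sqrt (by norm_num)
  intro h
  obtain ⟨i, hi, h⟩ := (mem_baseVertices_iff hn).1 h
  obtain ⟨s, hs'⟩ := exists_onSide n i
  have h0 := height_bp_of_onSide hn hs'
  rw [← h] at h0
  have hc := cast_eq_gam (n := n) hm
  have hxm : (x.2 : ℝ) < m := by exact_mod_cast hx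
  have k1 : 0 < (m - x.2) * gam n m := mul_pos (by linarith) hg
  have k2 : 0 ≤ x.2 * gam n m := by positivity
  have e1 : √3 * (n : ℝ) = 3 * (m * gam n m) := by rw [hc, ← mul_assoc, h3]
  have hne : ∀ t : Fin 3, 0 < height n t (toC (starPt n m x)) := by
    obtain ⟨σ, r⟩ := x
    simp only at k1 k2
    intro t
    have e2 : √3 * (√3 / 2 * (r * gam n m)) = 3 / 2 * (r * gam n m) := by
      linear_combination (r * gam n m / 2) * h3
    fin_cases t <;> fin_cases σ <;>
      simp only [Fin.mk_one, Fin.zero_eta, Fin.reduceFinMk, height_zero, height_one, height_two,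
        toC_re, toC_im, starPt, Matrix.cons_val_zero, Matrix.cons_val_one, Matrix.cons_val] <;>
      nlinarith
  exact (hne s).ne' h0

/-- The center carries three labels, one for each leg; all other labels are unique. -/
lemma starPt_injOn {n m : ℕ} (hn : 0 < n) (hm : 0 < m) {x y : Fin 3 × ℕ} (hx : 1 ≤ x.2)
    (h : starPt n m x = starPt n m y) : x = y := by
  have hg := gam_pos hn hm
  have h0 := dist_starPt hn hm x y
  rw [h, dist_self] at h0
  have h1 : starDist x y = 0 := by
    rcases mul_eq_zero.1 h0.symm with h | h
    · exact absurd h hg.ne'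
    · exact h
  unfold starDist at h1
  have hx' : (1 : ℝ) ≤ x.2 := by exact_mod_cast hx
  split_ifs at h1 with h2
  · have : (x.2 : ℝ) = y.2 := by linarith [abs_eq_zero.1 h1]
    exact Prod.ext h2 (by exact_mod_cast this)
  · rw [Real.sqrt_eq_zero (by positivity)] at h1
    have : (0 : ℝ) ≤ x.2 * y.2 := by positivity
    nlinarith

lemma tourLength_map_starPt {n m : ℕ} (hn : 0 < n) (hm : 0 < m) (W : List (Fin 3 × ℕ)) :
    tourLength (W.map (starPt n m)) =
      gam n m * ((cyclicPairs W).map fun e => starDist e.1 e.2).sum := by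
  rw [tourLength, ← List.map_rotate, List.zipWith_map, ← List.sum_map_mul_left, cyclicPairs,
    List.map_zip_eq_zipWith]
  congr 1
  congr 1
  funext x y
  exact dist_starPt hn hm x y

/-! ### Trips with end vertices on the side `c` -/

/-- The detour of going from `p` to `q` via a point of the side `c`, if the direction from `p`
to `q` is steep. -/
lemma detour {u p q : Plane} (hu : u 1 = 0) (hp : 0 < p 1) (hpq : p 1 ≤ q 1)
    (hsteep : (p 0 - q 0) ^ 2 ≤ 3 * (p 1 - q 1) ^ 2) :
    dist p q + p 1 < dist u p + dist u q := by
  have h1 : dist u p = dist (!₂[p 0, -p 1] : Plane) u := by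
    rw [dist_plane, dist_plane, hu]
    congr 1
    simp
    ring
  have h2 := dist_triangle (!₂[p 0, -p 1] : Plane) u q
  have h3 : dist p q ≤ 2 * (q 1 - p 1) := by
    rw [dist_plane, Real.sqrt_le_left (by linarith)]
    nlinarith
  have h4 : dist p q ^ 2 = (p 0 - q 0) ^ 2 + (p 1 - q 1) ^ 2 := by
    rw [dist_plane, Real.sq_sqrt (by positivity)]
  -- The squared distance from the mirror image exceeds that from `p` by `4 * p 1 * q 1`, while
  -- steepness gives `dist p q ≤ 2 * (q 1 - p 1)`.
  have h5 : dist p q + p 1 < dist (!₂[p 0, -p 1] : Plane) q := by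
    rw [dist_plane (!₂[p 0, -p 1] : Plane)]
    apply Real.lt_sqrt_of_sq_lt
    simp
    nlinarith
  linarith

lemma detour_of_le {u p q : Plane} {h : ℝ} (hu : u 1 = 0) (h0 : 0 < h) (hp : h ≤ p 1)
    (hq : h ≤ q 1) (hsteep : (p 0 - q 0) ^ 2 ≤ 3 * (p 1 - q 1) ^ 2) :
    dist p q + h < dist u p + dist u q := by
  rcases le_total (p 1) (q 1) with hpq | hpq
  · linarith [detour hu (h0.trans_le hp) hpq hsteep]
  · have := detour (p := q) (q := p) hu (h0.trans_le hq) hpq (by nlinarith)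
    rw [dist_comm q p] at this
    linarith

lemma le_starPt_one {n m K : ℕ} (hg : 0 < gam n m) {x : Fin 3 × ℕ} (hx : x.2 ≤ K) :
    ((m : ℝ) - K) * gam n m / 2 ≤ starPt n m x 1 := by
  obtain ⟨σ, r⟩ := x
  have hr : (r : ℝ) ≤ K := by exact_mod_cast hx
  have h1 : (r : ℝ) * gam n m ≤ K * gam n m := mul_le_mul_of_nonneg_right hr hg.le
  have h2 : 0 ≤ (r : ℝ) * gam n m := by positivity
  fin_cases σ <;> simp [starPt] <;> nlinarith

/-- The connection vertices are joined in a steep direction unless they lie on the two legs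
next to the side `c`. -/
lemma steep_or (n m : ℕ) (x y : Fin 3 × ℕ) :
    (starPt n m x 0 - starPt n m y 0) ^ 2 ≤ 3 * (starPt n m x 1 - starPt n m y 1) ^ 2 ∨
      (1 ≤ x.2 ∧ 1 ≤ y.2 ∧ ((x.1 = 0 ∧ y.1 = 1) ∨ (x.1 = 1 ∧ y.1 = 0))) := by
  obtain ⟨σ, r⟩ := x
  obtain ⟨τ, s⟩ := y
  have h3 : √3 ^ 2 = 3 := Real.sq_sqrt (by norm_num)
  rcases Nat.eq_zero_or_pos r with hr | hr
  · left
    subst hr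
    fin_cases τ <;> simp [starPt] <;> nlinarith [sq_nonneg ((s : ℝ) * gam n m)]
  rcases Nat.eq_zero_or_pos s with hs | hs
  · left
    subst hs
    fin_cases σ <;> simp [starPt] <;> nlinarith [sq_nonneg ((r : ℝ) * gam n m)]
  by_cases h : (σ = 0 ∧ τ = 1) ∨ (σ = 1 ∧ τ = 0)
  · exact Or.inr ⟨hr, hs, h⟩
  left
  have hrs : 0 ≤ ((r : ℝ) * gam n m) * (s * gam n m) := by
    have : ((r : ℝ) * gam n m) * (s * gam n m) = r * s * gam n m ^ 2 := by ring
    rw [this]; positivity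
  have q1 := sq_nonneg ((r : ℝ) * gam n m)
  have q2 := sq_nonneg ((s : ℝ) * gam n m)
  fin_cases σ <;> fin_cases τ <;> simp [starPt] at h ⊢ <;> nlinarith

/-- A nonempty proper subset of the star has a neighbour outside. -/
lemma exists_star_boundary {K : ℕ} {S : Fin 3 × ℕ → Prop}
    (h0 : ∀ σ τ, S (σ, 0) → S (τ, 0)) (h1 : ∃ x : Fin 3 × ℕ, x.2 ≤ K ∧ S x)
    (h2 : ∃ x : Fin 3 × ℕ, x.2 ≤ K ∧ ¬ S x) :
    ∃ x y : Fin 3 × ℕ, x.2 ≤ K ∧ y.2 ≤ K ∧ S x ∧ ¬ S y ∧ starDist x y = 1 := by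
  by_contra hcon
  push Not at hcon
  have hd : ∀ σ r, starDist (σ, r) (σ, r + 1) = 1 := fun σ r => by simp [starDist]
  have hd' : ∀ σ r, starDist (σ, r + 1) (σ, r) = 1 := fun σ r => by simp [starDist]
  have up : ∀ σ r, r + 1 ≤ K → S (σ, r) → S (σ, r + 1) := fun σ r hr hS => by
    by_contra h
    exact hcon (σ, r) (σ, r + 1) (by simp only; omega) hr hS h (hd σ r)
  have down : ∀ σ r, r + 1 ≤ K → S (σ, r + 1) → S (σ, r) := fun σ r hr hS => by
    by_contra h
    exact hcon (σ, r + 1) (σ, r) hr (by simp only; omega) hS h (hd' σ r)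
  obtain ⟨⟨σ, r⟩, hr, hS⟩ := h1
  have hM : S (σ, 0) := by
    clear h2
    induction r with
    | zero => exact hS
    | succ r ih => exact ih (by simp only at hr ⊢; omega) (down σ r hr hS)
  obtain ⟨⟨τ, s⟩, hs, hS'⟩ := h2
  apply hS'
  clear hS'
  induction s with
  | zero => exact h0 σ τ hM
  | succ s ih => exact up τ s hs (ih (by simp only at hs ⊢; omega))

/-! ### A competing tour with a single trip. -/

lemma pathLength_map_range_le {f : ℕ → Plane} {c : ℝ} (k : ℕ)
    (h : ∀ i < k, dist (f i) (f (i + 1)) ≤ c) :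
    pathLength ((List.range (k + 1)).map f) ≤ k * c := by
  induction k with
  | zero => simp [pathLength]
  | succ k ih =>
    have h1 := ih fun i hi => h i (by omega)
    rw [List.range_succ, List.map_append, pathLength_append (by simp) (by simp)]
    have h2 := h k (by omega)
    have h3 : ((List.range (k + 1)).map f).getLast (by simp) = f k := by
      simp [List.range_succ]
    rw [h3]
    simp only [List.map_cons, List.map_nil, List.head_cons, pathLength]
    push_cast
    linarith

/-- The labels of a path through the star from the end of `e` to the end of `f`. -/
def starPath (K : ℕ) : List (Fin 3 × ℕ) :=
  (List.range (K + 1)).map (fun i => ((0 : Fin 3), K - i)) ++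
    ((List.range K).map (fun i => ((2 : Fin 3), i + 1)) ++
      (List.range K).map (fun i => ((1 : Fin 3), i + 1)))

lemma nodup_starPath (K : ℕ) : (starPath K).Nodup := by
  unfold starPath
  refine List.Nodup.append ?_ (List.Nodup.append ?_ ?_ ?_) ?_
  · refine List.Nodup.map_on ?_ List.nodup_range
    intro i hi j hj h
    simp only [List.mem_range, Prod.mk.injEq, true_and] at hi hj h
    omega
  · exact List.Nodup.map (fun i j h => by simpa using h) List.nodup_range
  · exact List.Nodup.map (fun i j h => by simpa using h) List.nodup_range
  · intro x hx hy
    simp only [List.mem_map] at hx hy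
    obtain ⟨i, -, rfl⟩ := hx
    obtain ⟨j, -, h⟩ := hy
    simp at h
  · intro x hx hy
    simp only [List.mem_map, List.mem_append] at hx hy
    obtain ⟨i, -, rfl⟩ := hx
    rcases hy with ⟨j, -, h⟩ | ⟨j, -, h⟩ <;> simp at h

lemma mem_starPath {K : ℕ} {x : Fin 3 × ℕ} :
    x ∈ starPath K ↔ x.2 ≤ K ∧ (x.1 = 0 ∨ 1 ≤ x.2) := by
  obtain ⟨σ, r⟩ := x
  simp only [starPath, List.mem_append, List.mem_map, List.mem_range, Prod.mk.injEq]
  constructor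
  · rintro (⟨i, hi, rfl, rfl⟩ | ⟨i, hi, rfl, rfl⟩ | ⟨i, hi, rfl, rfl⟩)
    · exact ⟨by omega, Or.inl rfl⟩
    · exact ⟨by omega, Or.inr (by omega)⟩
    · exact ⟨by omega, Or.inr (by omega)⟩
  · rintro ⟨h1, h2⟩
    fin_cases σ
    · exact Or.inl ⟨K - r, by omega, rfl, by omega⟩
    · simp only [Fin.mk_one, Fin.isValue, one_ne_zero, false_or] at h2
      exact Or.inr (Or.inr ⟨r - 1, by omega, rfl, by omega⟩)
    · simp only [Fin.reduceFinMk, Fin.isValue, Fin.reduceEq, false_or] at h2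
      exact Or.inr (Or.inl ⟨r - 1, by omega, rfl, by omega⟩)

/-- The path follows `e` to the center, then `g` outwards, and jumps from the end of `g` to the
first vertex of `f`. The jump costs at most `K + 1` units; the other steps cost `3 K - 1` units. -/
lemma pathLength_starPath_le {n m K : ℕ} (hn : 0 < n) (hm : 0 < m) (hK : 1 ≤ K) :
    pathLength ((starPath K).map (starPt n m)) ≤ 4 * K * gam n m := by
  have hg := gam_pos hn hm
  obtain ⟨k, rfl⟩ : ∃ k, K = k + 1 := ⟨K - 1, by omega⟩
  unfold starPath
  rw [List.map_append, List.map_append, List.map_map, List.map_map, List.map_map,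
    pathLength_append (by simp) (by simp), pathLength_append (by simp) (by simp)]
  have l1 := pathLength_map_range_le (f := starPt n m ∘ fun i => ((0 : Fin 3), k + 1 - i))
    (c := gam n m) (k + 1) (fun i hi => by
      simp only [Function.comp_apply]
      rw [dist_starPt hn hm, starDist, if_pos rfl, Nat.cast_sub (by omega), Nat.cast_sub (by omega)]
      simp)
  have l2 := pathLength_map_range_le (f := starPt n m ∘ fun i => ((2 : Fin 3), i + 1))
    (c := gam n m) k (fun i hi => by
      simp only [Function.comp_apply]
      rw [dist_starPt hn hm, starDist, if_pos rfl]
      simp)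
  have l3 := pathLength_map_range_le (f := starPt n m ∘ fun i => ((1 : Fin 3), i + 1))
    (c := gam n m) k (fun i hi => by
      simp only [Function.comp_apply]
      rw [dist_starPt hn hm, starDist, if_pos rfl]
      simp)
  have e1 : ((List.range (k + 1 + 1)).map (starPt n m ∘ fun i => ((0 : Fin 3), k + 1 - i))).getLast
      (by simp) = starPt n m (0, 0) := by
    simp [List.range_succ]
  have e2 : ((List.range (k + 1)).map (starPt n m ∘ fun i => ((2 : Fin 3), i + 1))).getLast
      (by simp) = starPt n m (2, k + 1) := by
    simp [List.range_succ]
  have e3 : ((List.range (k + 1)).map (starPt n m ∘ fun i => ((1 : Fin 3), i + 1))).head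
      (by simp) = starPt n m (1, 1) := by
    simp [List.range_succ_eq_map]
  have e4 : (((List.range (k + 1)).map (starPt n m ∘ fun i => ((2 : Fin 3), i + 1))) ++
      ((List.range (k + 1)).map (starPt n m ∘ fun i => ((1 : Fin 3), i + 1)))).head
      (by simp) = starPt n m (2, 1) := by
    simp [List.range_succ_eq_map]
  rw [e1, e2, e3, e4, starPt_zero n m 0 2, dist_starPt hn hm, dist_starPt hn hm]
  have d1 : starDist ((2 : Fin 3), 0) (2, 1) = 1 := by simp [starDist]
  have d2 : starDist ((2 : Fin 3), k + 1) (1, 1) ≤ k + 2 := by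
    have hk : (0 : ℝ) ≤ k := by positivity
    simp only [starDist, Fin.isValue, Fin.reduceEq, if_false]
    rw [Real.sqrt_le_left (by positivity)]
    push_cast
    nlinarith
  rw [d1]
  have := mul_le_mul_of_nonneg_left d2 hg.le
  push_cast at *
  nlinarith

/-- Splitting the base cycle in the middle of the side `c`. -/
lemma exists_split_baseCycle {n : ℕ} (hn : 3 ≤ n) :
    ∃ Y : List Plane, ∃ hY : Y ≠ [], Y ~r baseCycle n ∧ Y.head hY = cVert (n / 2 + 1) ∧
      Y.getLast hY = cVert (n / 2) := by
  obtain ⟨k, hk⟩ : ∃ k, 3 * n = (n / 2 + 1) + (k + 1) := ⟨3 * n - (n / 2 + 1) - 1, by omega⟩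
  refine ⟨((List.range (k + 1)).map (n / 2 + 1 + ·)).map (bp n) ++
    (List.range (n / 2 + 1)).map (bp n), by simp, ?_, ?_, ?_⟩
  · have e : List.range (n / 2 + 1 + (k + 1)) = List.range (n / 2 + 1) ++
        (List.range (k + 1)).map (n / 2 + 1 + ·) := List.range_add
    rw [baseCycle_eq_map_range, hk, e, List.map_append]
    exact List.isRotated_append
  · rw [List.head_append_of_ne_nil (by simp)]
    simp [List.range_succ_eq_map, bp]
    omega
  · rw [List.getLast_append_of_ne_nil _ (by simp)]
    simp [List.range_succ, bp]
    omega

lemma sqrt_add_sq_le {x h c : ℝ} (hc : 0 < c) (hx : c ≤ x) :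
    √(x ^ 2 + h ^ 2) ≤ x + h ^ 2 / (2 * c) := by
  have h1 : 0 ≤ h ^ 2 / (2 * c) := by positivity
  rw [Real.sqrt_le_left (by linarith)]
  have h2 : c * (h ^ 2 / (2 * c)) = h ^ 2 / 2 := by field_simp
  nlinarith

/-- The numerical comparison behind the single-trip case. -/
lemma single_trip_bound {n m K : ℕ} (hn : 40 ≤ n) (hm : 22 ≤ m)
    (h1 : max 10 (4 + 4 * gam n m) ≤ ((m : ℝ) - K) * gam n m)
    (h2 : ((m : ℝ) - K) * gam n m < max 10 (4 + 4 * gam n m) + gam n m) :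
    dist (cVert (n / 2)) (starPt n m (0, K)) + dist (starPt n m (1, K)) (cVert (n / 2 + 1)) ≤
      √3 * (K * gam n m) - 1 + ((m : ℝ) - K) * gam n m / 2 - gam n m / 2 := by
  obtain ⟨hg, h23, h22⟩ := size_facts hn hm
  have hs : 1.732 < √3 := Real.lt_sqrt_of_sq_lt (by norm_num)
  obtain ⟨h, hh⟩ : ∃ h : ℝ, h = ((m : ℝ) - K) * gam n m / 2 := ⟨_, rfl⟩
  obtain ⟨a, ha⟩ : ∃ a : ℝ, a = √3 / 2 * (K * gam n m) := ⟨_, rfl⟩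
  have hL : K * gam n m = m * gam n m - 2 * h := by rw [hh]; ring
  have h10 : 10 ≤ 2 * h := by
    have := le_max_left 10 (4 + 4 * gam n m)
    linarith
  have h4 : 4 + 4 * gam n m ≤ 2 * h := by
    have := le_max_right 10 (4 + 4 * gam n m)
    linarith
  -- The star is wide compared with the distance `h` of its lower ends from `c`; this uses the lower
  -- bounds on `n` and `m` through `h23` and `h22`.
  have hc : 4 * h / 3 ≤ a - 1 := by
    have hLnn : 0 ≤ K * gam n m := by positivity
    have hal : 0.866 * (K * gam n m) ≤ a := by rw [ha]; nlinarith
    rcases max_choice 10 (4 + 4 * gam n m) with h | h <;> rw [h] at h2 <;> linarith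
  have hc0 : 0 < a - 1 := by linarith
  have hi1 : ((n / 2 : ℕ) : ℝ) ≤ n / 2 := Nat.cast_div_le
  have hi2 : (n : ℝ) / 2 - 1 / 2 ≤ ((n / 2 : ℕ) : ℝ) := by
    have : n ≤ 2 * (n / 2) + 1 := by omega
    have : (n : ℝ) ≤ 2 * ((n / 2 : ℕ) : ℝ) + 1 := by exact_mod_cast this
    linarith
  have d1 : dist (cVert (n / 2)) (starPt n m (0, K)) =
      √((((n / 2 : ℕ) : ℝ) - n / 2 + a) ^ 2 + h ^ 2) := by
    rw [dist_plane, ha, hh]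
    congr 1
    simp only [cVert, starPt, Matrix.cons_val_zero, Matrix.cons_val_one]
    ring
  have d2 : dist (starPt n m (1, K)) (cVert (n / 2 + 1)) =
      √(((n : ℝ) / 2 + a - ((n / 2 : ℕ) : ℝ) - 1) ^ 2 + h ^ 2) := by
    rw [dist_plane, ha, hh]
    congr 1
    simp only [cVert, starPt, Matrix.cons_val_zero, Matrix.cons_val_one]
    push_cast
    ring
  rw [d1, d2]
  have e1 := sqrt_add_sq_le (x := ((n / 2 : ℕ) : ℝ) - n / 2 + a) (h := h) hc0 (by linarith)
  have e2 := sqrt_add_sq_le (x := (n : ℝ) / 2 + a - ((n / 2 : ℕ) : ℝ) - 1) (h := h) hc0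
    (by linarith)
  have e3 : h ^ 2 / (2 * (a - 1)) + h ^ 2 / (2 * (a - 1)) = h ^ 2 / (a - 1) := by field_simp; ring
  -- By `hc` the left side is at most `3 * h / 4`, and `4 + 4γ ≤ 2h` makes `γ / 2` at most `h / 4 -
  -- 1 / 2`.
  have e4 : h ^ 2 / (a - 1) ≤ h - gam n m / 2 := by
    rw [div_le_iff₀ hc0]
    have q1 : (3 * h + 2) / 4 ≤ h - gam n m / 2 := by linarith
    nlinarith
  rw [← hh]
  linarith

lemma exists_label {n m K : ℕ} (hn : 0 < n) (hKm : K < m)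
    (h1 : max 10 (4 + 4 * gam n m) ≤ ((m : ℝ) - K) * gam n m)
    (h2 : ((m : ℝ) - K) * gam n m < max 10 (4 + 4 * gam n m) + gam n m) {p : Plane}
    (hp : p ∈ modifiedInstance n m) (hpb : p ∉ baseVertices n) :
    ∃ x : Fin 3 × ℕ, x.2 ≤ K ∧ starPt n m x = p := by
  obtain ⟨x, hx, h⟩ := ((mem_modifiedInstance_iff hn hKm h1 h2).1 hp).resolve_left hpb
  exact ⟨x, hx, h.symm⟩

/-- A closed tour through all internal vertices. -/
lemma le_tourLength_internal {n m K : ℕ} (hn : 0 < n) (hm : 0 < m) (hK : 1 ≤ K) {w : List Plane}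
    (hw : ∀ p ∈ w, ∃ x : Fin 3 × ℕ, x.2 ≤ K ∧ starPt n m x = p)
    (hall : ∀ x : Fin 3 × ℕ, x.2 ≤ K → starPt n m x ∈ w) :
    (4 + √3) * (K * gam n m) - gam n m / 2 ≤ tourLength w := by
  have hg := gam_pos hn hm
  choose! lab hlab using hw
  have hwW : (w.map lab).map (starPt n m) = w := by
    rw [List.map_map]
    nth_rewrite 2 [← List.map_id w]
    exact List.map_congr_left fun p hp => (hlab p hp).2
  have hb := star_tour_bound hK (W := w.map lab) (fun x hx => by
      obtain ⟨p, hp, rfl⟩ := List.mem_map.1 hx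
      exact (hlab p hp).1) (fun σ r h1 h2 => by
      have hp := hall (σ, r) h2
      have := starPt_injOn (x := (σ, r)) hn hm h1 (hlab _ hp).2.symm
      rw [this]
      exact List.mem_map_of_mem hp) (by
      have hp := hall (0, 0) (by simp)
      refine ⟨(lab (starPt n m (0, 0))).1, ?_⟩
      have h0 : (lab (starPt n m (0, 0))).2 = 0 := by
        by_contra hne
        have := starPt_injOn hn hm (by omega) (hlab _ hp).2
        rw [this] at hne
        exact hne rfl
      have : ((lab (starPt n m (0, 0))).1, 0) = lab (starPt n m (0, 0)) := Prod.ext rfl h0.symm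
      rw [this]
      exact List.mem_map_of_mem hp)
  have h := tourLength_map_starPt hn hm (w.map lab)
  rw [hwW] at h
  rw [h]
  have := mul_le_mul_of_nonneg_left hb hg.le
  linarith

/-- The tour with a single trip that leaves and reaches the middle of the side `c`. -/
lemma exists_single_trip_tour {n m K : ℕ} (hn : 40 ≤ n) (hm : 22 ≤ m) (hK : 1 ≤ K) (hKm : K < m)
    (h1 : max 10 (4 + 4 * gam n m) ≤ ((m : ℝ) - K) * gam n m)
    (h2 : ((m : ℝ) - K) * gam n m < max 10 (4 + 4 * gam n m) + gam n m) :
    ∃ l, IsTour (modifiedInstance n m) l ∧ tourLength l ≤ tourLength (baseCycle n) +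
      (4 + √3) * (K * gam n m) - 2 + ((m : ℝ) - K) * gam n m / 2 - gam n m / 2 := by
  have hn0 : 0 < n := by omega
  have hm0 : 0 < m := by omega
  obtain ⟨Y, hY, hYr, hYh, hYl⟩ := exists_split_baseCycle (n := n) (by omega)
  set w := (starPath K).map (starPt n m) with hw
  have hwne : w ≠ [] := by simp [hw, starPath, List.range_succ]
  have hmem : ∀ p, p ∈ w ↔ ∃ x : Fin 3 × ℕ, x.2 ≤ K ∧ p = starPt n m x := by
    intro p
    rw [hw, List.mem_map]
    constructor
    · rintro ⟨x, hx, rfl⟩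
      exact ⟨x, (mem_starPath.1 hx).1, rfl⟩
    · rintro ⟨⟨σ, r⟩, hx, rfl⟩
      rcases Nat.eq_zero_or_pos r with h0 | h0
      · subst h0
        exact ⟨(0, 0), mem_starPath.2 ⟨by simp, Or.inl rfl⟩, starPt_zero n m 0 σ⟩
      · exact ⟨(σ, r), mem_starPath.2 ⟨hx, Or.inr h0⟩, rfl⟩
  refine ⟨w ++ Y, ⟨?_, ?_⟩, ?_⟩
  · refine List.Nodup.append ?_ (hYr.nodup_iff.2 (nodup_baseCycle hn0)) ?_
    · refine List.Nodup.map_on ?_ (nodup_starPath K)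
      intro x hx y hy h
      by_cases hx1 : 1 ≤ x.2
      · exact starPt_injOn hn0 hm0 hx1 h
      by_cases hy1 : 1 ≤ y.2
      · exact (starPt_injOn hn0 hm0 hy1 h.symm).symm
      have hx0 := (mem_starPath.1 hx).2.resolve_right hx1
      have hy0 := (mem_starPath.1 hy).2.resolve_right hy1
      exact Prod.ext (hx0.trans hy0.symm) (by omega)
    · intro p hp hpY
      obtain ⟨x, hx, rfl⟩ := (hmem p).1 hp
      exact starPt_not_mem_base hn0 (by omega) ((mem_baseCycle hn0).1 (hYr.mem_iff.1 hpY))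
  · intro p
    rw [List.mem_append, hmem, mem_modifiedInstance_iff hn0 hKm h1 h2, hYr.mem_iff,
      mem_baseCycle hn0]
    exact or_comm
  · have hb := single_trip_bound hn hm h1 h2
    have hp := pathLength_starPath_le (n := n) (m := m) hn0 hm0 hK
    have hwh : w.head hwne = starPt n m (0, K) := by
      simp [hw, starPath, List.range_succ_eq_map]
    have hwl : w.getLast hwne = starPt n m (1, K) := by
      obtain ⟨k, rfl⟩ : ∃ k, K = k + 1 := ⟨K - 1, by omega⟩
      simp [hw, starPath, List.range_succ]
    have ht := tourLength_eq hY
    rw [tourLength_of_isRotated hYr, hYh, hYl] at ht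
    rw [tourLength_append hwne hY, hwh, hwl, hYh, hYl]
    have hd : dist (cVert (n / 2)) (cVert (n / 2 + 1)) = 1 := by
      rw [dist_plane]
      simp [cVert]
    rw [hd] at ht
    rw [← hw] at hp
    linarith

/-- The connection vertices of a trip at the side `c` lie on the two legs next to this side. -/
lemma connection_side_c {n m K : ℕ} (hn : 40 ≤ n) (hm : 22 ≤ m) (hK : 1 ≤ K) (hKm : K < m)
    (h1 : max 10 (4 + 4 * gam n m) ≤ ((m : ℝ) - K) * gam n m)
    (h2 : ((m : ℝ) - K) * gam n m < max 10 (4 + 4 * gam n m) + gam n m)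
    {l w rest : List Plane} {u v : Plane} (hl : IsOptimumTour (modifiedInstance n m) l)
    (hr : l ~r u :: (w ++ v :: rest)) (hw : w ≠ []) (hwb : ∀ x ∈ w, x ∉ baseVertices n)
    (hu1 : u 1 = 0) (huv : dist u v = 1) :
    ∃ r s, 1 ≤ r ∧ r ≤ K ∧ 1 ≤ s ∧ s ≤ K ∧ ((w.head hw = starPt n m (0, r) ∧ w.getLast hw = starPt n m (1, s)) ∨
      (w.head hw = starPt n m (1, r) ∧ w.getLast hw = starPt n m (0, s))) := by
  obtain ⟨hg, h23, h22⟩ := size_facts hn hm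
  have hn0 : 0 < n := by omega
  have hm0 : 0 < m := by omega
  have hopt : IsOptimumTour (modifiedInstance n m) (w ++ (v :: (rest ++ [u]))) := by
    refine hl.of_isRotated (hr.trans ?_)
    have := List.isRotated_append (l := [u]) (l' := w ++ v :: rest)
    simpa using this
  have hlab : ∀ p ∈ w, ∃ x : Fin 3 × ℕ, x.2 ≤ K ∧ starPt n m x = p := fun p hp =>
    exists_label hn0 hKm h1 h2 ((hopt.1.2 p).1 (List.mem_append_left _ hp)) (hwb p hp)
  obtain ⟨⟨σ, r⟩, hx, hx'⟩ := hlab _ (List.head_mem hw)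
  obtain ⟨⟨τ, s⟩, hy, hy'⟩ := hlab _ (List.getLast_mem hw)
  rcases steep_or n m (σ, r) (τ, s) with hst | ⟨hr1, hs1, h | h⟩
  swap
  · simp only at h
    exact ⟨r, s, hr1, hx, hs1, hy, Or.inl ⟨by rw [← hx', h.1], by rw [← hy', h.2]⟩⟩
  swap
  · simp only at h
    exact ⟨r, s, hr1, hx, hs1, hy, Or.inr ⟨by rw [← hx', h.1], by rw [← hy', h.2]⟩⟩
  exfalso
  have b10 := le_max_left 10 (4 + 4 * gam n m)
  have b4 := le_max_right 10 (4 + 4 * gam n m)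
  obtain ⟨h, hh⟩ : ∃ h : ℝ, h = ((m : ℝ) - K) * gam n m / 2 := ⟨_, rfl⟩
  -- In the remaining steep case, the direct connection of `p` and `q` saves more than `h` against
  -- the way via `u`; replacing `u` by `v` at one end changes this by at most 1.
  have hdet := detour_of_le (h := h) hu1 (by linarith)
    (by rw [hh]; exact le_starPt_one hg hx) (by rw [hh]; exact le_starPt_one hg hy) hst
  rw [hx', hy'] at hdet
  have htri := dist_triangle u v (w.getLast hw)
  rw [huv] at htri
  have c1 := dist_comm (w.getLast hw) v
  have c2 := dist_comm (w.getLast hw) (w.head hw)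
  by_cases hall : ∀ x : Fin 3 × ℕ, x.2 ≤ K → starPt n m x ∈ w
  · have hYb : ∀ p ∈ v :: (rest ++ [u]), p ∈ baseVertices n := by
      intro p hp
      by_contra hpb
      obtain ⟨x, hx, rfl⟩ := exists_label hn0 hKm h1 h2
        ((hopt.1.2 p).1 (List.mem_append_right _ hp)) hpb
      exact (List.nodup_append.1 hopt.1.1).2.2 _ (hall x hx) _ hp rfl
    have hbl : baseList n (w ++ (v :: (rest ++ [u]))) = v :: (rest ++ [u]) := by
      rw [baseList_append]
      have e1 : baseList n w = [] := List.filter_eq_nil_iff.2 (by simpa using hwb)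
      have e2 : baseList n (v :: (rest ++ [u])) = v :: (rest ++ [u]) :=
        List.filter_eq_self.2 (by simpa using hYb)
      rw [e1, e2, List.nil_append]
    -- The rest of the tour consists of base vertices in cyclic order, in one of the two directions,
    -- so closing it gives the boundary of the triangle.
    have hYlen : tourLength (v :: (rest ++ [u])) = tourLength (baseCycle n) := by
      rcases hopt.baseList_isRotated hn0 with h | h
      · rw [hbl] at h
        exact tourLength_of_isRotated h
      · rw [hbl] at h
        rw [← tourLength_reverse, tourLength_of_isRotated h]
    obtain ⟨l', hl', hlen⟩ := exists_single_trip_tour hn hm hK hKm h1 h2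
    have hle := hopt.2 l' hl'
    have hlow := le_tourLength_internal hn0 hm0 hK hlab hall
    rw [tourLength_append hw (by simp)] at hle
    rw [tourLength_eq hw] at hlow
    rw [tourLength_eq (by simp)] at hYlen
    have e1 : (v :: (rest ++ [u])).getLast (by simp) = u := by simp
    rw [e1] at hYlen hle
    simp only [List.head_cons] at hYlen hle
    rw [huv] at hYlen
    linarith
  -- Some internal vertex outside the trip neighbours one inside it. Merging there costs `2γ`, so
  -- altogether `h < 2 + 2γ`, contrary to the distance condition.
  · push Not at hall
    obtain ⟨x, y, hx2, hy2, hxS, hyS, hd⟩ := exists_star_boundary (K := K)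
      (S := fun x => starPt n m x ∈ w) (fun σ τ h => by rw [starPt_zero n m τ σ]; exact h)
      ⟨(σ, r), hx, by rw [hx']; exact List.head_mem hw⟩ hall
    have hyY : starPt n m y ∈ v :: (rest ++ [u]) := by
      have := (hopt.1.2 _).2 ((mem_modifiedInstance_iff hn0 hKm h1 h2).2 (Or.inr ⟨y, hy2, rfl⟩))
      exact (List.mem_append.1 this).resolve_left hyS
    have hmg := hopt.merge hw (by simp) hxS hyY
    have e1 : (v :: (rest ++ [u])).getLast (by simp) = u := by simp
    rw [e1, dist_starPt hn0 hm0, hd] at hmg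
    simp only [List.head_cons] at hmg
    rw [huv] at hmg
    linarith

/-! ### The rotation symmetry -/

/-- The rotation by 120 degrees around the center, mapping `A` to `B`, `B` to `C`, `C` to `A`. -/
noncomputable def rot (n : ℕ) (p : Plane) : Plane :=
  !₂[(n : ℝ) / 2 - (p 0 - n / 2) / 2 - √3 / 2 * (p 1 - n * √3 / 6),
    n * √3 / 6 + √3 / 2 * (p 0 - n / 2) - (p 1 - n * √3 / 6) / 2]

lemma rot_zero (n : ℕ) (p : Plane) : rot n p 0 =
    (n : ℝ) / 2 - (p 0 - n / 2) / 2 - √3 / 2 * (p 1 - n * √3 / 6) := by simp [rot]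

lemma rot_one (n : ℕ) (p : Plane) : rot n p 1 =
    n * √3 / 6 + √3 / 2 * (p 0 - n / 2) - (p 1 - n * √3 / 6) / 2 := by simp [rot]

lemma dist_rot (n : ℕ) (p q : Plane) : dist (rot n p) (rot n q) = dist p q := by
  have h3 : √3 ^ 2 = 3 := Real.sq_sqrt (by norm_num)
  rw [dist_plane, dist_plane]
  simp only [rot_zero, rot_one]
  congr 1
  linear_combination ((p 0 - q 0) ^ 2 + (p 1 - q 1) ^ 2) / 4 * h3

lemma rot_injective (n : ℕ) : Function.Injective (rot n) := fun p q h => by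
  rw [← dist_eq_zero, ← dist_rot n, h, dist_self]

lemma rot_rot_rot (n : ℕ) (p : Plane) : rot n (rot n (rot n p)) = p := by
  have h3 : √3 ^ 2 = 3 := Real.sq_sqrt (by norm_num)
  have h33 : √3 ^ 3 = 3 * √3 := by rw [pow_succ, h3]
  have h34 : √3 ^ 4 = 9 := by rw [show (4 : ℕ) = 2 + 2 from rfl, pow_add, h3]; norm_num
  ext i
  fin_cases i
  · simp only [Fin.zero_eta, Fin.isValue]
    simp only [rot_zero, rot_one]
    ring_nf
    simp only [h3, h33, h34]
    ring
  · simp only [Fin.mk_one, Fin.isValue]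
    simp only [rot_zero, rot_one]
    ring_nf
    simp only [h3, h33]
    ring

lemma rot_combination (n : ℕ) (p q : Plane) {a b : ℝ} (hab : a + b = 1) :
    rot n (a • p + b • q) = a • rot n p + b • rot n q := by
  have hb : b = 1 - a := by linarith
  subst hb
  ext i
  fin_cases i <;> simp [rot] <;> ring

lemma rot_cVert (n i : ℕ) : rot n (cVert i) = aVert n i := by
  have h3 : √3 ^ 2 = 3 := Real.sq_sqrt (by norm_num)
  ext j
  fin_cases j <;> simp [rot, cVert, aVert] <;> ring_nf
  rw [h3]; ring

lemma rot_aVert (n i : ℕ) : rot n (aVert n i) = bVert n i := by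
  have h3 : √3 ^ 2 = 3 := Real.sq_sqrt (by norm_num)
  ext j
  fin_cases j <;> simp [rot, aVert, bVert] <;> ring_nf
  rw [h3]; ring

lemma rot_bVert (n i : ℕ) : rot n (bVert n i) = cVert i := by
  have h3 : √3 ^ 2 = 3 := Real.sq_sqrt (by norm_num)
  ext j
  fin_cases j <;> simp [rot, cVert, bVert] <;> ring_nf
  rw [h3]; ring

lemma rot_starPt {n m : ℕ} (hm : 0 < m) (σ : Fin 3) (r : ℕ) :
    rot n (starPt n m (σ, r)) = starPt n m (σ + 1, r) := by
  have h3 : √3 ^ 2 = 3 := Real.sq_sqrt (by norm_num)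
  have hc := cast_eq_gam (n := n) hm
  have hc' : (m : ℝ) * gam n m = n * √3 / 3 := by
    rw [hc]; linear_combination -((m : ℝ) * gam n m / 3) * h3
  ext j
  fin_cases σ <;> fin_cases j <;> simp [rot, starPt, hc'] <;> ring_nf <;>
    simp only [h3] <;> ring

lemma rot_mem_base {n : ℕ} {p : Plane} (hp : p ∈ baseVertices n) : rot n p ∈ baseVertices n := by
  obtain ⟨i, hi, rfl | rfl | rfl⟩ := hp
  · exact ⟨i, hi, Or.inr (Or.inl (rot_aVert n i))⟩
  · exact ⟨i, hi, Or.inr (Or.inr (rot_bVert n i))⟩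
  · exact ⟨i, hi, Or.inl (rot_cVert n i)⟩

lemma mem_base_of_rot {n : ℕ} {p : Plane} (hp : rot n p ∈ baseVertices n) : p ∈ baseVertices n := by
  rw [← rot_rot_rot n p]
  exact rot_mem_base (rot_mem_base hp)

lemma rot_mem_modified {n m : ℕ} (hn : 40 ≤ n) (hm : 22 ≤ m) {p : Plane}
    (hp : p ∈ modifiedInstance n m) : rot n p ∈ modifiedInstance n m := by
  obtain ⟨K, -, hKm, h1, h2⟩ := exists_radius hn hm
  rw [mem_modifiedInstance_iff (by omega) hKm h1 h2] at hp ⊢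
  rcases hp with hp | ⟨⟨σ, r⟩, hr, rfl⟩
  · exact Or.inl (rot_mem_base hp)
  · exact Or.inr ⟨(σ + 1, r), hr, rot_starPt (by omega) σ r⟩

lemma IsOptimumTour.map_rot {n m : ℕ} (hn : 40 ≤ n) (hm : 22 ≤ m) {l : List Plane}
    (hl : IsOptimumTour (modifiedInstance n m) l) :
    IsOptimumTour (modifiedInstance n m) (l.map (rot n)) := by
  refine ⟨⟨hl.1.1.map (rot_injective n), fun p => ?_⟩, fun l' hl' => ?_⟩
  · rw [List.mem_map]
    constructor
    · rintro ⟨q, hq, rfl⟩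
      exact rot_mem_modified hn hm ((hl.1.2 q).1 hq)
    · intro hp
      exact ⟨rot n (rot n p), (hl.1.2 _).2 (rot_mem_modified hn hm (rot_mem_modified hn hm hp)),
        rot_rot_rot n p⟩
  · have : tourLength (l.map (rot n)) = tourLength l := by
      rw [tourLength, tourLength, ← List.map_rotate, List.zipWith_map]
      simp only [dist_rot]
    rw [this]
    exact hl.2 l' hl'

/-! ### The internal segments -/

/-- The closed leg of the star from a corner to the center. -/
def leg (n m : ℕ) (σ : Fin 3) : Set Plane := segment ℝ (starPt n m (σ, m)) (starPt n m (σ, 0))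

lemma segE_eq {n m : ℕ} (hm : 0 < m) : segE n = leg n m 0 := by
  rw [segE, leg, cornerA_eq (n := n) hm, center_eq hm 0]

lemma segF_eq {n m : ℕ} (hm : 0 < m) : segF n = leg n m 1 := by
  rw [segF, leg, cornerB_eq (n := n) hm, center_eq hm 1]

lemma segG_eq {n m : ℕ} (hm : 0 < m) : segG n = leg n m 2 := by
  rw [segG, leg, cornerC_eq (n := n) hm, center_eq hm 2]

lemma starPt_mem_leg {n m : ℕ} (hm : 0 < m) (σ : Fin 3) {r : ℕ} (hr : r ≤ m) :
    starPt n m (σ, r) ∈ leg n m σ := by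
  have hm' : (0 : ℝ) < m := by exact_mod_cast hm
  have hr' : (r : ℝ) ≤ m := by exact_mod_cast hr
  refine ⟨r / m, 1 - r / m, by positivity, ?_, by ring, ?_⟩
  · rw [sub_nonneg, div_le_one hm']; exact hr'
  · ext j
    fin_cases σ <;> fin_cases j <;> simp [starPt] <;> field_simp <;> ring

lemma rot_mem_leg {n m : ℕ} (hm : 0 < m) {σ : Fin 3} {p : Plane} (hp : p ∈ leg n m σ) :
    rot n p ∈ leg n m (σ + 1) := by
  obtain ⟨a, b, ha, hb, hab, rfl⟩ := hp
  refine ⟨a, b, ha, hb, hab, ?_⟩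
  rw [rot_combination n _ _ hab, rot_starPt hm, rot_starPt hm]

/-- The two points lie strictly to the left and strictly to the right of the vertical line through
the center, and no leg extends to both sides of it. -/
lemma not_common_leg {n m r s : ℕ} (hn : 0 < n) (hm : 0 < m) (hr : 1 ≤ r) (hs : 1 ≤ s)
    (σ : Fin 3) : ¬ (starPt n m (0, r) ∈ leg n m σ ∧ starPt n m (1, s) ∈ leg n m σ) := by
  have hg := gam_pos hn hm
  have hs3 : 0 < √3 := by positivity
  have hr' : 0 < √3 * (r * gam n m) := by
    have : (0 : ℝ) < r := by exact_mod_cast hr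
    positivity
  have hs' : 0 < √3 * (s * gam n m) := by
    have : (0 : ℝ) < s := by exact_mod_cast hs
    positivity
  rintro ⟨⟨a, b, ha, hb, hab, h1⟩, ⟨c, d, hc, hd, hcd, h2⟩⟩
  have e1 := congrArg (fun p : Plane => p 0) h1
  have e2 := congrArg (fun p : Plane => p 0) h2
  have hmg : 0 ≤ √3 * (m * gam n m) := by positivity
  have hb' : b = 1 - a := by linarith
  have hd' : d = 1 - c := by linarith
  subst hb' hd'
  have k1 : 0 ≤ a * (√3 * (m * gam n m)) := by positivity
  have k2 : 0 ≤ c * (√3 * (m * gam n m)) := by positivity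
  fin_cases σ <;> simp [starPt] at e1 e2 <;> nlinarith

/-! ### Trips -/

lemma onSide_succ {n i : ℕ} (hi : i < 3 * n) :
    ∃ s : Fin 3, OnSide n s i ∧ OnSide n s (i + 1) ∧ sidePos n s (i + 1) = sidePos n s i + 1 := by
  have hpos : ∀ s : Fin 3, ¬ (s = 2 ∧ i = 0) → sidePos n s (i + 1) = sidePos n s i + 1 := by
    intro s hs
    rw [sidePos, sidePos, if_neg (by omega), if_neg hs]
    push_cast; ring
  by_cases h1 : i < n
  · exact ⟨0, Or.inl ⟨rfl, by omega⟩, Or.inl ⟨rfl, by omega⟩, hpos 0 (by simp)⟩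
  by_cases h2 : i < 2 * n
  · exact ⟨1, Or.inr (Or.inl ⟨rfl, by omega⟩), Or.inr (Or.inl ⟨rfl, by omega⟩), hpos 1 (by simp)⟩
  · exact ⟨2, Or.inr (Or.inr ⟨rfl, by omega⟩), Or.inr (Or.inr ⟨rfl, by omega⟩),
      hpos 2 (by omega)⟩

lemma dist_eq_dist_toC (p q : Plane) : dist p q = dist (toC p) (toC q) := by
  rw [dist_plane, Complex.dist_eq_re_im]; rfl

lemma dist_bp_succ {n i : ℕ} (hn : 0 < n) (hi : i < 3 * n) : dist (bp n i) (bp n (i + 1)) = 1 := by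
  obtain ⟨s, h1, h2, h3⟩ := onSide_succ hi
  rw [dist_eq_dist_toC, toC_bp_eq hn h1, toC_bp_eq hn h2, h3, dist_comm, dist_eq_norm]
  have e : sideOrigin n s + ((sidePos n s i + 1 : ℝ) : ℂ) * sideDir s -
      (sideOrigin n s + (sidePos n s i : ℂ) * sideDir s) = sideDir s := by push_cast; ring
  rw [e, Complex.norm_def, normSq_sideDir, Real.sqrt_one]

/-- The end vertices of a trip are consecutive base vertices. -/
lemma trip_ends {n m : ℕ} (hn : 0 < n) {l w rest : List Plane} {u v : Plane}
    (hl : IsOptimumTour (modifiedInstance n m) l) (hu : u ∈ baseVertices n)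
    (hv : v ∈ baseVertices n) (hwb : ∀ x ∈ w, x ∉ baseVertices n)
    (hr : l ~r u :: (w ++ v :: rest)) :
    ∃ i < 3 * n, (u = bp n i ∧ v = bp n (i + 1)) ∨ (v = bp n i ∧ u = bp n (i + 1)) := by
  have hbl : baseList n (u :: (w ++ v :: rest)) = u :: v :: baseList n rest := by
    have e1 : w.filter (fun p => @decide (p ∈ baseVertices n) (Classical.propDecidable _)) = [] :=
      List.filter_eq_nil_iff.2 (by simpa using hwb)
    simp [baseList, hu, hv, e1]
  rcases (hl.of_isRotated hr).baseList_isRotated hn with h | h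
  · rw [hbl] at h
    obtain ⟨i, hi, h1, h2⟩ := succ_of_isRotated_baseCycle hn h
    exact ⟨i, hi, Or.inl ⟨h1, h2⟩⟩
  · rw [hbl] at h
    have h' : (v :: u :: (baseList n rest).reverse) ~r baseCycle n := by
      refine List.IsRotated.trans ?_ h
      have := List.isRotated_append (l := [v, u]) (l' := (baseList n rest).reverse)
      simpa using this
    obtain ⟨i, hi, h1, h2⟩ := succ_of_isRotated_baseCycle hn h'
    exact ⟨i, hi, Or.inr ⟨h1, h2⟩⟩

/-- In a tour that visits the base vertices counterclockwise, trips go counterclockwise. -/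
lemma trip_ends_of_ccw {n m : ℕ} (hn : 0 < n) {l w rest : List Plane} {u v : Plane}
    (hl : IsTour (modifiedInstance n m) l) (hc : IsCounterclockwise n l)
    (hu : u ∈ baseVertices n) (hv : v ∈ baseVertices n) (hwb : ∀ x ∈ w, x ∉ baseVertices n)
    (hr : l ~r u :: (w ++ v :: rest)) :
    ∃ i < 3 * n, u = bp n i ∧ v = bp n (i + 1) := by
  have hbl : baseList n (u :: (w ++ v :: rest)) = u :: v :: baseList n rest := by
    have e1 : w.filter (fun p => @decide (p ∈ baseVertices n) (Classical.propDecidable _)) = [] :=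
      List.filter_eq_nil_iff.2 (by simpa using hwb)
    simp [baseList, hu, hv, e1]
  have h := (baseList_isRotated (n := n) hr.symm).trans (hc.baseList_isRotated hn hl)
  rw [hbl] at h
  exact succ_of_isRotated_baseCycle hn h

/-- A trip at the side `c` has no two connection vertices on the same leg. -/
lemma not_common_leg_side_c {n m : ℕ} (hn : 40 ≤ n) (hm : 22 ≤ m) {l w rest : List Plane}
    {u v : Plane} (hl : IsOptimumTour (modifiedInstance n m) l)
    (hr : l ~r u :: (w ++ v :: rest)) (hw : w ≠ []) (hwb : ∀ x ∈ w, x ∉ baseVertices n)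
    (hu1 : u 1 = 0) (huv : dist u v = 1) (σ : Fin 3) :
    ¬ (w.head hw ∈ leg n m σ ∧ w.getLast hw ∈ leg n m σ) := by
  obtain ⟨K, hK, hKm, h1, h2⟩ := exists_radius hn hm
  obtain ⟨r, s, hr1, -, hs1, -, ⟨e1, e2⟩ | ⟨e1, e2⟩⟩ :=
    connection_side_c hn hm hK hKm h1 h2 hl hr hw hwb hu1 huv
  · rw [e1, e2]
    exact not_common_leg (by omega) (by omega) hr1 hs1 σ
  · rw [e1, e2, and_comm]
    exact not_common_leg (by omega) (by omega) hs1 hr1 σ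

/-- Here `k` is the number of rotations that bring the start of the trip to the line of `c`. Each
rotation moves every leg to the next one and preserves optimality. -/
lemma not_common_leg_iterate {n m : ℕ} (hn : 40 ≤ n) (hm : 22 ≤ m) (k : ℕ) {l w rest : List Plane}
    {u v : Plane} (hl : IsOptimumTour (modifiedInstance n m) l)
    (hr : l ~r u :: (w ++ v :: rest)) (hw : w ≠ []) (hwb : ∀ x ∈ w, x ∉ baseVertices n)
    (hu1 : (rot n)^[k] u 1 = 0) (huv : dist u v = 1) (σ : Fin 3) :
    ¬ (w.head hw ∈ leg n m σ ∧ w.getLast hw ∈ leg n m σ) := by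
  induction k generalizing l w rest u v σ with
  | zero => exact not_common_leg_side_c hn hm hl hr hw hwb hu1 huv σ
  | succ k ih =>
    rintro ⟨h1, h2⟩
    have hr' := hr.map (rot n)
    simp only [List.map_cons, List.map_append] at hr'
    refine ih (hl.map_rot hn hm) hr' (by simpa using hw) (fun x hx => ?_) hu1
      (by rw [dist_rot, huv]) (σ + 1) ⟨?_, ?_⟩
    · obtain ⟨y, hy, rfl⟩ := List.mem_map.1 hx
      exact fun h => hwb y hy (mem_base_of_rot h)
    · rw [List.head_map]
      exact rot_mem_leg (by omega) h1
    · rw [List.getLast_map]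
      exact rot_mem_leg (by omega) h2

lemma exists_iterate_rot {n i : ℕ} {s : Fin 3} (hn : 0 < n) (h : OnSide n s i) :
    ∃ k, (rot n)^[k] (bp n i) 1 = 0 := by
  have h3 : √3 ^ 2 = 3 := Real.sq_sqrt (by norm_num)
  have h0 := height_bp_of_onSide hn h
  fin_cases s
  · refine ⟨0, ?_⟩
    simp only [Fin.zero_eta, height_zero] at h0
    exact h0
  · refine ⟨2, ?_⟩
    simp only [Fin.mk_one, height_one, toC_re, toC_im] at h0
    simp only [Function.iterate_succ, Function.iterate_zero, Function.comp_apply, id_eq]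
    rw [rot_one, rot_zero, rot_one]
    linear_combination h0 + (n * √3 / 24 - bp n i 1 / 4) * h3
  · refine ⟨1, ?_⟩
    simp only [Fin.reduceFinMk, height_two, toC_re, toC_im] at h0
    simp only [Function.iterate_succ, Function.iterate_zero, Function.comp_apply, id_eq]
    rw [rot_one]
    linear_combination h0

/-- A trip at the side `c` that starts on the right and ends on the left crosses itself. -/
lemma crossing_at_side_c {n m r s i : ℕ} (hn : 0 < n) (hm : 0 < m) (hr : r < m) (hs : s < m)
    (hr1 : 1 ≤ r) (hs1 : 1 ≤ s) (hi : i + 1 ≤ n) :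
    ¬ Disjoint (segment ℝ (cVert i) (starPt n m (1, r)))
      (segment ℝ (starPt n m (0, s)) (cVert (i + 1))) := by
  have h3 : √3 * √3 = 3 := Real.mul_self_sqrt (by norm_num)
  have hs3 : 0 < √3 := by positivity
  have hg := gam_pos hn hm
  have hc := cast_eq_gam (n := n) hm
  have hrm : (r : ℝ) < m := by exact_mod_cast hr
  have hsm : (s : ℝ) < m := by exact_mod_cast hs
  have hr1' : (1 : ℝ) ≤ r := by exact_mod_cast hr1
  have hs1' : (1 : ℝ) ≤ s := by exact_mod_cast hs1
  have hi' : (i : ℝ) + 1 ≤ n := by exact_mod_cast hi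
  have hi0 : (0 : ℝ) ≤ i := by positivity
  obtain ⟨p, hp⟩ : ∃ p, p = starPt n m (1, r) := ⟨_, rfl⟩
  obtain ⟨q, hq⟩ : ∃ q, q = starPt n m (0, s) := ⟨_, rfl⟩
  rw [← hp, ← hq]
  have hp1 : 0 < p 1 := by
    have : 0 < (m - r) * gam n m := mul_pos (by linarith) hg
    rw [hp]; simp [starPt]; linarith
  have hq1 : 0 < q 1 := by
    have : 0 < (m - s) * gam n m := mul_pos (by linarith) hg
    rw [hq]; simp [starPt]; linarith
  have ep : √3 * p 1 = n - p 0 := by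
    rw [hp]; simp [starPt]; rw [hc]; ring
  have eq : √3 * q 1 = q 0 := by
    rw [hq]; simp [starPt]; rw [hc]; ring
  have hp0 : (n : ℝ) / 2 ≤ p 0 := by
    rw [hp]; simp [starPt]; positivity
  have hq0 : q 0 ≤ (n : ℝ) / 2 := by
    have : 0 ≤ √3 / 2 * (s * gam n m) := by positivity
    rw [hq]; simp [starPt]; linarith
  -- The orientation of `a`, `p`, `q` is affine in `a`, so it suffices that it is nonnegative at `A`
  -- and at `B`; this holds because `p` is on the right half and `q` on the left half.
  have hF : ∀ a : ℝ, 0 ≤ a → a ≤ n → 0 ≤ (p 0 - a) * q 1 - (q 0 - a) * p 1 := by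
    intro a ha0 han
    have k : ((p 0 - a) * q 1 - (q 0 - a) * p 1) * n =
        (n - a) * (q 1 * (2 * p 0 - n)) + a * (p 1 * (n - 2 * q 0)) := by
      have e1 : p 0 = n - √3 * p 1 := by linarith
      rw [e1, ← eq]; ring
    have hn' : (0 : ℝ) < n := by exact_mod_cast hn
    have t1 : 0 ≤ (n - a) * (q 1 * (2 * p 0 - n)) :=
      mul_nonneg (by linarith) (mul_nonneg hq1.le (by linarith))
    have t2 : 0 ≤ a * (p 1 * (n - 2 * q 0)) :=
      mul_nonneg ha0 (mul_nonneg hp1.le (by linarith))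
    exact nonneg_of_mul_nonneg_left (by rw [k]; linarith) hn'
  have hF1 := hF i hi0 (by linarith)
  have hF2 := hF (i + 1) (by linarith) hi'
  -- `Δ` is the determinant of the system for the intersection of the two lines. By `hF` at `i + 1`
  -- and at `i`, it is at least `q 1` and `p 1`, so both parameters lie in `[0, 1]`.
  obtain ⟨Δ, hΔ⟩ : ∃ Δ, Δ = (p 0 - i) * q 1 - (q 0 - (i + 1)) * p 1 := ⟨_, rfl⟩
  have d1 : q 1 ≤ Δ := by rw [hΔ]; linarith
  have d2 : p 1 ≤ Δ := by rw [hΔ]; linarith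
  have hΔ0 : 0 < Δ := hp1.trans_le d2
  rw [Set.not_disjoint_iff]
  refine ⟨(1 - q 1 / Δ) • cVert i + (q 1 / Δ) • p,
    ⟨1 - q 1 / Δ, q 1 / Δ, ?_, by positivity, by ring, rfl⟩,
    ⟨p 1 / Δ, 1 - p 1 / Δ, by positivity, ?_, by ring, ?_⟩⟩
  · rw [sub_nonneg, div_le_one hΔ0]; exact d1
  · rw [sub_nonneg, div_le_one hΔ0]; exact d2
  · ext j
    fin_cases j
    · simp [cVert]
      field_simp
      rw [hΔ]; ring
    · simp [cVert]
      field_simp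

end Tetrahedron

theorem mainTheorem6 (n m : ℕ) (hn : 40 ≤ n) (hm : 22 ≤ m)
    (l : List Tetrahedron.Plane)
    (hl : Tetrahedron.IsOptimumTour (Tetrahedron.modifiedInstance n m) l) :
    -- the counterclockwise orientation can be fixed without loss of generality
    (Tetrahedron.IsCounterclockwise n l ∨ Tetrahedron.IsCounterclockwise n l.reverse) ∧
    ∀ (u : Tetrahedron.Plane) (w : List Tetrahedron.Plane) (v : Tetrahedron.Plane)
      (ht : Tetrahedron.IsTrip n l u w v),
      -- the connection vertices do not lie on a common internal segment
      (∀ S ∈ Tetrahedron.internalSegments n,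
        ¬ (w.head ht.ne_nil ∈ S ∧ w.getLast ht.ne_nil ∈ S)) ∧
      -- a trip with main side `c` enters through `e` and leaves through `f`
      (Tetrahedron.IsCounterclockwise n l →
        Tetrahedron.HasMainSide (Tetrahedron.sideC n) u v →
        w.head ht.ne_nil ∈ Tetrahedron.segE n ∧
          w.getLast ht.ne_nil ∈ Tetrahedron.segF n) := by
  open Tetrahedron in
  have hn0 : 0 < n := by omega
  have hm0 : 0 < m := by omega
  refine ⟨hl.isCounterclockwise_or hn0, fun u w v ht => ⟨?_, ?_⟩⟩
  · obtain ⟨rest, hr⟩ := ht.subpath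
    obtain ⟨i, hi, hends⟩ := trip_ends hn0 hl ht.start_mem ht.end_mem ht.not_base hr
    obtain ⟨s, h1, h2, -⟩ := onSide_succ hi
    have hd := dist_bp_succ hn0 hi
    have key : ∀ σ, ¬ (w.head ht.ne_nil ∈ leg n m σ ∧ w.getLast ht.ne_nil ∈ leg n m σ) := by
      intro σ
      rcases hends with ⟨rfl, rfl⟩ | ⟨rfl, rfl⟩
      · obtain ⟨k, hk⟩ := exists_iterate_rot hn0 h1
        exact not_common_leg_iterate hn hm k hl hr ht.ne_nil ht.not_base hk hd σ
      · obtain ⟨k, hk⟩ := exists_iterate_rot hn0 h2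
        exact not_common_leg_iterate hn hm k hl hr ht.ne_nil ht.not_base hk
          (by rw [dist_comm]; exact hd) σ
    rintro S (rfl | rfl | rfl)
    · rw [segE_eq hm0]; exact key 0
    · rw [segF_eq hm0]; exact key 1
    · rw [segG_eq hm0]; exact key 2
  · intro hc hside
    obtain ⟨rest, hr⟩ := ht.subpath
    obtain ⟨i, hi, hu, hv⟩ := trip_ends_of_ccw hn0 hl.1 hc ht.start_mem ht.end_mem ht.not_base hr
    have hd := dist_bp_succ hn0 hi
    have hline : ∀ p ∈ sideC n, p 1 = 0 := by
      rintro p ⟨a, b, -, -, -, rfl⟩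
      simp [cornerA, cornerB]
    have hu1 := hline u hside.1
    have hv1 := hline v hside.2
    have honu : OnSide n 0 i := onSide_of_height hn0 hi (by rw [height_zero, toC_im, ← hu]; exact hu1)
    have hin : i ≤ n := by
      rcases honu with h | h | h
      · exact h.2
      · exact absurd h.1 (by decide)
      · exact absurd h.1 (by decide)
    have honv : OnSide n 0 (i + 1) :=
      onSide_of_height hn0 (by omega) (by rw [height_zero, toC_im, ← hv]; exact hv1)
    have hin1 : i + 1 ≤ n := by
      rcases honv with h | h | h
      · exact h.2
      · exact absurd h.1 (by decide)
      · exact absurd h.1 (by decide)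
    obtain ⟨K, hK, hKm, h1, h2⟩ := exists_radius hn hm
    obtain ⟨r, s, hr1, hrK, hs1, hsK, ⟨e1, e2⟩ | ⟨e1, e2⟩⟩ :=
      connection_side_c hn hm hK hKm h1 h2 hl hr ht.ne_nil ht.not_base hu1 (by rw [hu, hv]; exact hd)
    · rw [e1, e2, segE_eq hm0, segF_eq hm0]
      exact ⟨starPt_mem_leg hm0 0 (by omega), starPt_mem_leg hm0 1 (by omega)⟩
    -- The order `f`, `e` is excluded: the edge from `u = cVert i` to `f` and the edge from `e` to
    -- `v = cVert (i + 1)` would cross, although they share no end vertex.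
    · exfalso
      have hopt : IsOptimumTour (modifiedInstance n m) (w ++ (v :: (rest ++ [u]))) := by
        refine hl.of_isRotated (hr.trans ?_)
        have := List.isRotated_append (l := [u]) (l' := w ++ v :: rest)
        simpa using this
      have hne : starPt n m (1, r) ≠ starPt n m (0, s) := fun h => by
        have := congrArg Prod.fst (starPt_injOn (x := (1, r)) hn0 hm0 hr1 h)
        simp at this
      have hdis := hopt.disjoint_edges ht.ne_nil (by simp) (by rw [e1, e2]; exact hne)
        (by
          have : dist u v = 1 := by rw [hu, hv]; exact hd
          intro h
          have h' : v = u := by simpa using h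
          rw [h', dist_self] at this
          exact zero_ne_one this) (modified_not_collinear hn0)
      have e3 : (v :: (rest ++ [u])).getLast (by simp) = u := by simp
      rw [e1, e2, e3, List.head_cons] at hdis
      have huc : u = cVert i := by
        rw [hu]; apply toC_injective
        rw [toC_bp_zero hn0 hin]; apply Complex.ext <;> simp [cVert]
      have hvc : v = cVert (i + 1) := by
        rw [hv]; apply toC_injective
        rw [toC_bp_zero hn0 hin1]; apply Complex.ext <;> simp [cVert]
      rw [huc, hvc] at hdis
      exact crossing_at_side_c hn0 hm0 (by omega) (by omega) hr1 hs1 hin1 hdis
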